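/- Let $T$ be a two-dimensional compact torus with Lie algebra $\mathfrak t$, and let $(M,\omega)$ be a compact six-dimensional symplectic manifold with a Hamiltonian $T$-action and moment map $\mu:M\to\mathfrak t^*$, with the sign convention $d\langle\mu,\eta\rangle=\omega(\cdot,X_\eta)$, where $X_\eta$ is the fundamental vector field of $\eta\in\mathfrak t$. Assume that $M$ is a GKM manifold: $M^T$ is finite, and at each fixed point the weights of the isotropy representation (taken with respect to an invariant $\omega$-compatible complex structure) are pairwise linearly independent. Let $\Gamma$ be the GKM graph: its vertices are the fixed points, and its edges are the $T$-invariant embedded two-spheres, each joining the two fixed points it contains. For adjacent vertices $v,w$ let $\alpha_{v,w}\in\mathfrak t^*$ be the weight of $T$ on the tangent plane at $v$ of the sphere joining $v$ to $w$. Fix a generic $\xi\in\mathfrak t$ (no isotropy weight vanishes on $\xi$) and put $\mu_\xi=\langle\mu,\xi\rangle$. An edge from $v$ to $w$ is ascending if $\mu_\xi(v)<\mu_\xi(w)$ and descending if $\mu_\xi(v)>\mu_\xi(w)$; the index of $v$ is twice the number of descending edges starting at $v$. Assume that $\mu_\xi$ is index increasing: the index strictly increases along every ascending edge. Let $H(\Gamma)$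 be the ring of maps $f$ from the vertices to $\mathrm{Sym}(\mathfrak t^*)\cong\mathbb R[x_1,x_2]$ such that $f(v)-f(w)$ is divisible by a nonzero linear form parallel to $\mu(w)-\mu(v)$ whenever $v,w$ are adjacent; $x_1,x_2$ have degree two. For a vertex $p$, the (Guillemin–Zara) equivariant Thom class $\tau_p^+\in H(\Gamma)$ is the homogeneous element whose degree is the index of $p$, which vanishes at every vertex that cannot be reached from $p$ by an ascending path (the trivial path being allowed), and for which $\tau_p^+(p)$ is the product of the weights $\alpha_{p,w}$ over the descending edges from $p$ to $w$. Let $p$ be a vertex of index two and $q$ an adjacent vertex of index four. Let $v\neq p$ be the other vertex adjacent to $q$ with $\mu_\xi(v)<\mu_\xi(q)$, and let $c_{p,q}\in\mathbb R$ be the constant defined by $$\tau_p^+(q)=c_{p,q}\cdot\alpha_{q,v}.$$ Let $\gamma_p$ be the ascending cycle of $p$, i.e. the cycle in $\Gamma$ whose vertices are $p$ and all vertices reachable from $p$ by ascending paths. Suppose that $\gamma_p$ is tetragonal (it has four vertices) and convex, i.e. for each side of the tetragon in $\mathfrak t^*$ with vertices the images under $\mu$ of the vertices of $\gamma_p$,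 in cyclic order, all four vertices lie in one closed half-plane bounded by the line extending that side. Then $c_{p,q}$ is well defined (there is exactly one such real number) and $c_{p,q}>0$. -/

import Mathlib

open scoped Manifold ContDiff

noncomputable section

namespace HamGKM

/-- The two-dimensional compact torus `T = S¹ × S¹`. Its Lie algebra `𝔱` and the dual `𝔱*` are both
written `Fin 2 → ℝ`; the evaluation pairing of `α ∈ 𝔱*` with `ξ ∈ 𝔱` is `α ⬝ᵥ ξ`. -/
abbrev Torus : Type := Circle × Circle

/-- The exponential map `𝔱 → T`, `ξ ↦ (exp (i ξ₀), exp (i ξ₁))`. -/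
def texp (ξ : Fin 2 → ℝ) : Torus := (Circle.exp (ξ 0), Circle.exp (ξ 1))

/-- The linear polynomial `a₀ x₀ + a₁ x₁` in `Sym(𝔱*) = ℝ[x₀, x₁]` belonging to `a ∈ 𝔱*`. -/
def linPoly (a : Fin 2 → ℝ) : MvPolynomial (Fin 2) ℝ :=
  ∑ i, MvPolynomial.C (a i) * MvPolynomial.X i

section Manifold

variable {M : Type*} [TopologicalSpace M] [ChartedSpace (EuclideanSpace ℝ (Fin 6)) M]

variable (M) in
/-- Differential two-forms on the six-dimensional manifold `M`, with no regularity imposed yet. -/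
abbrev TwoForm : Type _ := ∀ x : M, TangentSpace (𝓡 6) x [⋀^Fin 2]→L[ℝ] ℝ

/-- The two-form `Ω` written in the preferred chart at `x₀`, i.e. its pull-back under the inverse
of that chart. -/
def TwoForm.inChart (Ω : TwoForm M) (x₀ : M) (y : EuclideanSpace ℝ (Fin 6)) :
    EuclideanSpace ℝ (Fin 6) [⋀^Fin 2]→L[ℝ] ℝ :=
  (Ω ((extChartAt (𝓡 6) x₀).symm y)).compContinuousLinearMap
    (mfderiv (𝓡 6) (𝓡 6) (extChartAt (𝓡 6) x₀).symm y)

/-- `Ω` is a symplectic form: smooth, closed and nondegenerate. -/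
structure IsSymplectic (Ω : TwoForm M) : Prop where
  smooth : ∀ x₀ : M, ContDiffOn ℝ ∞ (Ω.inChart x₀) (extChartAt (𝓡 6) x₀).target
  closed : ∀ x₀ : M, ∀ y ∈ (extChartAt (𝓡 6) x₀).target, extDeriv (Ω.inChart x₀) y = 0
  nondegenerate : ∀ (x : M) (u : TangentSpace (𝓡 6) x), (∀ v, Ω x ![u, v] = 0) → u = 0

variable [MulAction Torus M]

/-- The differential at `x` of the action of `t ∈ T` on `M`. -/
def dAct (t : Torus) (x : M) : TangentSpace (𝓡 6) x →L[ℝ] TangentSpace (𝓡 6) (t • x) :=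
  mfderiv (𝓡 6) (𝓡 6) (fun y : M => t • y) x

/-- The fundamental vector field of `ξ ∈ 𝔱`: the velocity at time `0` of `s ↦ exp (s ξ) • x`. -/
def fundField (ξ : Fin 2 → ℝ) (x : M) : TangentSpace (𝓡 6) x :=
  mfderiv 𝓘(ℝ, ℝ) (𝓡 6) (fun s : ℝ => texp (s • ξ) • x) 0 (1 : ℝ)

/-- The `T`-action on `(M, Ω)` is Hamiltonian with moment map `μ : M → 𝔱*`. The sign convention
`d⟨μ, ξ⟩ = Ω(·, X_ξ)` is the one for which `⟨μ, ξ⟩` increases, near a fixed point, in the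
directions of the isotropy weights `α` with `⟨α, ξ⟩ > 0`. -/
structure IsHamiltonian (Ω : TwoForm M) (μ : M → Fin 2 → ℝ) : Prop where
  symplectic : IsSymplectic Ω
  action_preserves : ∀ (t : Torus) (x : M) (u v : TangentSpace (𝓡 6) x),
    Ω (t • x) ![dAct t x u, dAct t x v] = Ω x ![u, v]
  smooth_moment : ContMDiff (𝓡 6) 𝓘(ℝ, Fin 2 → ℝ) ∞ μ
  moment_invariant : ∀ (t : Torus) (x : M), μ (t • x) = μ x
  moment_eq : ∀ (ξ : Fin 2 → ℝ) (x : M) (v : TangentSpace (𝓡 6) x),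
    mfderiv (𝓡 6) 𝓘(ℝ, Fin 2 → ℝ) μ x v ⬝ᵥ ξ = Ω x ![v, fundField ξ x]

/-- At a fixed point `x`, the vectors `a, b ∈ T_x M` span a one-dimensional complex
subrepresentation of weight `α`: `exp ξ` acts on `ℝ a ⊕ ℝ b` as multiplication by
`exp (i ⟨α, ξ⟩)`, for the complex structure `J a = b`, `J b = -a`, which is compatible with the
symplectic form since `Ω(a, J a) > 0`. (As `exp ξ • x = x`, both sides are vectors at `x`.) -/
structure IsWeightPlane (Ω : TwoForm M) (x : M) (α : Fin 2 → ℝ)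
    (a b : TangentSpace (𝓡 6) x) : Prop where
  pos : 0 < Ω x ![a, b]
  rot_left : ∀ ξ : Fin 2 → ℝ,
    (dAct (texp ξ) x a : TangentSpace (𝓡 6) x) = Real.cos (α ⬝ᵥ ξ) • a + Real.sin (α ⬝ᵥ ξ) • b
  rot_right : ∀ ξ : Fin 2 → ℝ,
    (dAct (texp ξ) x b : TangentSpace (𝓡 6) x) = -Real.sin (α ⬝ᵥ ξ) • a + Real.cos (α ⬝ᵥ ξ) • b

/-- `α` is a weight of the isotropy representation of `T` at the fixed point `x`. -/
def IsIsotropyWeight (Ω : TwoForm M) (x : M) (α : Fin 2 → ℝ) : Prop :=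
  ∃ a b : TangentSpace (𝓡 6) x, IsWeightPlane Ω x α a b

/-- `α 0, α 1, α 2` are, with multiplicity, the weights of the isotropy representation at the fixed
point `x`: `T_x M` is the `Ω`-orthogonal sum of weight planes of these weights. -/
def IsWeightSystem (Ω : TwoForm M) (x : M) (α : Fin 3 → Fin 2 → ℝ) : Prop :=
  ∃ a b : Fin 3 → TangentSpace (𝓡 6) x,
    (∀ i, IsWeightPlane Ω x (α i) (a i) (b i)) ∧
    (∀ i j, i ≠ j → Ω x ![a i, a j] = 0 ∧ Ω x ![a i, b j] = 0 ∧ Ω x ![b i, b j] = 0) ∧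
    Submodule.span ℝ (Set.range a ∪ Set.range b) = ⊤

/-- `(M, Ω, T)`, with moment map `μ`, is a Hamiltonian GKM manifold: the action is Hamiltonian,
the fixed point set is finite, and the isotropy weights at each fixed point are pairwise linearly
independent. -/
structure IsHamiltonianGKM (Ω : TwoForm M) (μ : M → Fin 2 → ℝ) : Prop where
  hamiltonian : IsHamiltonian Ω μ
  finite_fixed : (MulAction.fixedPoints Torus M).Finite
  independent : ∀ x ∈ MulAction.fixedPoints Torus M, ∃ α : Fin 3 → Fin 2 → ℝ,
    IsWeightSystem Ω x α ∧ ∀ i j, i ≠ j → LinearIndependent ℝ ![α i, α j]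

/-- The embedding `φ` of `S²` parametrizes a `T`-invariant embedded two-sphere in `M` that joins the
two fixed points `v` and `w`. -/
structure IsEdgeSphere (φ : Metric.sphere (0 : EuclideanSpace ℝ (Fin 3)) 1 → M)
    (v w : MulAction.fixedPoints Torus M) : Prop where
  embedding : Manifold.IsSmoothEmbedding (𝓡 2) (𝓡 6) ∞ φ
  invariant : ∀ (t : Torus), ∀ x ∈ Set.range φ, t • x ∈ Set.range φ
  fixed : Set.range φ ∩ MulAction.fixedPoints Torus M = {(v : M), (w : M)}

variable (M) in
/-- The GKM graph `Γ`: its vertices are the fixed points (the vertex `v` is placed at `μ v`), and its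
edges are the `T`-invariant embedded two-spheres, joining the two fixed points on them. -/
def gkmGraph : SimpleGraph (MulAction.fixedPoints Torus M) where
  Adj v w := v ≠ w ∧ ∃ φ, IsEdgeSphere φ v w
  symm := ⟨fun _ _ ⟨h, φ, hφ⟩ => ⟨h.symm, φ, hφ.1, hφ.2, by rw [Set.pair_comm]; exact hφ.3⟩⟩
  loopless := ⟨fun _ h => h.1 rfl⟩

/-- `α` is the weight at `v` of the isotropy representation on the tangent plane `T_v S` of a
sphere `S` that is an edge of `Γ` from `v` to `w`. -/
def IsEdgeWeight (Ω : TwoForm M) (v w : MulAction.fixedPoints Torus M) (α : Fin 2 → ℝ) : Prop :=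
  v ≠ w ∧ ∃ φ, IsEdgeSphere φ v w ∧ ∃ s, φ s = v ∧ ∃ a b : TangentSpace (𝓡 2) s,
    IsWeightPlane Ω (φ s) α (mfderiv (𝓡 2) (𝓡 6) φ s a) (mfderiv (𝓡 2) (𝓡 6) φ s b)

open Classical in
/-- The weight `α_{v,w} ∈ 𝔱*` at `v` of the edge from `v` to `w` (and `0` if there is none). -/
def edgeWeight (Ω : TwoForm M) (v w : MulAction.fixedPoints Torus M) : Fin 2 → ℝ :=
  if h : ∃ α, IsEdgeWeight Ω v w α then h.choose else 0

/-- `ξ ∈ 𝔱` is generic: no isotropy weight at any fixed point vanishes on it. -/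
def IsGeneric (Ω : TwoForm M) (ξ : Fin 2 → ℝ) : Prop :=
  ∀ x ∈ MulAction.fixedPoints Torus M, ∀ α, IsIsotropyWeight Ω x α → α ⬝ᵥ ξ ≠ 0

/-- The edge from `v` to `w` is ascending: `v` and `w` are adjacent and `μ_ξ(v) < μ_ξ(w)`. -/
def Ascends (μ : M → Fin 2 → ℝ) (ξ : Fin 2 → ℝ) (v w : MulAction.fixedPoints Torus M) : Prop :=
  (gkmGraph M).Adj v w ∧ μ v ⬝ᵥ ξ < μ w ⬝ᵥ ξ

/-- The endpoints of the descending edges starting at `v`. -/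
def downNbrs (μ : M → Fin 2 → ℝ) (ξ : Fin 2 → ℝ) (v : MulAction.fixedPoints Torus M) :
    Set (MulAction.fixedPoints Torus M) :=
  {w | Ascends μ ξ w v}

/-- The Morse index of `v` with respect to `μ_ξ`: twice the number of descending edges at `v`. -/
def morseIndex (μ : M → Fin 2 → ℝ) (ξ : Fin 2 → ℝ) (v : MulAction.fixedPoints Torus M) : ℕ :=
  2 * (downNbrs μ ξ v).ncard

/-- `μ_ξ` is index increasing: the index increases strictly along every ascending edge. -/
def IsIndexIncreasing (μ : M → Fin 2 → ℝ) (ξ : Fin 2 → ℝ) : Prop :=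
  ∀ v w, Ascends μ ξ v w → morseIndex μ ξ v < morseIndex μ ξ w

/-- The vertices that can be reached from `v` by an ascending path, `v` itself included. -/
def ascVertices (μ : M → Fin 2 → ℝ) (ξ : Fin 2 → ℝ) (v : MulAction.fixedPoints Torus M) :
    Set (MulAction.fixedPoints Torus M) :=
  {w | Relation.ReflTransGen (Ascends μ ξ) v w}

/-- `f` is an element of the graph cohomology ring `H(Γ)`: along each edge, `f v - f w` is divisible
by a linear polynomial parallel to the edge. -/
def IsGraphClass (μ : M → Fin 2 → ℝ)
    (f : MulAction.fixedPoints Torus M → MvPolynomial (Fin 2) ℝ) : Prop :=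
  ∀ v w, (gkmGraph M).Adj v w → linPoly (μ w - μ v) ∣ f v - f w

/-- `τ` is the equivariant Thom class `τ_p⁺`: the element of `H(Γ)` of degree equal to the index of
`p` (each `xᵢ` has degree two), supported on the vertices reachable from `p` by ascending paths,
whose value at `p` is the product of the weights of the descending edges at `p`. -/
structure IsThomClass (Ω : TwoForm M) (μ : M → Fin 2 → ℝ) (ξ : Fin 2 → ℝ)
    (p : MulAction.fixedPoints Torus M)
    (τ : MulAction.fixedPoints Torus M → MvPolynomial (Fin 2) ℝ) : Prop where
  graphClass : IsGraphClass μ τ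
  homogeneous : ∀ v, (τ v).IsHomogeneous (morseIndex μ ξ p / 2)
  support : ∀ v, τ v ≠ 0 → v ∈ ascVertices μ ξ p
  value : τ p = ∏ᶠ w ∈ downNbrs μ ξ p, linPoly (edgeWeight Ω p w)

/-- For adjacent `p` of index two and `q` of index four, `c` is the constant `c_{p,q}`:
`τ_p⁺(q) = c · α_{q,v}`, where `v ≠ p` is the other vertex adjacent to and below `q`. -/
def IsThomCoefficient (Ω : TwoForm M) (μ : M → Fin 2 → ℝ) (ξ : Fin 2 → ℝ)
    (τ : MulAction.fixedPoints Torus M → MvPolynomial (Fin 2) ℝ)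
    (p q : MulAction.fixedPoints Torus M) (c : ℝ) : Prop :=
  ∃ v, v ≠ p ∧ v ∈ downNbrs μ ξ q ∧ τ q = MvPolynomial.C c * linPoly (edgeWeight Ω q v)

end Manifold

/-- A subset `s` of the plane is in the same side with respect to the straight line `L`: it lies in
one closed half-plane bounded by `L`. -/
def InSameSide (L : AffineSubspace ℝ (Fin 2 → ℝ)) (s : Set (Fin 2 → ℝ)) : Prop :=
  ∀ x ∈ s, ∀ y ∈ s, L.WSameSide x y

/-- The tetragon `ABCD`, with sides `AB`, `BC`, `CD`, `DA`, is convex: its vertices are in the same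
side with respect to the line extending each side. -/
def IsConvexTetragon (A B C D : Fin 2 → ℝ) : Prop :=
  InSameSide (line[ℝ, A, B]) {A, B, C, D} ∧ InSameSide (line[ℝ, B, C]) {A, B, C, D} ∧
  InSameSide (line[ℝ, C, D]) {A, B, C, D} ∧ InSameSide (line[ℝ, D, A]) {A, B, C, D}

section Cycle

variable {M : Type*} [TopologicalSpace M] [ChartedSpace (EuclideanSpace ℝ (Fin 6)) M]
  [MulAction Torus M]

/-- The ascending cycle `γ_p` has the vertices `p, a, b, d` in this cyclic order: these are the
vertices reachable from `p` by ascending paths, they are distinct, and consecutive ones are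
adjacent. So `γ_p` is tetragonal, and `□γ_p` is the tetragon `μ(p) μ(a) μ(b) μ(d)`. -/
structure IsTetragonalCycle (μ : M → Fin 2 → ℝ) (ξ : Fin 2 → ℝ)
    (p a b d : MulAction.fixedPoints Torus M) : Prop where
  vertices : ascVertices μ ξ p = {p, a, b, d}
  card : (ascVertices μ ξ p).ncard = 4
  adj_p_a : (gkmGraph M).Adj p a
  adj_a_b : (gkmGraph M).Adj a b
  adj_b_d : (gkmGraph M).Adj b d
  adj_d_p : (gkmGraph M).Adj d p

/-- The ascending cycle `γ_p` is tetragonal and convex. -/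
def IsConvexTetragonalCycle (μ : M → Fin 2 → ℝ) (ξ : Fin 2 → ℝ)
    (p : MulAction.fixedPoints Torus M) : Prop :=
  ∃ a b d, IsTetragonalCycle μ ξ p a b d ∧ IsConvexTetragon (μ p) (μ a) (μ b) (μ d)

end Cycle

end HamGKM

end

/-! Let `r` be the only vertex below `p`, and let `η = rot α_{p,q}`, which spans the kernel of
`α_{p,q}`. The Thom class has `τ p = α_{p,r}` and `τ q = c α_{q,v}`, and `τ p - τ q` vanishes where
`α_{p,q}` does; hence `⟨α_{p,r}, η⟩ = c ⟨α_{q,v}, η⟩`. So `c > 0` means that the two edges at the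
ends of `pq` that do not belong to the cycle point to the same side of the line through `μ p` and `μ
q`. For the two cycle edges next to `pq`, this is what convexity says.

The two pairs are linked by the circle generated by `η`. It fixes the sphere of `pq` pointwise, and
its isotropy representations form a continuous family along this connected sphere, so negative
weights cannot appear or disappear. Thus the weights of both other edges at `p` are nonnegative on
`η` if and only if those at `q` are, and likewise on `-η`. If the cycle edges agree in sign and the
other two did not, one end would have two equal signs and the other end two opposite ones
(`edgeWeight_mul_pos`). The constant exists because `v` cannot be reached from `p`, by monotonicity
of the index; so `τ v = 0`, and the linear form `τ q` is divisible by `α_{q,v}`.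

Edges are given only as invariant embedded spheres, so the GKM facts about them have to be derived.
The tool is averaging the isotropy action of a circle at its fixed points. The plain average is the
projection `P` onto the fixed vectors. The average against the sawtooth `π - s` is an operator `C`
which is `2π/m` times the complex structure on a plane of weight `m ≠ 0` and kills the fixed
vectors, so that `Ω(u, C u)` records the signs of the weights. From `P` come the pointwise fixing of
spheres (`forall_mem_flowFixed`), the constancy of the number of fixed directions, and the fact that
two spheres through a point with parallel weights coincide as far as needed (`range_subset_range`).
From `C` comes the constancy of signs (`isSawNonneg_of_isSawNonneg`). The moment map equation then
places `μ w - μ v` on the positive ray of the edge weight (`exists_moment_sub_eq_smul`). -/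

open Set Filter Topology
noncomputable section
set_option linter.unusedSectionVars false
namespace HamGKM
-- Differentials of maps of manifolds and their expression in charts
section TangentMap

variable (E F G : Type*) [NormedAddCommGroup E] [NormedSpace ℝ E] [NormedAddCommGroup F]
  [NormedSpace ℝ F] [NormedAddCommGroup G] [NormedSpace ℝ G]
  {M N L : Type*} [TopologicalSpace M] [ChartedSpace E M] [TopologicalSpace N] [ChartedSpace F N]
  [TopologicalSpace L] [ChartedSpace G L]

/-- The differential of a map of manifolds at a point, with the tangent spaces written as the
model spaces. -/
def tderiv (f : M → N) (x : M) : E →L[ℝ] F := mfderiv 𝓘(ℝ, E) 𝓘(ℝ, F) f x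

variable {E F G}

theorem tderiv_comp {g : N → L} {f : M → N} (x : M)
    (hg : MDifferentiableAt 𝓘(ℝ, F) 𝓘(ℝ, G) g (f x))
    (hf : MDifferentiableAt 𝓘(ℝ, E) 𝓘(ℝ, F) f x) :
    tderiv E G (g ∘ f) x = (tderiv F G g (f x)).comp (tderiv E F f x) :=
  mfderiv_comp x hg hf

theorem tderiv_congr {f g : M → N} {x : M} (h : f =ᶠ[𝓝 x] g) :
    tderiv E F f x = tderiv E F g x := by
  have hx : f x = g x := h.eq_of_nhds
  unfold tderiv
  have := h.mfderiv_eq (I := 𝓘(ℝ, E)) (I' := 𝓘(ℝ, F))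
  exact this

theorem tderiv_id (x : M) : tderiv E E (fun y : M => y) x = ContinuousLinearMap.id ℝ E :=
  mfderiv_id

theorem tderiv_const (x : M) (y : N) : tderiv E F (fun _ : M => y) x = 0 :=
  mfderiv_const

theorem tderiv_eq_fderiv (f : E → F) (x : E) : tderiv E F f x = fderiv ℝ f x :=
  mfderiv_eq_fderiv

variable [IsManifold 𝓘(ℝ, E) ∞ M] [IsManifold 𝓘(ℝ, F) ∞ N]

theorem mdifferentiableAt_chart {x₀ x : M} (hx : x ∈ (extChartAt 𝓘(ℝ, E) x₀).source) :
    MDifferentiableAt 𝓘(ℝ, E) 𝓘(ℝ, E) (extChartAt 𝓘(ℝ, E) x₀) x :=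
  (contMDiffAt_extChartAt' (n := ∞) (by simpa using hx)).mdifferentiableAt (by simp)

theorem contMDiffAt_chart_symm {x₀ : M} {y : E} (hy : y ∈ (extChartAt 𝓘(ℝ, E) x₀).target) :
    ContMDiffAt 𝓘(ℝ, E) 𝓘(ℝ, E) ∞ (extChartAt 𝓘(ℝ, E) x₀).symm y :=
  (contMDiffOn_extChartAt_symm x₀).contMDiffAt ((isOpen_extChartAt_target x₀).mem_nhds hy)

theorem mdifferentiableAt_chart_symm {x₀ : M} {y : E}
    (hy : y ∈ (extChartAt 𝓘(ℝ, E) x₀).target) :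
    MDifferentiableAt 𝓘(ℝ, E) 𝓘(ℝ, E) (extChartAt 𝓘(ℝ, E) x₀).symm y :=
  (contMDiffAt_chart_symm hy).mdifferentiableAt (by simp)

theorem tderiv_symm_comp_chart {x₀ x : M} (hx : x ∈ (extChartAt 𝓘(ℝ, E) x₀).source) :
    (tderiv E E (extChartAt 𝓘(ℝ, E) x₀).symm (extChartAt 𝓘(ℝ, E) x₀ x)).comp
      (tderiv E E (extChartAt 𝓘(ℝ, E) x₀) x) = ContinuousLinearMap.id ℝ E := by
  set c := extChartAt 𝓘(ℝ, E) x₀ with hc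
  have hy : c x ∈ c.target := c.map_source hx
  have h := tderiv_comp (g := c.symm) (f := c) x
    (mdifferentiableAt_chart_symm hy) (mdifferentiableAt_chart hx)
  rw [← h, tderiv_congr (g := fun y => y), tderiv_id]
  filter_upwards [(isOpen_extChartAt_source x₀).mem_nhds hx] with y hy
  exact c.left_inv hy

/-- The tangent space at `x` is identified with the model space through the preferred chart at `x`.
Hence derivatives read in that chart, at its centre, are the intrinsic ones. -/
theorem tderiv_chart_self (x : M) :
    tderiv E E (extChartAt 𝓘(ℝ, E) x) x = ContinuousLinearMap.id ℝ E :=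
  haveI : IsManifold 𝓘(ℝ, E) 1 M := IsManifold.of_le (n := ∞) (by simp)
  mfderiv_extChartAt_self

theorem tderiv_chart_symm_self (x : M) :
    tderiv E E (extChartAt 𝓘(ℝ, E) x).symm (extChartAt 𝓘(ℝ, E) x x) =
      ContinuousLinearMap.id ℝ E := by
  have h := tderiv_symm_comp_chart (E := E) (mem_extChartAt_source (I := 𝓘(ℝ, E)) x)
  rwa [tderiv_chart_self, ContinuousLinearMap.comp_id] at h

/-- The differential in charts is the conjugated differential. -/
theorem fderiv_in_charts {f : M → N} {x₀ : M} {z₀ : N} {y : E}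
    (hy : y ∈ (extChartAt 𝓘(ℝ, E) x₀).target)
    (hf : MDifferentiableAt 𝓘(ℝ, E) 𝓘(ℝ, F) f ((extChartAt 𝓘(ℝ, E) x₀).symm y))
    (hz : f ((extChartAt 𝓘(ℝ, E) x₀).symm y) ∈ (extChartAt 𝓘(ℝ, F) z₀).source) :
    fderiv ℝ (fun y => extChartAt 𝓘(ℝ, F) z₀ (f ((extChartAt 𝓘(ℝ, E) x₀).symm y))) y =
      (tderiv F F (extChartAt 𝓘(ℝ, F) z₀) (f ((extChartAt 𝓘(ℝ, E) x₀).symm y))).comp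
        ((tderiv E F f ((extChartAt 𝓘(ℝ, E) x₀).symm y)).comp
          (tderiv E E (extChartAt 𝓘(ℝ, E) x₀).symm y)) := by
  rw [← tderiv_eq_fderiv, ← tderiv_comp y hf (mdifferentiableAt_chart_symm hy)]
  exact tderiv_comp (g := extChartAt 𝓘(ℝ, F) z₀) (f := f ∘ (extChartAt 𝓘(ℝ, E) x₀).symm) y
    (mdifferentiableAt_chart hz) (hf.comp y (mdifferentiableAt_chart_symm hy))

end TangentMap

/-! ### Circle flows and averages of their isotropy action -/

section Flow

variable {E : Type*} [NormedAddCommGroup E] [NormedSpace ℝ E]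
  {M : Type*} [TopologicalSpace M] [ChartedSpace E M]

/-- A smooth action of the circle `ℝ / 2πℤ`, as a `2π`-periodic flow. -/
structure IsCircleFlow (θ : ℝ → M → M) : Prop where
  smooth : ContMDiff (𝓘(ℝ, ℝ).prod 𝓘(ℝ, E)) 𝓘(ℝ, E) ∞ (fun p : ℝ × M => θ p.1 p.2)
  zero : ∀ x, θ 0 x = x
  add : ∀ s t x, θ (s + t) x = θ s (θ t x)
  period : ∀ x, θ (2 * Real.pi) x = x

/-- The points fixed by a flow. -/
def flowFixed (θ : ℝ → M → M) : Set M := {x | ∀ s, θ s x = x}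

/-- A flow, at time `s`, in the chart at `x₀`. -/
def flowInChart (E : Type*) [NormedAddCommGroup E] [NormedSpace ℝ E] [ChartedSpace E M]
    (θ : ℝ → M → M) (x₀ : M) (s : ℝ) (y : E) : E :=
  extChartAt 𝓘(ℝ, E) x₀ (θ s ((extChartAt 𝓘(ℝ, E) x₀).symm y))

variable [IsManifold 𝓘(ℝ, E) ∞ M] {θ : ℝ → M → M}

namespace IsCircleFlow

variable (hθ : IsCircleFlow (E := E) θ)
include hθ

theorem smooth_time (s : ℝ) : ContMDiff 𝓘(ℝ, E) 𝓘(ℝ, E) ∞ (θ s) :=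
  hθ.smooth.comp (contMDiff_const.prodMk contMDiff_id)

theorem mdifferentiableAt (s : ℝ) (x : M) : MDifferentiableAt 𝓘(ℝ, E) 𝓘(ℝ, E) (θ s) x :=
  (hθ.smooth_time s).mdifferentiable (by simp) x

theorem continuous : Continuous fun p : ℝ × M => θ p.1 p.2 := hθ.smooth.continuous

theorem periodic (x : M) : Function.Periodic (fun s => θ s x) (2 * Real.pi) := fun s => by
  simp only [hθ.add, hθ.period]

/-- At a fixed point the whole orbit stays at the centre of the chart, so one chart serves for all
times `s`. Smoothness is joint in time and space, which gives estimates uniform over a period. -/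
theorem contDiffAt_flowInChart {x₀ : M} (hx : x₀ ∈ flowFixed θ) (s : ℝ) :
    ContDiffAt ℝ ∞ (fun p : ℝ × E => flowInChart E θ x₀ p.1 p.2)
      (s, extChartAt 𝓘(ℝ, E) x₀ x₀) := by
  have h1 : ContMDiffAt (𝓘(ℝ, ℝ).prod 𝓘(ℝ, E)) (𝓘(ℝ, ℝ).prod 𝓘(ℝ, E)) ∞
      (fun p : ℝ × E => (p.1, (extChartAt 𝓘(ℝ, E) x₀).symm p.2))
      (s, extChartAt 𝓘(ℝ, E) x₀ x₀) :=
    contMDiffAt_fst.prodMk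
      ((contMDiffAt_chart_symm (mem_extChartAt_target x₀)).comp
        (s, extChartAt 𝓘(ℝ, E) x₀ x₀) contMDiffAt_snd)
  have h2 := (hθ.smooth.contMDiffAt (x := (s, (extChartAt 𝓘(ℝ, E) x₀).symm
    (extChartAt 𝓘(ℝ, E) x₀ x₀)))).comp (s, extChartAt 𝓘(ℝ, E) x₀ x₀) h1
  have h3 : ContMDiffAt 𝓘(ℝ, E) 𝓘(ℝ, E) ∞ (extChartAt 𝓘(ℝ, E) x₀)
      (θ s ((extChartAt 𝓘(ℝ, E) x₀).symm (extChartAt 𝓘(ℝ, E) x₀ x₀))) := by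
    refine contMDiffAt_extChartAt' ?_
    rw [extChartAt_to_inv, hx s]
    exact mem_chart_source _ _
  have h4 := h3.comp (s, extChartAt 𝓘(ℝ, E) x₀ x₀) h2
  rw [← contMDiffAt_iff_contDiffAt, modelWithCornersSelf_prod, ← chartedSpaceSelf_prod]
  exact h4

theorem continuousAt_fderiv_flowInChart {x₀ : M} (hx : x₀ ∈ flowFixed θ) (s : ℝ) :
    ContinuousAt (fun p : ℝ × E => fderiv ℝ (flowInChart E θ x₀ p.1) p.2)
      (s, extChartAt 𝓘(ℝ, E) x₀ x₀) := by
  have h := hθ.contDiffAt_flowInChart hx s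
  have h3 : ContDiffAt ℝ ∞ (Function.uncurry fun (p : ℝ × E) (y : E) =>
      flowInChart E θ x₀ p.1 y) ((s, extChartAt 𝓘(ℝ, E) x₀ x₀), extChartAt 𝓘(ℝ, E) x₀ x₀) := by
    exact ContDiffAt.comp (g := fun p : ℝ × E => flowInChart E θ x₀ p.1 p.2)
      (f := fun q : (ℝ × E) × E => (q.1.1, q.2))
      ((s, extChartAt 𝓘(ℝ, E) x₀ x₀), extChartAt 𝓘(ℝ, E) x₀ x₀) h
      (contDiffAt_fst.fst.prodMk contDiffAt_snd)
  exact (ContDiffAt.fderiv (m := 0) (g := fun p : ℝ × E => p.2) h3 contDiffAt_snd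
    (by simp)).continuousAt

theorem eventually_differentiableAt_flowInChart {x₀ : M} (hx : x₀ ∈ flowFixed θ) (s : ℝ) :
    ∀ᶠ p in 𝓝 (s, extChartAt 𝓘(ℝ, E) x₀ x₀),
      DifferentiableAt ℝ (flowInChart E θ x₀ p.1) p.2 := by
  have h := ((hθ.contDiffAt_flowInChart hx s).of_le (m := 1) (by simp)).eventually (by simp)
  filter_upwards [h] with p hp
  exact (hp.differentiableAt (by simp)).comp (f := fun y : E => (p.1, y)) p.2
    ((differentiableAt_const _).prodMk differentiableAt_id)

theorem fderiv_flowInChart {x₀ x : M} (hx : x ∈ flowFixed θ)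
    (hs : x ∈ (extChartAt 𝓘(ℝ, E) x₀).source) (s : ℝ) :
    fderiv ℝ (flowInChart E θ x₀ s) (extChartAt 𝓘(ℝ, E) x₀ x) =
      (tderiv E E (extChartAt 𝓘(ℝ, E) x₀) x).comp ((tderiv E E (θ s) x).comp
        (tderiv E E (extChartAt 𝓘(ℝ, E) x₀).symm (extChartAt 𝓘(ℝ, E) x₀ x))) := by
  have hl := (extChartAt 𝓘(ℝ, E) x₀).left_inv hs
  have := fderiv_in_charts (f := θ s) (z₀ := x₀) ((extChartAt 𝓘(ℝ, E) x₀).map_source hs)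
    (hθ.mdifferentiableAt s _) (by rw [hl, hx s]; exact hs)
  rw [hl, hx s] at this
  exact this

theorem fderiv_flowInChart_self {x : M} (hx : x ∈ flowFixed θ) (s : ℝ) :
    fderiv ℝ (flowInChart E θ x s) (extChartAt 𝓘(ℝ, E) x x) = tderiv E E (θ s) x := by
  rw [hθ.fderiv_flowInChart hx (mem_extChartAt_source x), tderiv_chart_self,
    tderiv_chart_symm_self]
  rfl

theorem tderiv_add {x : M} (hx : x ∈ flowFixed θ) (s t : ℝ) :
    tderiv E E (θ (s + t)) x = (tderiv E E (θ s) x).comp (tderiv E E (θ t) x) := by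
  have h := tderiv_comp (g := θ s) (f := θ t) x (hθ.mdifferentiableAt s _)
    (hθ.mdifferentiableAt t x)
  rw [hx t] at h
  rw [← h]
  congr 1
  funext y
  exact hθ.add s t y

theorem tderiv_zero (x : M) : tderiv E E (θ 0) x = ContinuousLinearMap.id ℝ E := by
  rw [show θ 0 = fun y => y from funext hθ.zero, tderiv_id]

theorem tderiv_periodic (x : M) :
    Function.Periodic (fun s => tderiv E E (θ s) x) (2 * Real.pi) := fun s => by
  have : θ (s + 2 * Real.pi) = θ s := funext fun y => hθ.periodic y s
  simp only [this]

theorem continuous_tderiv {x : M} (hx : x ∈ flowFixed θ) :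
    Continuous fun s => tderiv E E (θ s) x := by
  simp_rw [← hθ.fderiv_flowInChart_self hx]
  refine continuous_iff_continuousAt.2 fun s => ?_
  exact (hθ.continuousAt_fderiv_flowInChart hx s).comp (f := fun s => (s, extChartAt 𝓘(ℝ, E) x x))
    (by fun_prop)

end IsCircleFlow

/-- The average of the isotropy action of a flow at a fixed point, with weight function `h`. -/
def flowAverage (E : Type*) [NormedAddCommGroup E] [NormedSpace ℝ E] [ChartedSpace E M]
    (θ : ℝ → M → M) (h : ℝ → ℝ) (x : M) : E →L[ℝ] E :=
  ∫ s in (0 : ℝ)..2 * Real.pi, h s • tderiv E E (θ s) x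

namespace IsCircleFlow
variable (hθ : IsCircleFlow (E := E) θ)
include hθ

theorem flowAverage_apply [CompleteSpace E] {h : ℝ → ℝ} (hh : Continuous h) {x : M}
    (hx : x ∈ flowFixed θ) (u : E) :
    flowAverage E θ h x u = ∫ s in (0 : ℝ)..2 * Real.pi, h s • tderiv E E (θ s) x u := by
  have hc := hθ.continuous_tderiv hx
  rw [flowAverage, ContinuousLinearMap.intervalIntegral_apply]
  · rfl
  · exact (hh.smul hc).intervalIntegrable _ _

/-- In a chart, the averages of the isotropy action depend continuously on the fixed point. -/
theorem continuousWithinAt_flowAverage [CompleteSpace E] {h : ℝ → ℝ} (hh : Continuous h) {x₀ : M}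
    (hx₀ : x₀ ∈ flowFixed θ) :
    ContinuousWithinAt (fun x => (tderiv E E (extChartAt 𝓘(ℝ, E) x₀) x).comp
      ((flowAverage E θ h x).comp
        (tderiv E E (extChartAt 𝓘(ℝ, E) x₀).symm (extChartAt 𝓘(ℝ, E) x₀ x))))
      (flowFixed θ) x₀ := by
  set c := extChartAt 𝓘(ℝ, E) x₀ with hc
  set K : ℝ → E → E →L[ℝ] E := fun s y => fderiv ℝ (flowInChart E θ x₀ s) y with hK
  have hsrc : ∀ᶠ x in 𝓝 x₀, x ∈ c.source := extChartAt_source_mem_nhds x₀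
  have hK1 : ∀ x ∈ flowFixed θ, x ∈ c.source → ∀ s, K s (c x) =
      ((ContinuousLinearMap.compL ℝ E E E (tderiv E E c x)).comp
        ((ContinuousLinearMap.compL ℝ E E E).flip (tderiv E E c.symm (c x))))
        (tderiv E E (θ s) x) := fun x hx hs s => by
    rw [hK]
    exact hθ.fderiv_flowInChart hx hs s
  have hKc : ∀ x ∈ flowFixed θ, x ∈ c.source → Continuous fun s => K s (c x) := by
    intro x hx hs
    simp_rw [hK1 x hx hs]
    exact (ContinuousLinearMap.continuous _).comp (hθ.continuous_tderiv hx)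
  have key : ∀ x ∈ flowFixed θ, x ∈ c.source →
      (tderiv E E c x).comp ((flowAverage E θ h x).comp (tderiv E E c.symm (c x))) =
        ∫ s in (0 : ℝ)..2 * Real.pi, h s • K s (c x) := by
    intro x hx hs
    simp_rw [hK1 x hx hs, ← map_smul]
    rw [ContinuousLinearMap.intervalIntegral_comp_comm]
    · rfl
    · exact (hh.smul (hθ.continuous_tderiv hx)).intervalIntegrable _ _
  have hKat : ∀ s, ContinuousAt (fun p : E × ℝ => K p.2 p.1) (c x₀, s) := fun s =>
    ContinuousAt.comp (g := fun p : ℝ × E => fderiv ℝ (flowInChart E θ x₀ p.1) p.2)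
      (f := fun p : E × ℝ => (p.2, p.1)) (x := (c x₀, s))
      (hθ.continuousAt_fderiv_flowInChart hx₀ s) (by fun_prop)
  have hKx₀ := hKc x₀ hx₀ (mem_extChartAt_source x₀)
  -- Domination for the parameter integral: compactness of the period makes the pointwise continuity
  -- in `(y, s)` uniform in `s`.
  have hbound : ∀ᶠ y in 𝓝 (c x₀), ∀ s ∈ Icc (0 : ℝ) (2 * Real.pi),
      ‖K s y‖ ≤ ‖K s (c x₀)‖ + 1 := by
    refine isCompact_Icc.eventually_forall_of_forall_eventually fun s _ => ?_
    have h1 : ContinuousAt (fun p : E × ℝ => ‖K p.2 p.1‖ - ‖K p.2 (c x₀)‖) (c x₀, s) :=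
      (hKat s).norm.sub (hKx₀.norm.comp continuous_snd).continuousAt
    have h2 := h1.eventually_lt_const (u := 1) (by simp)
    filter_upwards [h2] with p hp
    linarith
  -- Only the chart images of fixed points are considered, because continuity of `s ↦ K s y` is
  -- known only there.
  have hce : ContinuousWithinAt (fun y => ∫ s in (0 : ℝ)..2 * Real.pi, h s • K s y)
      {y | y ∈ c.target ∧ c.symm y ∈ flowFixed θ} (c x₀) := by
    refine intervalIntegral.continuousWithinAt_of_dominated_interval
      (bound := fun s => ‖h s‖ * (‖K s (c x₀)‖ + 1)) ?_ ?_ ?_ ?_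
    · filter_upwards [self_mem_nhdsWithin] with y hy
      have := hKc _ hy.2 (c.map_target hy.1)
      rw [c.right_inv hy.1] at this
      exact (hh.smul this).aestronglyMeasurable
    · filter_upwards [mem_nhdsWithin_of_mem_nhds hbound] with x hx
      refine Eventually.of_forall fun s hs => ?_
      rw [norm_smul]
      rw [uIoc_of_le Real.two_pi_pos.le] at hs
      exact mul_le_mul_of_nonneg_left (hx s (Ioc_subset_Icc_self hs)) (norm_nonneg _)
    · exact (hh.norm.mul (hKx₀.norm.add continuous_const)).intervalIntegrable _ _
    · refine Eventually.of_forall fun s _ => ?_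
      have : ContinuousAt (fun y => K s y) (c x₀) :=
        ContinuousAt.comp (g := fun p : E × ℝ => K p.2 p.1) (f := fun y : E => (y, s))
        (x := c x₀) (hKat s) (by fun_prop)
      exact (this.const_smul (h s)).continuousWithinAt
  have hcw : ContinuousWithinAt (fun x => ∫ s in (0 : ℝ)..2 * Real.pi, h s • K s (c x))
      (flowFixed θ ∩ c.source) x₀ := by
    refine ContinuousWithinAt.comp (g := fun y => ∫ s in (0 : ℝ)..2 * Real.pi, h s • K s y) hce
      (continuousAt_extChartAt x₀).continuousWithinAt fun x hx => ⟨c.map_source hx.2, ?_⟩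
    rw [c.left_inv hx.2]
    exact hx.1
  replace hcw := (continuousWithinAt_inter hsrc).1 hcw
  refine hcw.congr_of_eventuallyEq ?_ (key x₀ hx₀ (mem_extChartAt_source x₀))
  filter_upwards [self_mem_nhdsWithin, mem_nhdsWithin_of_mem_nhds hsrc] with x hx hs
  exact key x hx hs

end IsCircleFlow
end Flow

/-! ### The sawtooth detects non-constant periodic functions -/

section PeriodicFunctions

variable {E : Type*} [NormedAddCommGroup E] [NormedSpace ℝ E] [CompleteSpace E]

theorem integral_pi_sub : ∫ s in (0 : ℝ)..2 * Real.pi, (Real.pi - s) = 0 := by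
  rw [intervalIntegral.integral_sub (by simp) (by simp)]
  simp; ring

/-- A periodic function all of whose translates are orthogonal to the sawtooth is constant. -/
theorem eq_mean_of_sawtooth_eq_zero {a : ℝ → E} (ha : Continuous a)
    (hp : Function.Periodic a (2 * Real.pi))
    (h0 : ∀ t, ∫ s in (0 : ℝ)..2 * Real.pi, (Real.pi - s) • a (s + t) = 0) :
    a 0 = (2 * Real.pi)⁻¹ • ∫ s in (0 : ℝ)..2 * Real.pi, a s := by
  set m := ∫ s in (0 : ℝ)..2 * Real.pi, a s with hm
  have hsa : Continuous fun s : ℝ => s • a s := by fun_prop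
  -- With `B t = ∫₀ᵗ s a(s) ds`, the hypothesis at `t` becomes `(π + t) m = B (t + 2π) - B t`.
  -- Differentiating at `t = 0` gives `m = 2π a(2π) = 2π a(0)`.
  have key : ∀ t, (Real.pi + t) • m = (∫ s in (0 : ℝ)..t + 2 * Real.pi, s • a s) -
      ∫ s in (0 : ℝ)..t, s • a s := by
    intro t
    have h := h0 t
    have hsh : ∀ s, (Real.pi - s) • a (s + t) = (Real.pi - (s + t - t)) • a (s + t) := by simp
    simp_rw [hsh] at h
    rw [intervalIntegral.integral_comp_add_right (f := fun s => (Real.pi - (s - t)) • a s) t,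
      zero_add] at h
    have h1 : ∀ s, (Real.pi - (s - t)) • a s = (Real.pi + t) • a s - s • a s := fun s => by
      rw [← sub_smul]; ring_nf
    simp_rw [h1] at h
    have hca : Continuous fun s => (Real.pi + t) • a s := by fun_prop
    rw [intervalIntegral.integral_sub (hca.intervalIntegrable _ _)
      (hsa.intervalIntegrable _ _), intervalIntegral.integral_smul, sub_eq_zero,
      add_comm (2 * Real.pi) t, hp.intervalIntegral_add_eq t 0, zero_add] at h
    rw [hm, h, eq_sub_iff_add_eq, add_comm]
    exact intervalIntegral.integral_add_adjacent_intervals (hsa.intervalIntegrable _ _)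
      (hsa.intervalIntegrable _ _)
  have hB : ∀ t, HasDerivAt (fun u => ∫ s in (0 : ℝ)..u, s • a s) (t • a t) t := fun t =>
    hsa.integral_hasStrictDerivAt 0 t |>.hasDerivAt
  have hL : HasDerivAt (fun t : ℝ => (Real.pi + t) • m) ((1 : ℝ) • m) 0 :=
    ((hasDerivAt_id (0 : ℝ)).const_add Real.pi).smul_const m
  have hR : HasDerivAt (fun t : ℝ => (∫ s in (0 : ℝ)..t + 2 * Real.pi, s • a s) -
      ∫ s in (0 : ℝ)..t, s • a s) ((0 + 2 * Real.pi) • a (0 + 2 * Real.pi) - (0 : ℝ) • a 0) 0 :=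
    ((hB (0 + 2 * Real.pi)).comp_add_const 0 (2 * Real.pi)).sub (hB 0)
  have h := hL.unique (hR.congr_of_eventuallyEq (Eventually.of_forall key))
  have hp0 := hp 0
  rw [hp0, one_smul, zero_add, zero_smul, sub_zero] at h
  rw [h, smul_smul, inv_mul_cancel₀ Real.two_pi_pos.ne', one_smul]

end PeriodicFunctions

/-! ### The projection onto fixed vectors, the sawtooth operator and the mean along orbits -/

section FlowProjection

variable {E : Type*} [NormedAddCommGroup E] [NormedSpace ℝ E] [CompleteSpace E]
  {M : Type*} [TopologicalSpace M] [ChartedSpace E M] [IsManifold 𝓘(ℝ, E) ∞ M] {θ : ℝ → M → M}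

/-- The projection of the tangent space at a fixed point onto the vectors fixed by a flow. -/
def flowProj (E : Type*) [NormedAddCommGroup E] [NormedSpace ℝ E] [ChartedSpace E M]
    (θ : ℝ → M → M) (x : M) : E →L[ℝ] E := flowAverage E θ (fun _ => (2 * Real.pi)⁻¹) x

/-- The average of the isotropy action at a fixed point against the sawtooth function. It acts by
`2π / m` times the complex structure on a weight plane of weight `m ≠ 0`. -/
def flowSaw (E : Type*) [NormedAddCommGroup E] [NormedSpace ℝ E] [ChartedSpace E M]
    (θ : ℝ → M → M) (x : M) : E →L[ℝ] E := flowAverage E θ (fun s => Real.pi - s) x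

namespace IsCircleFlow
variable (hθ : IsCircleFlow (E := E) θ) {x : M} (hx : x ∈ flowFixed θ)
include hθ hx

theorem flowAverage_comp_tderiv {h : ℝ → ℝ} (hh : Continuous h) (t : ℝ) (u : E) :
    flowAverage E θ h x (tderiv E E (θ t) x u) =
      ∫ s in (0 : ℝ)..2 * Real.pi, h s • tderiv E E (θ (s + t)) x u := by
  rw [hθ.flowAverage_apply hh hx]
  simp_rw [hθ.tderiv_add hx]
  rfl

/-- The circle is commutative, so the averages are intertwining operators. -/
theorem tderiv_comp_flowAverage {h : ℝ → ℝ} (hh : Continuous h) (t : ℝ) (u : E) :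
    tderiv E E (θ t) x (flowAverage E θ h x u) =
      flowAverage E θ h x (tderiv E E (θ t) x u) := by
  rw [hθ.flowAverage_comp_tderiv hx hh, hθ.flowAverage_apply hh hx,
    ← ContinuousLinearMap.intervalIntegral_comp_comm]
  · simp_rw [add_comm _ t, hθ.tderiv_add hx, map_smul]
    rfl
  · exact (hh.smul ((hθ.continuous_tderiv hx).clm_apply continuous_const)).intervalIntegrable _ _

theorem periodic_apply (u : E) :
    Function.Periodic (fun s => tderiv E E (θ s) x u) (2 * Real.pi) := fun s => by
  have := hθ.tderiv_periodic x s
  simp only at this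
  simp only [this]

theorem continuous_apply (u : E) : Continuous fun s => tderiv E E (θ s) x u :=
  (hθ.continuous_tderiv hx).clm_apply continuous_const

theorem flowProj_apply (u : E) :
    flowProj E θ x u = (2 * Real.pi)⁻¹ • ∫ s in (0 : ℝ)..2 * Real.pi, tderiv E E (θ s) x u := by
  rw [flowProj, hθ.flowAverage_apply continuous_const hx, intervalIntegral.integral_smul]

theorem flowProj_tderiv (t : ℝ) (u : E) :
    flowProj E θ x (tderiv E E (θ t) x u) = flowProj E θ x u := by
  rw [flowProj, hθ.flowAverage_comp_tderiv hx continuous_const, ← flowProj,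
    hθ.flowProj_apply hx, intervalIntegral.integral_smul]
  congr 1
  rw [intervalIntegral.integral_comp_add_right (f := fun s => tderiv E E (θ s) x u), zero_add,
    add_comm _ t, (hθ.periodic_apply hx u).intervalIntegral_add_eq t 0, zero_add]

theorem tderiv_flowProj (t : ℝ) (u : E) :
    tderiv E E (θ t) x (flowProj E θ x u) = flowProj E θ x u := by
  rw [flowProj, hθ.tderiv_comp_flowAverage hx continuous_const, ← flowProj, hθ.flowProj_tderiv hx]

theorem flowProj_eq_self {u : E} (hu : ∀ s, tderiv E E (θ s) x u = u) :
    flowProj E θ x u = u := by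
  rw [hθ.flowProj_apply hx]
  simp_rw [hu]
  rw [intervalIntegral.integral_const, sub_zero, smul_smul,
    inv_mul_cancel₀ Real.two_pi_pos.ne', one_smul]

theorem flowProj_flowProj (u : E) : flowProj E θ x (flowProj E θ x u) = flowProj E θ x u :=
  hθ.flowProj_eq_self hx fun s => hθ.tderiv_flowProj hx s u

theorem flowSaw_apply (u : E) : flowSaw E θ x u =
    ∫ s in (0 : ℝ)..2 * Real.pi, (Real.pi - s) • tderiv E E (θ s) x u :=
  hθ.flowAverage_apply (by fun_prop) hx u

/-- The kernel of the sawtooth operator consists of fixed vectors: it is invariant, so all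
translates of the orbit `s ↦ dθ_s u` integrate to zero against the sawtooth, and the orbit at time
zero equals its mean. -/
theorem flowProj_eq_self_of_flowSaw {u : E} (hu : flowSaw E θ x u = 0) :
    flowProj E θ x u = u := by
  have h := eq_mean_of_sawtooth_eq_zero (hθ.continuous_apply hx u) (hθ.periodic_apply hx u)
    fun t => by
      rw [← hθ.flowAverage_comp_tderiv hx (h := fun s => Real.pi - s) (by fun_prop),
        ← hθ.tderiv_comp_flowAverage hx (by fun_prop), ← flowSaw, hu, map_zero]
  rw [hθ.flowProj_apply hx, ← h, hθ.tderiv_zero]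
  rfl

theorem flowSaw_flowProj (u : E) : flowSaw E θ x (flowProj E θ x u) = 0 := by
  rw [hθ.flowSaw_apply hx]
  simp_rw [hθ.tderiv_flowProj hx]
  rw [intervalIntegral.integral_smul_const, integral_pi_sub, zero_smul]

end IsCircleFlow

/-- The mean, in the chart at `x₀`, of the flow through a point. -/
def flowMean (E : Type*) [NormedAddCommGroup E] [NormedSpace ℝ E] [ChartedSpace E M]
    (θ : ℝ → M → M) (x₀ x : M) : E :=
  (2 * Real.pi)⁻¹ • ∫ s in (0 : ℝ)..2 * Real.pi, extChartAt 𝓘(ℝ, E) x₀ (θ s x)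

theorem flowMean_of_mem_flowFixed {x₀ x : M} (hx : x ∈ flowFixed θ) :
    flowMean E θ x₀ x = extChartAt 𝓘(ℝ, E) x₀ x := by
  rw [flowMean]
  simp_rw [hx _]
  rw [intervalIntegral.integral_const, sub_zero, smul_smul,
    inv_mul_cancel₀ Real.two_pi_pos.ne', one_smul]

namespace IsCircleFlow
variable (hθ : IsCircleFlow (E := E) θ)
include hθ

/-- Since the mean is constant on orbits, an invariant set on which it is injective consists of
fixed points. This is how points are shown to be fixed below. -/
theorem flowMean_flow (x₀ x : M) (t : ℝ) : flowMean E θ x₀ (θ t x) = flowMean E θ x₀ x := by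
  unfold flowMean
  congr 1
  simp_rw [← hθ.add]
  rw [intervalIntegral.integral_comp_add_right (f := fun s => extChartAt 𝓘(ℝ, E) x₀ (θ s x)),
    zero_add, add_comm _ t]
  have := ((hθ.periodic x).comp (extChartAt 𝓘(ℝ, E) x₀)).intervalIntegral_add_eq t 0
  rwa [zero_add] at this

/-- Points near a fixed point stay near it under a circle flow. -/
theorem eventually_forall_mem {x₀ : M} (hx₀ : x₀ ∈ flowFixed θ) {U : Set M} (hU : U ∈ 𝓝 x₀) :
    ∀ᶠ x in 𝓝 x₀, ∀ s, θ s x ∈ U := by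
  have h : ∀ᶠ x in 𝓝 x₀, ∀ s ∈ Icc (0 : ℝ) (2 * Real.pi), θ s x ∈ U := by
    refine isCompact_Icc.eventually_forall_of_forall_eventually fun s _ => ?_
    have hc : ContinuousAt (fun p : M × ℝ => θ p.2 p.1) (x₀, s) :=
      (hθ.continuous.comp continuous_swap).continuousAt
    exact hc (by simpa only [hx₀ s] using hU)
  filter_upwards [h] with x hx s
  obtain ⟨t, ht, hts⟩ := (hθ.periodic x).exists_mem_Ico₀ Real.two_pi_pos s
  rw [show θ s x = θ t x from hts]
  exact hx t (Ico_subset_Icc_self ht)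

/-- The mean along the flow is strictly differentiable at a fixed point, its derivative being the
projection onto the fixed vectors. -/
theorem flowMean_sub_le {x₀ : M} (hx₀ : x₀ ∈ flowFixed θ) {ε : ℝ} (hε : 0 < ε) :
    ∀ᶠ p : M × M in 𝓝 x₀ ×ˢ 𝓝 x₀, ‖flowMean E θ x₀ p.1 - flowMean E θ x₀ p.2 -
      flowProj E θ x₀ (extChartAt 𝓘(ℝ, E) x₀ p.1 - extChartAt 𝓘(ℝ, E) x₀ p.2)‖ ≤
      ε * ‖extChartAt 𝓘(ℝ, E) x₀ p.1 - extChartAt 𝓘(ℝ, E) x₀ p.2‖ := by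
  set c := extChartAt 𝓘(ℝ, E) x₀ with hc
  have hder : ∀ s, fderiv ℝ (flowInChart E θ x₀ s) (c x₀) = tderiv E E (θ s) x₀ := fun s =>
    hθ.fderiv_flowInChart_self hx₀ s
  -- The derivatives of all time-`s` maps are within `ε` of those at the fixed point on one common
  -- ball; the mean value inequality for each `s` is then integrated over the period.
  have hloc : ∀ᶠ y in 𝓝 (c x₀), ∀ s ∈ Icc (0 : ℝ) (2 * Real.pi),
      DifferentiableAt ℝ (flowInChart E θ x₀ s) y ∧
        ‖fderiv ℝ (flowInChart E θ x₀ s) y - tderiv E E (θ s) x₀‖ ≤ ε := by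
    refine isCompact_Icc.eventually_forall_of_forall_eventually fun s _ => ?_
    have hsw : ContinuousAt (fun p : E × ℝ => (p.2, p.1)) (c x₀, s) := by fun_prop
    have h1 : ContinuousAt (fun p : E × ℝ =>
        ‖fderiv ℝ (flowInChart E θ x₀ p.2) p.1 - tderiv E E (θ p.2) x₀‖) (c x₀, s) :=
      ((ContinuousAt.comp (g := fun p : ℝ × E => fderiv ℝ (flowInChart E θ x₀ p.1) p.2)
        (f := fun p : E × ℝ => (p.2, p.1)) (x := (c x₀, s))
        (hθ.continuousAt_fderiv_flowInChart hx₀ s) hsw).sub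
        ((hθ.continuous_tderiv hx₀).comp continuous_snd).continuousAt).norm
    have h2 := h1.eventually_lt_const (u := ε) (by simpa [hder] using hε)
    filter_upwards [h2, hsw.eventually (hθ.eventually_differentiableAt_flowInChart hx₀ s)]
      with p hp hp'
    exact ⟨hp', hp.le⟩
  obtain ⟨δ, hδ, hball⟩ := Metric.eventually_nhds_iff_ball.1 hloc
  have hcont := continuousAt_extChartAt (I := 𝓘(ℝ, E)) x₀
  have hsrc : ∀ᶠ x in 𝓝 x₀, x ∈ c.source := extChartAt_source_mem_nhds x₀
  have hU : ∀ᶠ x in 𝓝 x₀, c x ∈ Metric.ball (c x₀) δ ∧ x ∈ c.source ∧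
      ∀ s, θ s x ∈ c.source :=
    (hcont.eventually (Metric.ball_mem_nhds _ hδ)).and (hsrc.and
      (hθ.eventually_forall_mem hx₀ hsrc))
  filter_upwards [hU.prod_mk hU] with p ⟨⟨h1b, h1s, h1t⟩, ⟨h2b, h2s, h2t⟩⟩
  have hint : ∀ x : M, (∀ s, θ s x ∈ c.source) →
      IntervalIntegrable (fun s => c (θ s x)) MeasureTheory.volume 0 (2 * Real.pi) := by
    intro x hx
    refine Continuous.intervalIntegrable (continuous_iff_continuousAt.2 fun s => ?_) _ _
    exact ContinuousAt.comp (g := c) (f := fun s => θ s x) (continuousAt_extChartAt' (hx s))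
      (hθ.continuous.comp (by fun_prop : Continuous fun s : ℝ => (s, x))).continuousAt
  have hD : IntervalIntegrable (fun s => tderiv E E (θ s) x₀ (c p.1 - c p.2))
      MeasureTheory.volume 0 (2 * Real.pi) :=
    (hθ.continuous_apply hx₀ _).intervalIntegrable _ _
  rw [hθ.flowProj_apply hx₀, flowMean, flowMean, ← smul_sub, ← smul_sub,
    ← intervalIntegral.integral_sub (hint _ h1t) (hint _ h2t),
    ← intervalIntegral.integral_sub ((hint _ h1t).sub (hint _ h2t)) hD, norm_smul, norm_inv,
    Real.norm_of_nonneg Real.two_pi_pos.le, inv_mul_le_iff₀ Real.two_pi_pos]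
  refine (intervalIntegral.norm_integral_le_of_norm_le_const (C := ε * ‖c p.1 - c p.2‖)
    fun s hs => ?_).trans_eq (by rw [sub_zero, abs_of_pos Real.two_pi_pos, mul_comm])
  rw [uIoc_of_le Real.two_pi_pos.le] at hs
  have := (convex_ball (c x₀) δ).norm_image_sub_le_of_norm_fderiv_le'
    (fun y hy => (hball y hy s (Ioc_subset_Icc_self hs)).1)
    (fun y hy => (hball y hy s (Ioc_subset_Icc_self hs)).2) h2b h1b
  simpa only [flowInChart, c.left_inv h1s, c.left_inv h2s, ← hc] using this

end IsCircleFlow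

end FlowProjection

/-! ### Local estimates for smooth maps and immersions -/

section SmoothMaps

variable {E F : Type*} [NormedAddCommGroup E] [NormedSpace ℝ E] [NormedAddCommGroup F]
  [NormedSpace ℝ F] {M N : Type*} [TopologicalSpace M] [ChartedSpace E M]
  [IsManifold 𝓘(ℝ, E) ∞ M] [TopologicalSpace N] [ChartedSpace F N] [IsManifold 𝓘(ℝ, F) ∞ N]

theorem contDiffAt_in_charts {φ : N → M} (hφ : ContMDiff 𝓘(ℝ, F) 𝓘(ℝ, E) ∞ φ) (n₀ : N) :
    ContDiffAt ℝ ∞ (fun u => extChartAt 𝓘(ℝ, E) (φ n₀) (φ ((extChartAt 𝓘(ℝ, F) n₀).symm u)))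
      (extChartAt 𝓘(ℝ, F) n₀ n₀) := by
  rw [← contMDiffAt_iff_contDiffAt]
  have h1 := contMDiffAt_chart_symm (mem_extChartAt_target (I := 𝓘(ℝ, F)) n₀)
  have h2 := (hφ _).comp (extChartAt 𝓘(ℝ, F) n₀ n₀) h1
  have h3 : ContMDiffAt 𝓘(ℝ, E) 𝓘(ℝ, E) ∞ (extChartAt 𝓘(ℝ, E) (φ n₀))
      (φ ((extChartAt 𝓘(ℝ, F) n₀).symm (extChartAt 𝓘(ℝ, F) n₀ n₀))) := by
    refine contMDiffAt_extChartAt' ?_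
    rw [extChartAt_to_inv]
    exact mem_chart_source _ _
  exact h3.comp (extChartAt 𝓘(ℝ, F) n₀ n₀) h2

theorem fderiv_in_charts_self {φ : N → M} {n₀ : N}
    (hφ : MDifferentiableAt 𝓘(ℝ, F) 𝓘(ℝ, E) φ n₀) :
    fderiv ℝ (fun u => extChartAt 𝓘(ℝ, E) (φ n₀) (φ ((extChartAt 𝓘(ℝ, F) n₀).symm u)))
      (extChartAt 𝓘(ℝ, F) n₀ n₀) = tderiv F E φ n₀ := by
  have hl := (extChartAt 𝓘(ℝ, F) n₀).left_inv (mem_extChartAt_source n₀)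
  have := fderiv_in_charts (f := φ) (z₀ := φ n₀) (mem_extChartAt_target (I := 𝓘(ℝ, F)) n₀)
    (by rw [hl]; exact hφ) (by rw [hl]; exact mem_extChartAt_source _)
  rw [hl] at this
  rw [this, tderiv_chart_self, tderiv_chart_symm_self]
  rfl

theorem hasStrictFDerivAt_in_charts {φ : N → M} (hφ : ContMDiff 𝓘(ℝ, F) 𝓘(ℝ, E) ∞ φ) (n₀ : N) :
    HasStrictFDerivAt
      (fun u => extChartAt 𝓘(ℝ, E) (φ n₀) (φ ((extChartAt 𝓘(ℝ, F) n₀).symm u)))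
      (tderiv F E φ n₀) (extChartAt 𝓘(ℝ, F) n₀ n₀) := by
  rw [← fderiv_in_charts_self (hφ.mdifferentiable (by simp) n₀)]
  exact (contDiffAt_in_charts hφ n₀).hasStrictFDerivAt (by simp)

/-- Differences of nearby points of an immersed submanifold are almost tangent to it. -/
theorem eventually_norm_apply_sub_le [FiniteDimensional ℝ F] {G : Type*} [NormedAddCommGroup G]
    [NormedSpace ℝ G] {φ : N → M} (hφ : ContMDiff 𝓘(ℝ, F) 𝓘(ℝ, E) ∞ φ) {n₀ : N}
    (hinj : Function.Injective (tderiv F E φ n₀)) (B : E →L[ℝ] G)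
    (hB : B.comp (tderiv F E φ n₀) = 0) {ε : ℝ} (hε : 0 < ε) :
    ∀ᶠ p : N × N in 𝓝 n₀ ×ˢ 𝓝 n₀,
      ‖B (extChartAt 𝓘(ℝ, E) (φ n₀) (φ p.1) - extChartAt 𝓘(ℝ, E) (φ n₀) (φ p.2))‖ ≤
        ε * ‖extChartAt 𝓘(ℝ, E) (φ n₀) (φ p.1) - extChartAt 𝓘(ℝ, E) (φ n₀) (φ p.2)‖ := by
  set c := extChartAt 𝓘(ℝ, E) (φ n₀)
  set e := extChartAt 𝓘(ℝ, F) n₀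
  set D := tderiv F E φ n₀
  obtain ⟨K, hK0, hK⟩ := (D : F →ₗ[ℝ] E).exists_antilipschitzWith (LinearMap.ker_eq_bot.2 hinj)
  have hK' : ∀ u, ‖u‖ ≤ K * ‖D u‖ := fun u => by
    simpa using hK.le_mul_dist u 0
  have hK0' : (0 : ℝ) < K := hK0
  -- The first bound lets `δ‖u‖` be absorbed, giving `‖u‖ ≤ 2K‖w‖`; the second turns the resulting
  -- error `‖B‖ δ ‖u‖` into at most `ε‖w‖`. The `+ 1` covers `B = 0`.
  set δ : ℝ := min (1 / (2 * K)) (ε / (2 * K * (‖B‖ + 1))) with hδ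
  have hδ0 : 0 < δ := by positivity
  have hs : ∀ᶠ q in 𝓝 (e n₀, e n₀), ‖c (φ (e.symm q.1)) - c (φ (e.symm q.2)) - D (q.1 - q.2)‖ ≤
      δ * ‖q.1 - q.2‖ := (hasStrictFDerivAt_in_charts hφ n₀).isLittleO.def hδ0
  have he : Tendsto (fun p : N × N => (e p.1, e p.2)) (𝓝 n₀ ×ˢ 𝓝 n₀) (𝓝 (e n₀, e n₀)) := by
    rw [nhds_prod_eq]
    exact (continuousAt_extChartAt (I := 𝓘(ℝ, F)) n₀).tendsto.prodMap
      (continuousAt_extChartAt (I := 𝓘(ℝ, F)) n₀).tendsto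
  have hsrc : ∀ᶠ n in 𝓝 n₀, n ∈ e.source := extChartAt_source_mem_nhds n₀
  filter_upwards [he.eventually hs, hsrc.prod_mk hsrc] with p hp ⟨h1, h2⟩
  simp only [e.left_inv h1, e.left_inv h2] at hp
  set w := c (φ p.1) - c (φ p.2)
  set u := e p.1 - e p.2
  have hu : ‖u‖ ≤ 2 * K * ‖w‖ := by
    have h3 : ‖D u‖ ≤ ‖w‖ + δ * ‖u‖ := by
      calc ‖D u‖ = ‖w - (w - D u)‖ := by rw [sub_sub_cancel]
        _ ≤ ‖w‖ + ‖w - D u‖ := norm_sub_le _ _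
        _ ≤ _ := by gcongr
    have h4 : δ * K ≤ 1 / 2 := by
      calc δ * K ≤ 1 / (2 * K) * K := by gcongr; exact min_le_left _ _
        _ = 1 / 2 := by field_simp
    have h5 := hK' u
    have h6 : ‖u‖ ≤ K * ‖w‖ + (δ * K) * ‖u‖ :=
      h5.trans ((mul_le_mul_of_nonneg_left h3 hK0'.le).trans_eq (by ring))
    have h7 : (δ * K) * ‖u‖ ≤ 1 / 2 * ‖u‖ := by gcongr
    linarith
  have hBw : B w = B (w - D u) := by
    have : B (D u) = 0 := DFunLike.congr_fun hB u
    rw [map_sub B w, this, sub_zero]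
  calc ‖B w‖ = ‖B (w - D u)‖ := by rw [hBw]
    _ ≤ ‖B‖ * ‖w - D u‖ := B.le_opNorm _
    _ ≤ ‖B‖ * (δ * (2 * K * ‖w‖)) := by gcongr; exact hp.trans (by gcongr)
    _ ≤ (‖B‖ + 1) * ((ε / (2 * K * (‖B‖ + 1))) * (2 * K * ‖w‖)) := by
        gcongr
        · linarith
        · exact min_le_right _ _
    _ = ε * ‖w‖ := by field_simp

/-- Smooth maps which agree on an open set have the same derivatives on its closure. -/
theorem eq_and_tderiv_eq_of_mem_closure [T2Space M] {f g : N → M}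
    (hf : ContMDiff 𝓘(ℝ, F) 𝓘(ℝ, E) ∞ f) (hg : ContMDiff 𝓘(ℝ, F) 𝓘(ℝ, E) ∞ g) {Z : Set N}
    (hZ : IsOpen Z) (hfg : EqOn f g Z) {n : N} (hn : n ∈ closure Z) :
    f n = g n ∧ tderiv F E f n = tderiv F E g n := by
  have hn0 : f n = g n := hfg.closure hf.continuous hg.continuous hn
  refine ⟨hn0, ?_⟩
  have hf' := contDiffAt_in_charts hf n
  have hg' := contDiffAt_in_charts hg n
  rw [← fderiv_in_charts_self (hf.mdifferentiable (by simp) n),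
    ← fderiv_in_charts_self (hg.mdifferentiable (by simp) n)]
  rw [hn0] at hf' ⊢
  set e := extChartAt 𝓘(ℝ, F) n
  set f' := fun u => extChartAt 𝓘(ℝ, E) (g n) (f (e.symm u))
  set g' := fun u => extChartAt 𝓘(ℝ, E) (g n) (g (e.symm u))
  have hcf : ContinuousAt (fderiv ℝ f') (e n) :=
    (hf'.fderiv_right (m := 0) (by simp)).continuousAt
  have hcg : ContinuousAt (fderiv ℝ g') (e n) :=
    (hg'.fderiv_right (m := 0) (by simp)).continuousAt
  -- The derivatives agree at points of `Z` arbitrarily close to `n`, and both depend continuously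
  -- on the point.
  have hfr : ∃ᶠ n' in 𝓝 n, fderiv ℝ f' (e n') = fderiv ℝ g' (e n') := by
    have hsrc : ∀ᶠ n' in 𝓝 n, n' ∈ e.source := extChartAt_source_mem_nhds n
    refine ((mem_closure_iff_frequently.1 hn).and_eventually hsrc).mono fun n' hn' => ?_
    refine Filter.EventuallyEq.fderiv_eq ?_
    have hc : ContinuousAt e.symm (e n') := continuousAt_extChartAt_symm'' (e.map_source hn'.2)
    have : ∀ᶠ u in 𝓝 (e n'), e.symm u ∈ Z :=
      hc (by rw [e.left_inv hn'.2]; exact hZ.mem_nhds hn'.1)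
    filter_upwards [this] with u hu
    simp only [f', g', hfg hu]
  have hsub : ContinuousAt (fun n' => fderiv ℝ f' (e n') - fderiv ℝ g' (e n')) n :=
    (hcf.sub hcg).comp (f := e) (continuousAt_extChartAt n)
  by_contra hne
  have := hsub.eventually_ne (sub_ne_zero.2 hne)
  exact hfr (this.mono fun n' h h' => h (sub_eq_zero.2 h'))

theorem eq_of_tderiv_eq_zero [T2Space M] [PreconnectedSpace N] {f : N → M}
    (hf : MDifferentiable 𝓘(ℝ, F) 𝓘(ℝ, E) f) (h0 : ∀ n, tderiv F E f n = 0) (n n' : N) :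
    f n = f n' := by
  refine IsLocallyConstant.apply_eq_of_preconnectedSpace
    ((IsLocallyConstant.iff_eventually_eq f).2 fun n₀ => ?_) n n'
  set e := extChartAt 𝓘(ℝ, F) n₀
  set c := extChartAt 𝓘(ℝ, E) (f n₀)
  have hcont : ContinuousAt (fun u => f (e.symm u)) (e n₀) := by
    refine ContinuousAt.comp (g := f) hf.continuous.continuousAt ?_
    exact continuousAt_extChartAt_symm n₀
  have hU : ∀ᶠ u in 𝓝 (e n₀), u ∈ e.target ∧ f (e.symm u) ∈ c.source := by
    refine Filter.Eventually.and (extChartAt_target_mem_nhds n₀) (hcont ?_)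
    have : e.symm (e n₀) = n₀ := extChartAt_to_inv n₀
    simp only [this]
    exact extChartAt_source_mem_nhds _
  obtain ⟨δ, hδ, hball⟩ := Metric.eventually_nhds_iff_ball.1 hU
  have hderiv : ∀ u ∈ Metric.ball (e n₀) δ,
      HasFDerivAt (fun u => c (f (e.symm u))) (0 : F →L[ℝ] E) u := by
    intro u hu
    obtain ⟨hu1, hu2⟩ := hball u hu
    have hd : DifferentiableAt ℝ (fun u => c (f (e.symm u))) u := by
      rw [← mdifferentiableAt_iff_differentiableAt]
      exact (mdifferentiableAt_chart hu2).comp u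
        ((hf (e.symm u)).comp u (mdifferentiableAt_chart_symm hu1))
    have h1 := fderiv_in_charts hu1 (hf (e.symm u)) hu2
    rw [h0] at h1
    have h2 : fderiv ℝ (fun u => c (f (e.symm u))) u = 0 := by
      rw [h1]; simp
    rw [← h2]
    exact hd.hasFDerivAt
  have hsrc : ∀ᶠ n in 𝓝 n₀, n ∈ e.source := extChartAt_source_mem_nhds n₀
  have hb : ∀ᶠ n in 𝓝 n₀, e n ∈ Metric.ball (e n₀) δ :=
    (continuousAt_extChartAt (I := 𝓘(ℝ, F)) n₀) (Metric.ball_mem_nhds _ hδ)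
  filter_upwards [hsrc, hb] with n hn hnb
  have hn₀ : n₀ ∈ e.source := mem_extChartAt_source n₀
  have h3 := (convex_ball (e n₀) δ).norm_image_sub_le_of_norm_hasFDerivWithin_le (𝕜 := ℝ)
    (f := fun u => c (f (e.symm u))) (f' := fun _ => (0 : F →L[ℝ] E)) (C := 0) (fun u hu => (hderiv u hu).hasFDerivWithinAt) (by simp) (Metric.mem_ball_self hδ) hnb
  have h4 : c (f n) = c (f n₀) := by
    simpa [e.left_inv hn, e.left_inv hn₀, sub_eq_zero] using h3
  have h5 := (hball _ hnb).2
  rw [e.left_inv hn] at h5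
  exact c.injOn h5 (mem_extChartAt_source _) h4

end SmoothMaps

/-! ### Submanifolds fixed by a circle -/

section FixedSubmanifolds

variable {E F : Type*} [NormedAddCommGroup E] [NormedSpace ℝ E] [FiniteDimensional ℝ E]
  [NormedAddCommGroup F] [NormedSpace ℝ F] [FiniteDimensional ℝ F]
  {M N : Type*} [TopologicalSpace M] [T2Space M] [ChartedSpace E M]
  [IsManifold 𝓘(ℝ, E) ∞ M] [TopologicalSpace N] [ChartedSpace F N] [IsManifold 𝓘(ℝ, F) ∞ N]
  {θ : ℝ → M → M} {φ : N → M}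

namespace IsCircleFlow
variable (hθ : IsCircleFlow (E := E) θ)
include hθ

theorem isClosed_flowFixed : IsClosed (flowFixed θ) := by
  have : flowFixed θ = ⋂ s, {x | θ s x = x} := by ext; simp [flowFixed]
  rw [this]
  exact isClosed_iInter fun s => isClosed_eq (hθ.smooth_time s).continuous continuous_id

/-- If the isotropy action is trivial on the tangent space of an invariant submanifold, then the
nearby points of this submanifold are fixed. -/
theorem eventually_mem_flowFixed (hφ : ContMDiff 𝓘(ℝ, F) 𝓘(ℝ, E) ∞ φ) (hemb : IsEmbedding φ)
    (hinv : ∀ s n, θ s (φ n) ∈ range φ) {n₀ : N}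
    (hinj : Function.Injective (tderiv F E φ n₀)) (h0 : φ n₀ ∈ flowFixed θ)
    (htriv : ∀ s u, tderiv E E (θ s) (φ n₀) (tderiv F E φ n₀ u) = tderiv F E φ n₀ u) :
    ∀ᶠ n in 𝓝 n₀, φ n ∈ flowFixed θ := by
  set c := extChartAt 𝓘(ℝ, E) (φ n₀)
  have hB : (flowProj E θ (φ n₀) - ContinuousLinearMap.id ℝ E).comp (tderiv F E φ n₀) = 0 := by
    ext u
    simp [hθ.flowProj_eq_self h0 fun s => htriv s u]
  have h1 := eventually_norm_apply_sub_le hφ hinj _ hB (ε := 1 / 4) (by norm_num)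
  have hc := hφ.continuous.continuousAt (x := n₀)
  have h2 := (hc.tendsto.prodMap hc.tendsto).eventually
    (hθ.flowMean_sub_le h0 (ε := 1 / 4) (by norm_num))
  have hsrc : ∀ᶠ n in 𝓝 n₀, φ n ∈ c.source := hc (extChartAt_source_mem_nhds _)
  obtain ⟨V, hV, hVinj⟩ := eventually_prod_self_iff'.1 (h1.and (h2.and (hsrc.prod_mk hsrc)))
  -- The mean is injective on the submanifold near `n₀`. A chord `w` is almost tangent, so `P w` is
  -- close to `w`; if the means agree, `P w` is also small compared with `w`. The two errors of size
  -- `‖w‖ / 4` force `w = 0`.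
  have hVinj' : ∀ n ∈ V, ∀ n' ∈ V, flowMean E θ (φ n₀) (φ n) = flowMean E θ (φ n₀) (φ n') →
      φ n = φ n' := by
    intro n hn n' hn' heq
    obtain ⟨h3, h4, h5, h6⟩ := hVinj n hn n' hn'
    simp only [Prod.map_apply, heq, sub_self, zero_sub, norm_neg] at h3 h4
    refine c.injOn h5 h6 (sub_eq_zero.1 (norm_le_zero_iff.1 ?_))
    set w := c (φ n) - c (φ n')
    have h7 : ‖w‖ ≤ ‖flowProj E θ (φ n₀) w‖ +
        ‖(flowProj E θ (φ n₀) - ContinuousLinearMap.id ℝ E) w‖ := by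
      calc ‖w‖ = ‖flowProj E θ (φ n₀) w -
            (flowProj E θ (φ n₀) - ContinuousLinearMap.id ℝ E) w‖ := by
            congr 1
            simp only [sub_apply, ContinuousLinearMap.id_apply]
            abel
        _ ≤ _ := norm_sub_le _ _
    have h8 : ‖(flowProj E θ (φ n₀) - ContinuousLinearMap.id ℝ E) w‖ ≤ 1 / 4 * ‖w‖ := h3
    have h9 : ‖flowProj E θ (φ n₀) w‖ ≤ 1 / 4 * ‖w‖ := h4
    linarith [norm_nonneg w]
  -- As `φ` is an embedding, closeness in the ambient manifold implies closeness of parameters. A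
  -- short orbit therefore stays in the part where the mean is injective.
  obtain ⟨U, hU, hUV⟩ := hemb.isInducing.nhds_eq_comap n₀ ▸ hV
  filter_upwards [hc.eventually (hθ.eventually_forall_mem h0 hU)] with n hn s
  obtain ⟨n', hn'⟩ := hinv s n
  have hnV : n ∈ V := hUV (by have := hn 0; rwa [hθ.zero] at this)
  have hnV' : n' ∈ V := hUV (by have := hn s; rwa [← hn'] at this)
  rw [← hn']
  refine hVinj' n' hnV' n hnV ?_
  rw [hn', hθ.flowMean_flow]

/-- A connected invariant submanifold is fixed by a circle flow as soon as the flow fixes one of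
its points and acts trivially on the tangent space there. -/
theorem forall_mem_flowFixed [PreconnectedSpace N] (hφ : ContMDiff 𝓘(ℝ, F) 𝓘(ℝ, E) ∞ φ)
    (hemb : IsEmbedding φ) (hinj : ∀ n, Function.Injective (tderiv F E φ n))
    (hinv : ∀ s n, θ s (φ n) ∈ range φ) {n₀ : N} (h0 : φ n₀ ∈ flowFixed θ)
    (htriv : ∀ s u, tderiv E E (θ s) (φ n₀) (tderiv F E φ n₀ u) = tderiv F E φ n₀ u) (n : N) :
    φ n ∈ flowFixed θ := by
  -- The interior of the fixed set in the submanifold is also closed: at a limit point the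
  -- derivatives of `θ s ∘ φ` and `φ` agree by continuity, so the isotropy action is trivial on the
  -- tangent space and the local result applies again.
  set Z := interior (φ ⁻¹' flowFixed θ) with hZ
  have hclosed : IsClosed Z := by
    refine isClosed_of_closure_subset fun n hn => ?_
    have hfix : φ n ∈ flowFixed θ :=
      closure_minimal interior_subset (hθ.isClosed_flowFixed.preimage hφ.continuous) hn
    refine mem_interior_iff_mem_nhds.2
      (hθ.eventually_mem_flowFixed hφ hemb hinv (hinj n) hfix fun s u => ?_)
    have hs := (eq_and_tderiv_eq_of_mem_closure ((hθ.smooth_time s).comp hφ) hφ isOpen_interior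
      (fun n' hn' => interior_subset (s := φ ⁻¹' flowFixed θ) hn' s) hn).2
    rw [tderiv_comp n (hθ.mdifferentiableAt s _) (hφ.mdifferentiable (by simp) n)] at hs
    exact DFunLike.congr_fun hs u
  have hZu : Z = univ := IsClopen.eq_univ ⟨hclosed, isOpen_interior⟩ ⟨n₀,
    mem_interior_iff_mem_nhds.2 (hθ.eventually_mem_flowFixed hφ hemb hinv (hinj n₀) h0 htriv)⟩
  exact interior_subset (s := φ ⁻¹' flowFixed θ) (hZu ▸ mem_univ n : n ∈ Z)

theorem tderiv_apply_of_forall_mem_flowFixed (hφ : ContMDiff 𝓘(ℝ, F) 𝓘(ℝ, E) ∞ φ)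
    (hfix : ∀ n, φ n ∈ flowFixed θ) (n : N) (s : ℝ) (u : F) :
    tderiv E E (θ s) (φ n) (tderiv F E φ n u) = tderiv F E φ n u := by
  have h := tderiv_comp n (hθ.mdifferentiableAt s _) (hφ.mdifferentiable (by simp) n)
  rw [show θ s ∘ φ = φ from funext fun n => hfix n s] at h
  exact (DFunLike.congr_fun h u).symm

/-- The rank of a projection is its trace, which is continuous and invariant under change of charts.
This makes the rank a continuous function with integer values. -/
theorem trace_flowProj {x : M} (hx : x ∈ flowFixed θ) :
    LinearMap.trace ℝ E (flowProj E θ x) =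
      (Module.finrank ℝ (LinearMap.range (flowProj E θ x : E →ₗ[ℝ] E)) : ℝ) :=
  LinearMap.IsProj.trace ⟨fun u => LinearMap.mem_range_self _ u, by
    rintro _ ⟨u, rfl⟩
    exact hθ.flowProj_flowProj hx u⟩

/-- In a chart, the average isotropy action depends continuously on the point of a family of fixed
points. -/
theorem continuousAt_flowAverage {h : ℝ → ℝ} (hh : Continuous h) (hφ : Continuous φ)
    (hfix : ∀ n, φ n ∈ flowFixed θ) (n₀ : N) :
    ContinuousAt (fun n => (tderiv E E (extChartAt 𝓘(ℝ, E) (φ n₀)) (φ n)).comp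
      ((flowAverage E θ h (φ n)).comp (tderiv E E (extChartAt 𝓘(ℝ, E) (φ n₀)).symm
        (extChartAt 𝓘(ℝ, E) (φ n₀) (φ n))))) n₀ :=
  (hθ.continuousWithinAt_flowAverage hh (hfix n₀)).tendsto.comp
    (tendsto_nhdsWithin_iff.2 ⟨hφ.continuousAt, Eventually.of_forall hfix⟩)

/-- The number of fixed directions is constant along a connected set of fixed points. -/
theorem finrank_flowProj_eq [PreconnectedSpace N] (hφ : Continuous φ)
    (hfix : ∀ n, φ n ∈ flowFixed θ) (n n' : N) :
    Module.finrank ℝ (LinearMap.range (flowProj E θ (φ n) : E →ₗ[ℝ] E)) =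
      Module.finrank ℝ (LinearMap.range (flowProj E θ (φ n') : E →ₗ[ℝ] E)) := by
  set k : N → ℕ := fun n => Module.finrank ℝ (LinearMap.range (flowProj E θ (φ n) : E →ₗ[ℝ] E))
  have hc : Continuous fun n => (k n : ℝ) := by
    refine continuous_iff_continuousAt.2 fun n₀ => ?_
    have h1 := hθ.continuousAt_flowAverage (h := fun _ => (2 * Real.pi)⁻¹) continuous_const hφ
      hfix n₀
    have htr : Continuous fun A : E →L[ℝ] E => LinearMap.trace ℝ E (A : E →ₗ[ℝ] E) :=
      ((LinearMap.trace ℝ E).comp (ContinuousLinearMap.coeLM ℝ)).continuous_of_finiteDimensional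
    refine (htr.continuousAt.comp h1).congr ?_
    have hsrc : ∀ᶠ n in 𝓝 n₀, φ n ∈ (extChartAt 𝓘(ℝ, E) (φ n₀)).source :=
      hφ.continuousAt (extChartAt_source_mem_nhds _)
    filter_upwards [hsrc] with n hn
    rw [← hθ.trace_flowProj (hfix n)]
    have h2 := tderiv_symm_comp_chart hn
    have h3 : LinearMap.trace ℝ E ((tderiv E E (extChartAt 𝓘(ℝ, E) (φ n₀)) (φ n) : E →ₗ[ℝ] E) ∘ₗ
        ((flowProj E θ (φ n) : E →ₗ[ℝ] E) ∘ₗ (tderiv E E (extChartAt 𝓘(ℝ, E) (φ n₀)).symm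
        (extChartAt 𝓘(ℝ, E) (φ n₀) (φ n)) : E →ₗ[ℝ] E))) =
        LinearMap.trace ℝ E (flowProj E θ (φ n) : E →ₗ[ℝ] E) := by
      rw [LinearMap.trace_comp_comm', LinearMap.comp_assoc]
      congr 1
      ext u
      exact congrArg (flowProj E θ (φ n)) (DFunLike.congr_fun h2 u)
    exact h3
  have hk : Continuous k := Nat.isClosedEmbedding_coe_real.isInducing.continuous_iff.2 hc
  exact PreconnectedSpace.constant inferInstance hk

/-- A fixed submanifold which is tangent to all fixed vectors contains all fixed points nearby. -/
theorem exists_nhds_flowFixed_subset_range (hφ : ContMDiff 𝓘(ℝ, F) 𝓘(ℝ, E) ∞ φ)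
    (hfix : ∀ n, φ n ∈ flowFixed θ) (n₀ : N)
    (hrange : LinearMap.range (flowProj E θ (φ n₀) : E →ₗ[ℝ] E) ≤
      LinearMap.range (tderiv F E φ n₀ : F →ₗ[ℝ] E)) :
    ∃ U ∈ 𝓝 (φ n₀), flowFixed θ ∩ U ⊆ range φ := by
  set c := extChartAt 𝓘(ℝ, E) (φ n₀)
  set e := extChartAt 𝓘(ℝ, F) n₀
  set P := flowProj E θ (φ n₀) with hP
  set D := tderiv F E φ n₀
  have hPD : ∀ u, P (D u) = D u := fun u => hθ.flowProj_eq_self (hfix n₀) fun s =>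
    hθ.tderiv_apply_of_forall_mem_flowFixed hφ hfix n₀ s u
  have hest := hθ.flowMean_sub_le (hfix n₀) (ε := 1 / 2) (by norm_num)
  have hsrc : ∀ᶠ x in 𝓝 (φ n₀), x ∈ c.source := extChartAt_source_mem_nhds _
  obtain ⟨U, hU, hUest⟩ := eventually_prod_self_iff'.1 (hest.and (hsrc.prod_mk hsrc))
  -- At fixed points the mean is the chart coordinate itself, so its strict derivative `P` makes `P
  -- ∘ c` injective on nearby fixed points.
  have hUinj : ∀ x ∈ flowFixed θ ∩ U, ∀ y ∈ flowFixed θ ∩ U, P (c x) = P (c y) → x = y := by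
    rintro x ⟨hxF, hxU⟩ y ⟨hyF, hyU⟩ hxy
    obtain ⟨h1, h2, h3⟩ := hUest x hxU y hyU
    simp only [flowMean_of_mem_flowFixed hxF, flowMean_of_mem_flowFixed hyF] at h1
    rw [map_sub, ← hP, hxy, sub_self, sub_zero] at h1
    refine c.injOn h2 h3 (sub_eq_zero.1 (norm_le_zero_iff.1 ?_))
    linarith [norm_nonneg (c x - c y)]
  set R := P.rangeRestrict
  have hstrict : HasStrictFDerivAt (fun u => R (c (φ (e.symm u)))) (R.comp D) (e n₀) :=
    R.hasStrictFDerivAt.comp (e n₀) (hasStrictFDerivAt_in_charts hφ n₀)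
  -- The range of `P` lies in the tangent space, so `P ∘ c ∘ φ` is locally open onto the range of
  -- `P`. Every nearby fixed point thus shares its value of `P ∘ c` with a point of the submanifold,
  -- and injectivity identifies the two.
  have hsurj : (R.comp D).range = ⊤ := by
    refine LinearMap.range_eq_top.2 ?_
    rintro ⟨_, v, rfl⟩
    obtain ⟨u, hu⟩ := hrange (LinearMap.mem_range_self _ v)
    refine ⟨u, Subtype.ext ?_⟩
    change P (D u) = P v
    rw [hPD]
    exact hu
  have hmap := hstrict.map_nhds_eq_of_surj hsurj
  have hn₀ : e.symm (e n₀) = n₀ := extChartAt_to_inv n₀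
  have hW : {u | φ (e.symm u) ∈ U} ∈ 𝓝 (e n₀) := by
    have : ContinuousAt (fun u => φ (e.symm u)) (e n₀) :=
      ContinuousAt.comp hφ.continuous.continuousAt (continuousAt_extChartAt_symm n₀)
    refine this ?_
    change U ∈ 𝓝 (φ (e.symm (e n₀)))
    rwa [hn₀]
  have himg := hmap ▸ image_mem_map hW
  have hc : ContinuousAt (fun x => R (c x)) (φ n₀) :=
    R.continuous.continuousAt.comp (continuousAt_extChartAt (I := 𝓘(ℝ, E)) (φ n₀))
  rw [hn₀] at himg
  refine ⟨U ∩ (fun x => R (c x)) ⁻¹' ((fun u => R (c (φ (e.symm u)))) '' {u | φ (e.symm u) ∈ U}),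
    inter_mem hU (hc himg), ?_⟩
  rintro x ⟨hxF, hxU, u, huU, hux⟩
  refine ⟨e.symm u, (hUinj x ⟨hxF, hxU⟩ _ ⟨hfix _, huU⟩ ?_).symm⟩
  exact (congrArg Subtype.val hux).symm

/-- A connected set of fixed points which meets a compact fixed submanifold that is tangent to all
fixed vectors is contained in it. -/
theorem range_subset_range [CompactSpace N] {N' : Type*} [TopologicalSpace N']
    [PreconnectedSpace N'] {φ' : N' → M} (hφ' : Continuous φ') (hfix' : ∀ n, φ' n ∈ flowFixed θ)
    (hφ : ContMDiff 𝓘(ℝ, F) 𝓘(ℝ, E) ∞ φ) (hfix : ∀ n, φ n ∈ flowFixed θ)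
    (hrange : ∀ n, LinearMap.range (flowProj E θ (φ n) : E →ₗ[ℝ] E) ≤
      LinearMap.range (tderiv F E φ n : F →ₗ[ℝ] E))
    {n' : N'} (hn' : φ' n' ∈ range φ) : range φ' ⊆ range φ := by
  have hclosed : IsClosed (φ' ⁻¹' range φ) :=
    (isCompact_range hφ.continuous).isClosed.preimage hφ'
  have hopen : IsOpen (φ' ⁻¹' range φ) := by
    refine isOpen_iff_mem_nhds.2 fun m hm => ?_
    obtain ⟨n, hn⟩ := hm
    obtain ⟨U, hU, hUr⟩ := hθ.exists_nhds_flowFixed_subset_range hφ hfix n (hrange n)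
    rw [hn] at hU
    filter_upwards [hφ'.continuousAt hU] with m' hm'
    exact hUr ⟨hfix' m', hm'⟩
  have := IsClopen.eq_univ ⟨hclosed, hopen⟩ ⟨n', hn'⟩
  rintro _ ⟨m, rfl⟩
  exact (this ▸ mem_univ m : m ∈ φ' ⁻¹' range φ)

end IsCircleFlow

end FixedSubmanifolds

/-- The sawtooth is odd under `s ↦ 2π - s`. This sign compensates the antisymmetry of the two-form
and makes the sawtooth operator symmetric for it. -/
theorem integral_sawtooth_neg {g : ℝ → ℝ} (hg : Function.Periodic g (2 * Real.pi)) :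
    ∫ s in (0 : ℝ)..2 * Real.pi, (Real.pi - s) * g (-s) =
      -∫ s in (0 : ℝ)..2 * Real.pi, (Real.pi - s) * g s := by
  have h := intervalIntegral.integral_comp_sub_left (a := 0) (b := 2 * Real.pi)
    (fun s => (Real.pi - s) * g s) (2 * Real.pi)
  rw [sub_self, sub_zero] at h
  rw [← h, ← intervalIntegral.integral_neg]
  refine intervalIntegral.integral_congr fun s _ => ?_
  have h2 := hg (-s)
  rw [neg_add_eq_sub] at h2
  simp only [h2]
  ring

/-! ### Alternating forms as bilinear pairings -/

section Pairing

variable {E : Type*} [NormedAddCommGroup E] [NormedSpace ℝ E]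

theorem alternating_swap (Ω : E [⋀^Fin 2]→L[ℝ] ℝ) (u v : E) : Ω ![u, v] = -Ω ![v, u] := by
  have h := Ω.toAlternatingMap.map_swap ![v, u] (i := 0) (j := 1) (by decide)
  have h2 : ![v, u] ∘ Equiv.swap (0 : Fin 2) 1 = ![u, v] := by
    funext i; fin_cases i <;> simp
  rw [h2] at h
  exact h

/-- An alternating two-form as a bilinear map. -/
def pairing (Ω : E [⋀^Fin 2]→L[ℝ] ℝ) : E →ₗ[ℝ] E →ₗ[ℝ] ℝ :=
  LinearMap.mk₂ ℝ (fun u v => Ω ![u, v])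
    (fun u u' v => Ω.toAlternatingMap.map_vecCons_add ![v] u u')
    (fun a u v => Ω.toAlternatingMap.map_vecCons_smul ![v] a u)
    (fun u v v' => by
      rw [alternating_swap Ω u (v + v'), alternating_swap Ω u v, alternating_swap Ω u v', ← neg_add]
      exact congrArg _ (Ω.toAlternatingMap.map_vecCons_add ![u] v v'))
    (fun a u v => by
      rw [alternating_swap Ω u (a • v), alternating_swap Ω u v, smul_neg]
      exact congrArg _ (Ω.toAlternatingMap.map_vecCons_smul ![u] a v))

theorem pairing_apply (Ω : E [⋀^Fin 2]→L[ℝ] ℝ) (u v : E) : pairing Ω u v = Ω ![u, v] := rfl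

theorem pairing_swap (Ω : E [⋀^Fin 2]→L[ℝ] ℝ) (u v : E) : pairing Ω u v = -pairing Ω v u :=
  alternating_swap Ω u v

theorem pairing_self (Ω : E [⋀^Fin 2]→L[ℝ] ℝ) (u : E) : pairing Ω u u = 0 := by
  have := pairing_swap Ω u u
  linarith

/-- A nonnegative quadratic form `u ↦ Ω(u, C u)`, with `C` symmetric with respect to `Ω`, vanishes
only on the kernel of `C`. -/
theorem eq_zero_of_pairing_eq_zero {Ω : E [⋀^Fin 2]→L[ℝ] ℝ}
    (hnd : ∀ u, (∀ v, pairing Ω u v = 0) → u = 0) {C : E →L[ℝ] E}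
    (hsymm : ∀ u v, pairing Ω u (C v) = pairing Ω v (C u))
    (hpos : ∀ u, 0 ≤ pairing Ω u (C u)) {u : E} (hu : pairing Ω u (C u) = 0) : C u = 0 := by
  refine hnd _ fun w => ?_
  rw [pairing_swap, neg_eq_zero]
  have key : ∀ t : ℝ, 0 ≤ 2 * t * pairing Ω w (C u) + t ^ 2 * pairing Ω w (C w) := by
    intro t
    have h := hpos (u + t • w)
    simp only [map_add, map_smul, LinearMap.add_apply, LinearMap.smul_apply, smul_eq_mul, hu,
      hsymm u w] at h
    linarith
  set b := pairing Ω w (C u)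
  set q := pairing Ω w (C w)
  have hq : 0 ≤ q := hpos w
  -- Near the minimiser `-b / q` of the quadratic polynomial, but with a denominator that stays
  -- positive when `q = 0`.
  have h := key (-b / (q + 1))
  have h2 : 2 * (-b / (q + 1)) * b + (-b / (q + 1)) ^ 2 * q = -(b ^ 2 * (q + 2)) / (q + 1) ^ 2 := by
    field_simp; ring
  rw [h2] at h
  have h3 : 0 ≤ -(b ^ 2 * (q + 2)) := by
    have := mul_nonneg h (sq_nonneg (q + 1))
    rwa [div_mul_cancel₀ _ (by positivity)] at this
  have : b ^ 2 * (q + 2) ≤ 0 := by linarith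
  have h4 : b ^ 2 ≤ 0 := nonpos_of_mul_nonpos_left this (by linarith)
  exact pow_eq_zero_iff (two_ne_zero) |>.1 (le_antisymm h4 (sq_nonneg b))

end Pairing

/-! ### Constancy of the signs of the weights along fixed points -/

section Signature

variable {E : Type*} [NormedAddCommGroup E] [NormedSpace ℝ E] [FiniteDimensional ℝ E]
  {M N : Type*} [TopologicalSpace M] [T2Space M] [ChartedSpace E M]
  [IsManifold 𝓘(ℝ, E) ∞ M] [TopologicalSpace N] {θ : ℝ → M → M} {φ : N → M}

/-- The quadratic form `u ↦ Ω(u, C u)` of the sawtooth average `C` at a fixed point is nonnegative.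
This says that no weight of the circle action on the tangent space is negative. -/
def IsSawNonneg (θ : ℝ → M → M) (Ω : M → E [⋀^Fin 2]→L[ℝ] ℝ) (x : M) : Prop :=
  ∀ u, 0 ≤ pairing (Ω x) u (flowSaw E θ x u)

/-- A two-form is continuous in charts. -/
def IsContinuousForm (Ω : M → E [⋀^Fin 2]→L[ℝ] ℝ) : Prop :=
  ∀ x₀ : M, ContinuousAt (fun y => (Ω ((extChartAt 𝓘(ℝ, E) x₀).symm y)).compContinuousLinearMap
    (tderiv E E (extChartAt 𝓘(ℝ, E) x₀).symm y)) (extChartAt 𝓘(ℝ, E) x₀ x₀)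

namespace IsCircleFlow
variable (hθ : IsCircleFlow (E := E) θ) {Ω : M → E [⋀^Fin 2]→L[ℝ] ℝ}
include hθ

theorem pairing_tderiv_neg {x : M} (hx : x ∈ flowFixed θ)
    (hinv : ∀ s u v, pairing (Ω x) (tderiv E E (θ s) x u) (tderiv E E (θ s) x v) =
      pairing (Ω x) u v) (s : ℝ) (u v : E) :
    pairing (Ω x) u (tderiv E E (θ s) x v) = -pairing (Ω x) v (tderiv E E (θ (-s)) x u) := by
  have h := hinv (-s) u (tderiv E E (θ s) x v)
  have h2 : tderiv E E (θ (-s)) x (tderiv E E (θ s) x v) = v := by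
    have := hθ.tderiv_add hx (-s) s
    rw [neg_add_cancel, hθ.tderiv_zero] at this
    exact (DFunLike.congr_fun this v).symm
  rw [h2] at h
  rw [← h, pairing_swap]

theorem pairing_flowAverage {h : ℝ → ℝ} (hh : Continuous h) {x : M} (hx : x ∈ flowFixed θ)
    (u v : E) : pairing (Ω x) u (flowAverage E θ h x v) =
      ∫ s in (0 : ℝ)..2 * Real.pi, h s * pairing (Ω x) u (tderiv E E (θ s) x v) := by
  have h1 := ContinuousLinearMap.intervalIntegral_comp_comm (𝕜 := ℝ)
    (LinearMap.toContinuousLinearMap (pairing (Ω x) u))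
    (f := fun s => h s • tderiv E E (θ s) x v) (a := 0) (b := 2 * Real.pi)
    (μ := MeasureTheory.volume)
    ((hh.smul (hθ.continuous_apply hx v)).intervalIntegrable _ _)
  rw [hθ.flowAverage_apply hh hx]
  simp only [map_smul, LinearMap.coe_toContinuousLinearMap', smul_eq_mul] at h1
  exact h1.symm

/-- Invariance of the form makes `dθ_{-s}` the adjoint of `dθ_s`. Swapping the arguments and
reversing the sawtooth each contribute a sign, and the signs cancel. -/
theorem pairing_flowSaw_symm {x : M} (hx : x ∈ flowFixed θ)
    (hinv : ∀ s u v, pairing (Ω x) (tderiv E E (θ s) x u) (tderiv E E (θ s) x v) =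
      pairing (Ω x) u v) (u v : E) :
    pairing (Ω x) u (flowSaw E θ x v) = pairing (Ω x) v (flowSaw E θ x u) := by
  have hsaw : Continuous fun s : ℝ => Real.pi - s := by fun_prop
  rw [flowSaw, hθ.pairing_flowAverage hsaw hx, hθ.pairing_flowAverage hsaw hx]
  have hp : Function.Periodic (fun s => pairing (Ω x) v (tderiv E E (θ s) x u)) (2 * Real.pi) :=
    (hθ.periodic_apply hx u).comp (pairing (Ω x) v)
  rw [← neg_neg (∫ s in (0 : ℝ)..2 * Real.pi, (Real.pi - s) * pairing (Ω x) v _),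
    ← integral_sawtooth_neg hp, ← intervalIntegral.integral_neg]
  refine intervalIntegral.integral_congr fun s _ => ?_
  simp only [hθ.pairing_tderiv_neg hx hinv s u v]
  ring

/-- By invariance, pairing with a fixed vector is constant along the orbit of `v`, so `v` may be
replaced by its average. -/
theorem pairing_flowProj {x : M} (hx : x ∈ flowFixed θ)
    (hinv : ∀ s u v, pairing (Ω x) (tderiv E E (θ s) x u) (tderiv E E (θ s) x v) =
      pairing (Ω x) u v) {u : E} (hu : ∀ s, tderiv E E (θ s) x u = u) (v : E) :
    pairing (Ω x) u (flowProj E θ x v) = pairing (Ω x) u v := by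
  have h1 : ∀ s, pairing (Ω x) u (tderiv E E (θ s) x v) = pairing (Ω x) u v := fun s => by
    conv_lhs => rw [← hu s]
    exact hinv s u v
  rw [flowProj, hθ.pairing_flowAverage continuous_const hx]
  simp_rw [h1]
  rw [intervalIntegral.integral_const, sub_zero, smul_eq_mul, ← mul_assoc,
    mul_inv_cancel₀ Real.two_pi_pos.ne', one_mul]

/-- The signature of the isotropy action of a circle is constant along a connected set of fixed
points: if it is nonnegative somewhere, it is nonnegative everywhere. -/
theorem isSawNonneg_of_isSawNonneg [PreconnectedSpace N] (hφ : Continuous φ)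
    (hfix : ∀ n, φ n ∈ flowFixed θ) (hΩ : IsContinuousForm Ω)
    (hinv : ∀ n s u v, pairing (Ω (φ n)) (tderiv E E (θ s) (φ n) u) (tderiv E E (θ s) (φ n) v) =
      pairing (Ω (φ n)) u v) (hnd : ∀ x u, (∀ v, pairing (Ω x) u v = 0) → u = 0)
    {n₁ : N} (h₁ : IsSawNonneg θ Ω (φ n₁)) (n₂ : N) : IsSawNonneg θ Ω (φ n₂) := by
  set S : Set N := {n | IsSawNonneg θ Ω (φ n)}
  -- the objects at `φ n`, in the chart at `φ n₀`
  let dc : N → N → E →L[ℝ] E := fun n₀ n => tderiv E E (extChartAt 𝓘(ℝ, E) (φ n₀)) (φ n)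
  let ds : N → N → E →L[ℝ] E := fun n₀ n => tderiv E E (extChartAt 𝓘(ℝ, E) (φ n₀)).symm
    (extChartAt 𝓘(ℝ, E) (φ n₀) (φ n))
  let W : N → N → E [⋀^Fin 2]→L[ℝ] ℝ := fun n₀ n => (Ω (φ n)).compContinuousLinearMap (ds n₀ n)
  let C : N → N → E →L[ℝ] E := fun n₀ n => (dc n₀ n).comp ((flowSaw E θ (φ n)).comp (ds n₀ n))
  let P : N → N → E →L[ℝ] E := fun n₀ n => (dc n₀ n).comp ((flowProj E θ (φ n)).comp (ds n₀ n))
  have hsrc : ∀ n₀, ∀ᶠ n in 𝓝 n₀, φ n ∈ (extChartAt 𝓘(ℝ, E) (φ n₀)).source := fun n₀ =>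
    hφ.continuousAt (extChartAt_source_mem_nhds _)
  have hW : ∀ n₀, ContinuousAt (W n₀) n₀ := fun n₀ => by
    have h1 : ContinuousAt (fun n => (Ω ((extChartAt 𝓘(ℝ, E) (φ n₀)).symm
        (extChartAt 𝓘(ℝ, E) (φ n₀) (φ n)))).compContinuousLinearMap (ds n₀ n)) n₀ :=
      ContinuousAt.comp (f := fun n => extChartAt 𝓘(ℝ, E) (φ n₀) (φ n)) (hΩ (φ n₀))
        (ContinuousAt.comp (continuousAt_extChartAt (φ n₀)) hφ.continuousAt)
    refine h1.congr ?_
    filter_upwards [hsrc n₀] with n hn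
    simp only [W, (extChartAt 𝓘(ℝ, E) (φ n₀)).left_inv hn]
  have hC : ∀ n₀, ContinuousAt (C n₀) n₀ := fun n₀ =>
    hθ.continuousAt_flowAverage (by fun_prop) hφ hfix n₀
  have hP : ∀ n₀, ContinuousAt (P n₀) n₀ := fun n₀ =>
    hθ.continuousAt_flowAverage continuous_const hφ hfix n₀
  have hdsdc : ∀ n₀ n, φ n ∈ (extChartAt 𝓘(ℝ, E) (φ n₀)).source → ∀ u, ds n₀ n (dc n₀ n u) = u :=
    fun n₀ n hn u => DFunLike.congr_fun (tderiv_symm_comp_chart hn) u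
  have hWC : ∀ n₀ n, φ n ∈ (extChartAt 𝓘(ℝ, E) (φ n₀)).source → ∀ u,
      W n₀ n ![u, C n₀ n u] =
        pairing (Ω (φ n)) (ds n₀ n u) (flowSaw E θ (φ n) (ds n₀ n u)) := by
    intro n₀ n hn u
    have h1 : ds n₀ n (C n₀ n u) = flowSaw E θ (φ n) (ds n₀ n u) := hdsdc n₀ n hn _
    rw [pairing_apply, ← h1]
    simp only [W, ContinuousAlternatingMap.compContinuousLinearMap_apply]
    congr 1
    funext i; fin_cases i <;> rfl
  have heval : ∀ n₀ u, ContinuousAt (fun p : N × E => W n₀ p.1 ![p.2, C n₀ p.1 p.2]) (n₀, u) := by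
    intro n₀ u
    have h1 : ContinuousAt (fun p : N × E => W n₀ p.1) (n₀, u) :=
      ContinuousAt.comp (f := Prod.fst) (x := (n₀, u)) (hW n₀) continuousAt_fst
    have h2 : ContinuousAt (fun p : N × E => C n₀ p.1) (n₀, u) :=
      ContinuousAt.comp (f := Prod.fst) (x := (n₀, u)) (hC n₀) continuousAt_fst
    have h3 : ContinuousAt (fun p : N × E => ![p.2, C n₀ p.1 p.2]) (n₀, u) := by
      refine continuousAt_pi.2 fun i => ?_
      fin_cases i
      · exact continuousAt_snd
      · exact h2.clm_apply continuousAt_snd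
    exact h1.eval h3
  have hself : ∀ n u, ds n n u = u := fun n u => DFunLike.congr_fun (tderiv_chart_symm_self _) u
  have hself' : ∀ n u, dc n n u = u := fun n u => DFunLike.congr_fun (tderiv_chart_self _) u
  have hclosed : IsClosed S := by
    refine isClosed_of_closure_subset fun n₀ hn₀ u => ?_
    have h1 : ContinuousAt (fun n => W n₀ n ![u, C n₀ n u]) n₀ :=
      ContinuousAt.comp (f := fun n => (n, u)) (heval n₀ u) (by fun_prop)
    have h2 : ∃ᶠ n in 𝓝 n₀, 0 ≤ W n₀ n ![u, C n₀ n u] :=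
      ((mem_closure_iff_frequently.1 hn₀).and_eventually (hsrc n₀)).mono fun n hn => by
        rw [hWC n₀ n hn.2]
        exact hn.1 _
    have h3 : 0 ≤ W n₀ n₀ ![u, C n₀ n₀ u] := by
      by_contra hneg
      exact h2 ((h1.eventually_lt_const (not_le.1 hneg)).mono fun n hn => not_le.2 hn)
    rw [hWC n₀ n₀ (mem_extChartAt_source _), hself] at h3
    exact h3
  -- The form is only semidefinite, its kernel being the fixed vectors. Adding `‖P u‖²` makes it
  -- positive on the unit sphere, which persists nearby by compactness. At the nearby point,
  -- subtracting the fixed part of a vector leaves the form unchanged and makes the added term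
  -- vanish.
  have hopen : IsOpen S := by
    refine isOpen_iff_mem_nhds.2 fun n₀ hn₀ => ?_
    have hpos : ∀ u ∈ Metric.sphere (0 : E) 1, 0 < W n₀ n₀ ![u, C n₀ n₀ u] + ‖P n₀ n₀ u‖ ^ 2 := by
      intro u hu
      rw [hWC n₀ n₀ (mem_extChartAt_source _), hself]
      have h1 := hn₀ u
      refine lt_of_le_of_ne (by positivity) fun h0 => ?_
      have h2 : pairing (Ω (φ n₀)) u (flowSaw E θ (φ n₀) u) = 0 := by
        have := sq_nonneg ‖P n₀ n₀ u‖
        linarith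
      have h3 : ‖P n₀ n₀ u‖ = 0 := by
        rw [h2, zero_add] at h0
        exact pow_eq_zero_iff two_ne_zero |>.1 h0.symm
      have h4 := eq_zero_of_pairing_eq_zero (hnd _)
        (hθ.pairing_flowSaw_symm (hfix n₀) (hinv n₀)) hn₀ h2
      have h5 : P n₀ n₀ u = u := by
        change dc n₀ n₀ (flowProj E θ (φ n₀) (ds n₀ n₀ u)) = u
        rw [hself, hself', hθ.flowProj_eq_self_of_flowSaw (hfix n₀) h4]
      rw [h5] at h3
      simp [h3] at hu
    have hev : ∀ᶠ n in 𝓝 n₀, ∀ u ∈ Metric.sphere (0 : E) 1,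
        0 < W n₀ n ![u, C n₀ n u] + ‖P n₀ n u‖ ^ 2 := by
      refine (isCompact_sphere (0 : E) 1).eventually_forall_of_forall_eventually fun u hu => ?_
      have h2 : ContinuousAt (fun p : N × E => P n₀ p.1 p.2) (n₀, u) :=
        ContinuousAt.clm_apply
          (ContinuousAt.comp (f := Prod.fst) (x := (n₀, u)) (hP n₀) continuousAt_fst) continuousAt_snd
      exact ((heval n₀ u).add (h2.norm.pow 2)).eventually_const_lt (hpos u hu)
    filter_upwards [hev, hsrc n₀] with n hn hns v
    set w := v - flowProj E θ (φ n) v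
    have hPw : flowProj E θ (φ n) w = 0 := by
      simp only [w, map_sub, hθ.flowProj_flowProj (hfix n), sub_self]
    have hQ : pairing (Ω (φ n)) v (flowSaw E θ (φ n) v) =
        pairing (Ω (φ n)) w (flowSaw E θ (φ n) w) := by
      have h1 : flowSaw E θ (φ n) w = flowSaw E θ (φ n) v := by
        simp only [w, map_sub, hθ.flowSaw_flowProj (hfix n), sub_zero]
      rw [h1]
      simp only [w, map_sub, LinearMap.sub_apply]
      rw [hθ.pairing_flowSaw_symm (hfix n) (hinv n) (flowProj E θ (φ n) v),
        hθ.flowSaw_flowProj (hfix n), map_zero, sub_zero]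
    rw [hQ]
    rcases eq_or_ne w 0 with hw | hw
    · rw [hw]; simp
    · set u := dc n₀ n w
      have hu0 : u ≠ 0 := fun h => hw (by rw [← hdsdc n₀ n hns w]; simp only [u] at h; rw [h, map_zero])
      have h1 := hn (‖u‖⁻¹ • u) (by simp [norm_smul, hu0])
      rw [hWC n₀ n hns, map_smul] at h1
      have h2 : P n₀ n (‖u‖⁻¹ • u) = 0 := by
        rw [map_smul]
        change ‖u‖⁻¹ • dc n₀ n (flowProj E θ (φ n) (ds n₀ n u)) = 0
        rw [hdsdc n₀ n hns, hPw, map_zero, smul_zero]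
      rw [h2, hdsdc n₀ n hns] at h1
      simp only [map_smul, LinearMap.smul_apply, smul_eq_mul, norm_zero] at h1
      have h3 : 0 < ‖u‖⁻¹ := by positivity
      by_contra hneg
      have := mul_neg_of_pos_of_neg h3 (mul_neg_of_pos_of_neg h3 (not_le.1 hneg))
      linarith
  have := IsClopen.eq_univ ⟨hclosed, hopen⟩ ⟨n₁, h₁⟩
  exact (this ▸ mem_univ n₂ : n₂ ∈ S)

end IsCircleFlow
end Signature

/-! ### Determinants and rotations in the plane -/

section PlaneVectors

/-- The determinant of two vectors in the plane. -/
def det2 (α β : Fin 2 → ℝ) : ℝ := α 0 * β 1 - α 1 * β 0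

/-- The vector `α` rotated by a right angle. -/
def rot (α : Fin 2 → ℝ) : Fin 2 → ℝ := ![-α 1, α 0]

theorem dot_rot (α β : Fin 2 → ℝ) : β ⬝ᵥ rot α = det2 α β := by
  simp [dotProduct, Fin.sum_univ_two, rot, det2]; ring

theorem det2_swap (α β : Fin 2 → ℝ) : det2 α β = -det2 β α := by
  simp only [det2]; ring

theorem det2_self (α : Fin 2 → ℝ) : det2 α α = 0 := by
  simp only [det2]; ring

theorem rot_ne_zero {α : Fin 2 → ℝ} (h : α ≠ 0) : rot α ≠ 0 := by
  refine fun h0 => h ?_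
  funext i
  have h1 := congrFun h0 0
  have h2 := congrFun h0 1
  fin_cases i
  · simpa [rot] using h2
  · simpa [rot] using h1

theorem exists_eq_smul_of_det2_eq_zero {α β : Fin 2 → ℝ} (hα : α ≠ 0) (h : det2 α β = 0) :
    ∃ k : ℝ, β = k • α := by
  simp only [det2] at h
  have hα' : 0 < α 0 ^ 2 + α 1 ^ 2 := by
    by_contra hneg
    refine hα (funext fun i => ?_)
    fin_cases i <;> simp <;> nlinarith [sq_nonneg (α 0), sq_nonneg (α 1)]
  refine ⟨(α 0 * β 0 + α 1 * β 1) / (α 0 ^ 2 + α 1 ^ 2), funext fun i => ?_⟩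
  fin_cases i
  · simp only [Fin.zero_eta, Pi.smul_apply, smul_eq_mul]
    rw [div_mul_eq_mul_div, eq_div_iff hα'.ne']
    linear_combination α 1 * h * (-1)
  · simp only [Fin.mk_one, Pi.smul_apply, smul_eq_mul]
    rw [div_mul_eq_mul_div, eq_div_iff hα'.ne']
    linear_combination α 0 * h

theorem det2_ne_zero_of_linearIndependent {α β : Fin 2 → ℝ}
    (h : LinearIndependent ℝ ![α, β]) : det2 α β ≠ 0 := by
  intro h0
  have hα : α ≠ 0 := h.ne_zero (0 : Fin 2)
  obtain ⟨k, hk⟩ := exists_eq_smul_of_det2_eq_zero hα h0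
  have := (LinearIndependent.pair_iff.1 h) k (-1) (by rw [hk]; simp)
  norm_num at this

theorem ne_zero_of_det2_ne_zero {α β : Fin 2 → ℝ} (h : det2 α β ≠ 0) : α ≠ 0 := by
  rintro rfl
  simp [det2] at h

/-- A vector on which two independent covectors take given values. -/
theorem exists_dot_eq {α β : Fin 2 → ℝ} (h : det2 α β ≠ 0) (s t : ℝ) :
    ∃ ζ : Fin 2 → ℝ, α ⬝ᵥ ζ = s ∧ β ⬝ᵥ ζ = t := by
  refine ⟨![(s * β 1 - t * α 1) / det2 α β, (t * α 0 - s * β 0) / det2 α β], ?_, ?_⟩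
  · simp only [dotProduct, Fin.sum_univ_two, Matrix.cons_val_zero, Matrix.cons_val_one]
    field_simp
    simp only [det2]; ring
  · simp only [dotProduct, Fin.sum_univ_two, Matrix.cons_val_zero, Matrix.cons_val_one]
    field_simp
    simp only [det2]; ring

theorem det2_rot_ne_zero {α : Fin 2 → ℝ} (h : α ≠ 0) : det2 α (rot α) ≠ 0 := by
  intro h0
  refine h (funext fun i => ?_)
  simp [det2, rot] at h0
  fin_cases i <;> simp <;> nlinarith [sq_nonneg (α 0), sq_nonneg (α 1)]

theorem exists_dot_eq_of_ne_zero {α : Fin 2 → ℝ} (h : α ≠ 0) (s : ℝ) :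
    ∃ ζ : Fin 2 → ℝ, α ⬝ᵥ ζ = s := by
  obtain ⟨ζ, hζ, -⟩ := exists_dot_eq (det2_rot_ne_zero h) s 0
  exact ⟨ζ, hζ⟩

end PlaneVectors

/-! ### Weight planes in a six-dimensional symplectic representation -/

section RotPlanes

variable {E : Type*} [NormedAddCommGroup E] [NormedSpace ℝ E]

/-- A representation of the torus, as a family of operators indexed by its Lie algebra, acts on the
span of `a` and `b` by rotations of weight `α`, and `ω` is positive on `a, b`. -/
structure IsRotPlane (Ω : E [⋀^Fin 2]→L[ℝ] ℝ) (ρ : (Fin 2 → ℝ) → E →L[ℝ] E) (α : Fin 2 → ℝ)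
    (a b : E) : Prop where
  pos : 0 < pairing Ω a b
  left : ∀ ζ, ρ ζ a = Real.cos (α ⬝ᵥ ζ) • a + Real.sin (α ⬝ᵥ ζ) • b
  right : ∀ ζ, ρ ζ b = -Real.sin (α ⬝ᵥ ζ) • a + Real.cos (α ⬝ᵥ ζ) • b

variable {Ω : E [⋀^Fin 2]→L[ℝ] ℝ} {ρ : (Fin 2 → ℝ) → E →L[ℝ] E} {α β : Fin 2 → ℝ} {a b c d : E}

namespace IsRotPlane

theorem combo (h : IsRotPlane Ω ρ α a b) {ζ : Fin 2 → ℝ} {t : ℝ} (hζ : α ⬝ᵥ ζ = t) (x y : ℝ) :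
    ρ ζ (x • a + y • b) = (x * Real.cos t - y * Real.sin t) • a +
      (x * Real.sin t + y * Real.cos t) • b := by
  rw [map_add, map_smul, map_smul, h.left, h.right, hζ]
  module

theorem combo_zero (h : IsRotPlane Ω ρ α a b) {ζ : Fin 2 → ℝ} (hζ : α ⬝ᵥ ζ = 0) (x y : ℝ) :
    ρ ζ (x • a + y • b) = x • a + y • b := by
  rw [h.combo hζ]; simp

theorem combo_pi (h : IsRotPlane Ω ρ α a b) {ζ : Fin 2 → ℝ} (hζ : α ⬝ᵥ ζ = Real.pi) (x y : ℝ) :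
    ρ ζ (x • a + y • b) = -(x • a + y • b) := by
  rw [h.combo hζ]; simp; module

theorem combo_pi_div_two (h : IsRotPlane Ω ρ α a b) {ζ : Fin 2 → ℝ} (hζ : α ⬝ᵥ ζ = Real.pi / 2)
    (x y : ℝ) : ρ ζ (x • a + y • b) = x • b - y • a := by
  rw [h.combo hζ]; simp; module

/-- A rotation by an angle with trivial action is a full turn. -/
theorem cos_eq_one (h : IsRotPlane Ω ρ α a b) {ζ : Fin 2 → ℝ} (hζ : ρ ζ a = a) :
    Real.cos (α ⬝ᵥ ζ) = 1 := by
  have h1 := h.left ζ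
  rw [hζ] at h1
  have h2 := congrArg (fun u => pairing Ω u b) h1
  simp only [map_add, map_smul, LinearMap.add_apply, LinearMap.smul_apply, pairing_self,
    smul_eq_mul, mul_zero, add_zero] at h2
  have := h.pos
  nlinarith [mul_right_cancel₀ this.ne' (h2.symm.trans (one_mul _).symm)]

end IsRotPlane

/-- Two covectors are separated by a vector if one of them vanishes on it and the other one takes
the value `π`. -/
def Separated (α β : Fin 2 → ℝ) : Prop :=
  ∃ ζ : Fin 2 → ℝ, (α ⬝ᵥ ζ = Real.pi ∧ β ⬝ᵥ ζ = 0) ∨ (α ⬝ᵥ ζ = 0 ∧ β ⬝ᵥ ζ = Real.pi)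

theorem separated_of_det2 (h : det2 α β ≠ 0) : Separated α β :=
  let ⟨ζ, hζ⟩ := exists_dot_eq h Real.pi 0
  ⟨ζ, Or.inl hζ⟩

theorem Separated.symm (h : Separated α β) : Separated β α :=
  let ⟨ζ, hζ⟩ := h
  ⟨ζ, hζ.symm.imp And.symm And.symm⟩

theorem separated_zero (h : β ≠ 0) : Separated 0 β :=
  let ⟨ζ, hζ⟩ := exists_dot_eq_of_ne_zero h Real.pi
  ⟨ζ, Or.inr ⟨by simp, hζ⟩⟩

theorem pairing_combo (Ω : E [⋀^Fin 2]→L[ℝ] ℝ) (a b : E) (x y z w : ℝ) :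
    pairing Ω (x • a + y • b) (z • a + w • b) = (x * w - y * z) * pairing Ω a b := by
  simp only [map_add, map_smul, LinearMap.add_apply, LinearMap.smul_apply, pairing_self,
    smul_eq_mul, pairing_swap Ω b a]
  ring

variable (hinv : ∀ ζ u v, pairing Ω (ρ ζ u) (ρ ζ v) = pairing Ω u v)
include hinv

/-- Planes with separated weights are orthogonal. -/
theorem pairing_eq_zero_of_separated (h : IsRotPlane Ω ρ α a b) (h' : IsRotPlane Ω ρ β c d)
    (hs : Separated α β) (x y z w : ℝ) :
    pairing Ω (x • a + y • b) (z • c + w • d) = 0 := by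
  -- The operator `ρ ζ` is `-1` on one plane and `1` on the other, so invariance makes the pairing
  -- equal to its negative.
  obtain ⟨ζ, ⟨h1, h2⟩ | ⟨h1, h2⟩⟩ := hs
  · have := hinv ζ (x • a + y • b) (z • c + w • d)
    rw [h.combo_pi h1, h'.combo_zero h2, map_neg, LinearMap.neg_apply] at this
    linarith
  · have := hinv ζ (x • a + y • b) (z • c + w • d)
    rw [h.combo_zero h1, h'.combo_pi h2, map_neg] at this
    linarith

/-- Planes with pairwise separated weights are independent. -/
theorem linearIndependent_of_separated {n : ℕ} {α : Fin n → Fin 2 → ℝ} {a b : Fin n → E}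
    (h : ∀ i, IsRotPlane Ω ρ (α i) (a i) (b i)) (hs : ∀ i j, i ≠ j → Separated (α i) (α j)) :
    LinearIndependent ℝ (Sum.elim a b) := by
  rw [Fintype.linearIndependent_iff]
  intro g hg
  rw [Fintype.sum_sum_type] at hg
  simp only [Sum.elim_inl, Sum.elim_inr, ← Finset.sum_add_distrib] at hg
  have key : ∀ i z w, (g (.inl i) * w - g (.inr i) * z) * pairing Ω (a i) (b i) = 0 := by
    intro i z w
    have h1 := congrArg (fun u => pairing Ω u (z • a i + w • b i)) hg
    simp only [map_sum, LinearMap.sum_apply, map_zero, LinearMap.zero_apply] at h1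
    rw [Finset.sum_eq_single i] at h1
    · rwa [pairing_combo] at h1
    · intro j _ hj
      exact pairing_eq_zero_of_separated hinv (h j) (h i) (hs j i hj) _ _ _ _
    · simp
  rintro (i | i)
  · simpa [(h i).pos.ne'] using key i 0 1
  · simpa [(h i).pos.ne'] using key i 1 0

/-- Four such planes would give eight independent vectors in dimension six. Separation rather than
independence of the weights also allows one weight to be zero. -/
theorem not_four_planes [FiniteDimensional ℝ E] (hE : Module.finrank ℝ E = 6)
    {α : Fin 4 → Fin 2 → ℝ} {a b : Fin 4 → E}
    (h : ∀ i, IsRotPlane Ω ρ (α i) (a i) (b i)) (hs : ∀ i j, i < j → Separated (α i) (α j)) :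
    False := by
  have h1 := (linearIndependent_of_separated hinv h fun i j hij => (lt_or_gt_of_ne hij).elim
    (hs i j) fun hji => (hs j i hji).symm).fintype_card_le_finrank
  simp [hE] at h1

/-- Three planes with pairwise independent weights decompose the space. -/
theorem exists_combo_of_three_planes [FiniteDimensional ℝ E] (hE : Module.finrank ℝ E = 6)
    {α : Fin 3 → Fin 2 → ℝ} {a b : Fin 3 → E}
    (h : ∀ i, IsRotPlane Ω ρ (α i) (a i) (b i)) (hs : ∀ i j, i ≠ j → det2 (α i) (α j) ≠ 0) (u : E) :
    ∃ x y : Fin 3 → ℝ, u = ∑ i, (x i • a i + y i • b i) := by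
  have h1 := linearIndependent_of_separated hinv h fun i j hij => separated_of_det2 (hs i j hij)
  have h2 := h1.span_eq_top_of_card_eq_finrank (by simp [hE])
  have h3 : u ∈ Submodule.span ℝ (range (Sum.elim a b)) := h2 ▸ Submodule.mem_top
  obtain ⟨g, hg⟩ := (Submodule.mem_span_range_iff_exists_fun ℝ).1 h3
  refine ⟨fun i => g (.inl i), fun i => g (.inr i), ?_⟩
  rw [← hg, Fintype.sum_sum_type, Finset.sum_add_distrib]
  rfl

/-- A nonzero invariant subspace contains one of the weight planes. -/
theorem exists_plane_le_of_invariant [FiniteDimensional ℝ E] (hE : Module.finrank ℝ E = 6)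
    {α : Fin 3 → Fin 2 → ℝ} {a b : Fin 3 → E}
    (h : ∀ i, IsRotPlane Ω ρ (α i) (a i) (b i)) (hs : ∀ i j, i ≠ j → det2 (α i) (α j) ≠ 0)
    {W : Submodule ℝ E} (hW : ∀ ζ, ∀ u ∈ W, ρ ζ u ∈ W) (hW0 : W ≠ ⊥) :
    ∃ i, a i ∈ W ∧ b i ∈ W := by
  obtain ⟨u, huW, hu0⟩ := (Submodule.ne_bot_iff W).1 hW0
  obtain ⟨x, y, hxy⟩ := exists_combo_of_three_planes hinv hE h hs u
  obtain ⟨i, hi⟩ : ∃ i, ¬ (x i = 0 ∧ y i = 0) := by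
    by_contra hne
    push Not at hne
    refine hu0 (hxy.trans (Finset.sum_eq_zero fun i _ => ?_))
    rw [(hne i).1, (hne i).2]; simp
  refine ⟨i, ?_⟩
  have huniv : ∃ j k, i ≠ j ∧ i ≠ k ∧ j ≠ k ∧
      ∀ f : Fin 3 → E, ∑ l, f l = f i + f j + f k := by
    fin_cases i
    · exact ⟨1, 2, by decide, by decide, by decide, fun f => Fin.sum_univ_three f⟩
    · exact ⟨0, 2, by decide, by decide, by decide, fun f => by
        rw [Fin.sum_univ_three]; simp only [Fin.mk_one]; abel⟩
    · exact ⟨0, 1, by decide, by decide, by decide, fun f => by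
        rw [Fin.sum_univ_three]; simp only [Fin.reduceFinMk]; abel⟩
  obtain ⟨j, k, hij, hik, -, hsum⟩ := huniv
  rw [hsum] at hxy
  set ui := x i • a i + y i • b i
  set uj := x j • a j + y j • b j
  set uk := x k • a k + y k • b k
  -- Both operators are `-1` on plane `i`; `ρ ζ` is `1` on plane `j`, and `ρ η` is `1` on plane `k`.
  -- Hence `(1 - ρ ζ)(1 - ρ η)` maps `u` to four times its component in plane `i`.
  obtain ⟨ζ, hζi, hζj⟩ := exists_dot_eq (hs i j hij) Real.pi 0
  obtain ⟨η, hηi, hηk⟩ := exists_dot_eq (hs i k hik) Real.pi 0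
  have hui : ui ∈ W := by
    have h1 : u - ρ η u ∈ W := W.sub_mem huW (hW η u huW)
    have h2 : (u - ρ η u) - ρ ζ (u - ρ η u) ∈ W := W.sub_mem h1 (hW ζ _ h1)
    have h3 : ∃ z w : ℝ, u - ρ η u = (2 : ℝ) • ui + (z • a j + w • b j) := by
      rw [hxy, map_add, map_add, (h i).combo_pi hηi, (h k).combo_zero hηk, (h j).combo rfl]
      refine ⟨x j - (x j * Real.cos (α j ⬝ᵥ η) - y j * Real.sin (α j ⬝ᵥ η)),
        y j - (x j * Real.sin (α j ⬝ᵥ η) + y j * Real.cos (α j ⬝ᵥ η)), ?_⟩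
      simp only [ui, uj, uk]
      module
    obtain ⟨z, w, hzw⟩ := h3
    rw [hzw, map_add, map_smul, (h i).combo_pi hζi, (h j).combo_zero hζj] at h2
    have h4 : (2 : ℝ) • ui + (z • a j + w • b j) - ((2 : ℝ) • -ui + (z • a j + w • b j)) =
        (4 : ℝ) • ui := by module
    rw [h4] at h2
    exact (W.smul_mem_iff (by norm_num : (4 : ℝ) ≠ 0)).1 h2
  -- A quarter turn of the component in plane `i` gives a second vector of `W`, and the two together
  -- span that plane.
  obtain ⟨κ, hκ⟩ := exists_dot_eq_of_ne_zero (ne_zero_of_det2_ne_zero (hs i j hij)) (Real.pi / 2)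
  have hvi : x i • b i - y i • a i ∈ W := (h i).combo_pi_div_two hκ (x i) (y i) ▸ hW κ _ hui
  have hr : x i ^ 2 + y i ^ 2 ≠ 0 := by
    intro h0
    refine hi ⟨?_, ?_⟩ <;> nlinarith [sq_nonneg (x i), sq_nonneg (y i)]
  constructor
  · refine (W.smul_mem_iff hr).1 ?_
    have : (x i ^ 2 + y i ^ 2) • a i = x i • ui - y i • (x i • b i - y i • a i) := by
      simp only [ui]; module
    rw [this]
    exact W.sub_mem (W.smul_mem _ hui) (W.smul_mem _ hvi)
  · refine (W.smul_mem_iff hr).1 ?_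
    have : (x i ^ 2 + y i ^ 2) • b i = y i • ui + x i • (x i • b i - y i • a i) := by
      simp only [ui]; module
    rw [this]
    exact W.add_mem (W.smul_mem _ hui) (W.smul_mem _ hvi)

/-- Every weight plane is part of a decomposition into three planes with pairwise independent
weights. -/
theorem exists_completion [FiniteDimensional ℝ E] (hE : Module.finrank ℝ E = 6)
    {α : Fin 3 → Fin 2 → ℝ} {a b : Fin 3 → E}
    (h : ∀ i, IsRotPlane Ω ρ (α i) (a i) (b i)) (hs : ∀ i j, i ≠ j → det2 (α i) (α j) ≠ 0)
    (h' : IsRotPlane Ω ρ β c d) :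
    ∃ (α' : Fin 3 → Fin 2 → ℝ) (a' b' : Fin 3 → E), (∀ i, IsRotPlane Ω ρ (α' i) (a' i) (b' i)) ∧
      (∀ i j, i ≠ j → det2 (α' i) (α' j) ≠ 0) ∧ α' 0 = β ∧ a' 0 = c ∧ b' 0 = d := by
  have hα : ∀ i, α i ≠ 0 := fun i => by
    obtain ⟨j, hj⟩ : ∃ j, i ≠ j := by
      fin_cases i
      · exact ⟨1, by decide⟩
      · exact ⟨0, by decide⟩
      · exact ⟨0, by decide⟩
    exact ne_zero_of_det2_ne_zero (hs i j hj)
  -- By dimension, `β` is parallel to some `α i`, and it is nonzero because zero is separated from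
  -- every nonzero weight. The new plane then takes the place of plane `i`.
  have hfour : ¬ ∀ i, Separated β (α i) := fun hsep => by
    refine not_four_planes hinv hE (α := Fin.cons β α) (a := Fin.cons c a) (b := Fin.cons d b)
      (fun i => ?_) fun i j => ?_
    · refine Fin.cases ?_ (fun i => ?_) i
      · exact h'
      · exact h i
    · refine Fin.cases ?_ (fun i => ?_) i <;> refine Fin.cases ?_ (fun j => ?_) j
      · simp
      · exact fun _ => hsep j
      · simp
      · exact fun hij => separated_of_det2 (hs i j fun he => by simp [he] at hij)
  have hβ : β ≠ 0 := by
    rintro rfl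
    exact hfour fun i => separated_zero (hα i)
  push Not at hfour
  obtain ⟨i, hi⟩ := hfour
  obtain ⟨k, hk⟩ := exists_eq_smul_of_det2_eq_zero (hα i) (by
    by_contra h0
    exact hi (separated_of_det2 h0).symm)
  have hk0 : k ≠ 0 := by
    rintro rfl
    exact hβ (by simpa using hk)
  have hβj : ∀ j, i ≠ j → det2 β (α j) ≠ 0 := fun j hij => by
    have : det2 β (α j) = k * det2 (α i) (α j) := by
      rw [hk]; simp only [det2, Pi.smul_apply, smul_eq_mul]; ring
    rw [this]
    exact mul_ne_zero hk0 (hs i j hij)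
  have hjk : ∃ j l, i ≠ j ∧ i ≠ l ∧ j ≠ l := by
    fin_cases i
    · exact ⟨1, 2, by decide, by decide, by decide⟩
    · exact ⟨0, 2, by decide, by decide, by decide⟩
    · exact ⟨0, 1, by decide, by decide, by decide⟩
  obtain ⟨j, l, hij, hil, hjl⟩ := hjk
  refine ⟨![β, α j, α l], ![c, a j, a l], ![d, b j, b l], ?_, ?_, rfl, rfl, rfl⟩
  · intro m
    fin_cases m
    · exact h'
    · exact h j
    · exact h l
  · intro m n hmn
    have h1 := hβj j hij
    have h2 := hβj l hil
    have h3 := hs j l hjl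
    have h1' := h1
    have h2' := h2
    have h3' := h3
    rw [det2_swap, neg_ne_zero] at h1' h2' h3'
    fin_cases m <;> fin_cases n <;> first | exact absurd rfl hmn | assumption

end RotPlanes

/-! ### Fourier integrals of constants and of the sawtooth -/

section RotationIntegrals

variable {m : ℝ}

theorem sin_eq_zero_of_cos_eq_one {t : ℝ} (h : Real.cos t = 1) : Real.sin t = 0 := by
  have := Real.sin_sq_add_cos_sq t
  rw [h] at this
  nlinarith [sq_nonneg (Real.sin t)]

/-- Here and below, `cos (2πm) = 1` expresses that `m` is an integer, in the form in which
periodicity of a flow provides it. -/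
theorem integral_cos_mul_of_period (hm : m ≠ 0) (h : Real.cos (2 * Real.pi * m) = 1) :
    ∫ s in (0 : ℝ)..2 * Real.pi, Real.cos (s * m) = 0 := by
  have hs := sin_eq_zero_of_cos_eq_one h
  rw [intervalIntegral.integral_comp_mul_right Real.cos hm, integral_cos]
  simp [hs]

theorem integral_sin_mul_of_period (hm : m ≠ 0) (h : Real.cos (2 * Real.pi * m) = 1) :
    ∫ s in (0 : ℝ)..2 * Real.pi, Real.sin (s * m) = 0 := by
  rw [intervalIntegral.integral_comp_mul_right Real.sin hm, integral_sin]
  simp [h]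

theorem hasDerivAt_mul_const_trig (s : ℝ) :
    HasDerivAt (fun s : ℝ => Real.sin (s * m)) (Real.cos (s * m) * m) s ∧
      HasDerivAt (fun s : ℝ => Real.cos (s * m)) (-Real.sin (s * m) * m) s := by
  have h : HasDerivAt (fun s : ℝ => s * m) m s := by simpa using (hasDerivAt_id s).mul_const m
  exact ⟨h.sin, h.cos⟩

theorem integral_sawtooth_cos (hm : m ≠ 0) (h : Real.cos (2 * Real.pi * m) = 1) :
    ∫ s in (0 : ℝ)..2 * Real.pi, (Real.pi - s) * Real.cos (s * m) = 0 := by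
  have hs := sin_eq_zero_of_cos_eq_one h
  have hd : ∀ s ∈ uIcc (0 : ℝ) (2 * Real.pi), HasDerivAt
      (fun s => (Real.pi - s) * Real.sin (s * m) / m - Real.cos (s * m) / m ^ 2)
      ((Real.pi - s) * Real.cos (s * m)) s := fun s _ => by
    obtain ⟨h1, h2⟩ := hasDerivAt_mul_const_trig (m := m) s
    refine HasDerivAt.congr_deriv (((((hasDerivAt_id s).const_sub Real.pi).mul h1).div_const m).sub
      (h2.div_const (m ^ 2))) ?_
    simp only [id]
    field_simp
    ring
  rw [intervalIntegral.integral_eq_sub_of_hasDerivAt hd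
    (Continuous.intervalIntegrable (by fun_prop) _ _)]
  simp [hs, h]

theorem integral_sawtooth_sin (hm : m ≠ 0) (h : Real.cos (2 * Real.pi * m) = 1) :
    ∫ s in (0 : ℝ)..2 * Real.pi, (Real.pi - s) * Real.sin (s * m) = 2 * Real.pi / m := by
  have hs := sin_eq_zero_of_cos_eq_one h
  have hd : ∀ s ∈ uIcc (0 : ℝ) (2 * Real.pi), HasDerivAt
      (fun s => -((Real.pi - s) * Real.cos (s * m)) / m - Real.sin (s * m) / m ^ 2)
      ((Real.pi - s) * Real.sin (s * m)) s := fun s _ => by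
    obtain ⟨h1, h2⟩ := hasDerivAt_mul_const_trig (m := m) s
    refine HasDerivAt.congr_deriv
      (((((hasDerivAt_id s).const_sub Real.pi).mul h2).neg.div_const m).sub
      (h1.div_const (m ^ 2))) ?_
    simp only [id]
    field_simp
    ring
  rw [intervalIntegral.integral_eq_sub_of_hasDerivAt hd
    (Continuous.intervalIntegrable (by fun_prop) _ _)]
  simp [hs, h]
  field_simp
  ring

end RotationIntegrals

/-! ### The averaging operators on weight planes -/

section FlowWeights

variable {E : Type*} [NormedAddCommGroup E] [NormedSpace ℝ E] [CompleteSpace E]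
  {M : Type*} [TopologicalSpace M] [ChartedSpace E M] [IsManifold 𝓘(ℝ, E) ∞ M] {θ : ℝ → M → M}

namespace IsCircleFlow
variable (hθ : IsCircleFlow (E := E) θ) {x : M} (hx : x ∈ flowFixed θ) {a b : E} {m : ℝ}
include hθ hx

theorem flowAverage_rot {h : ℝ → ℝ} (hh : Continuous h)
    (hrot : ∀ s, tderiv E E (θ s) x a = Real.cos (s * m) • a + Real.sin (s * m) • b) :
    flowAverage E θ h x a = (∫ s in (0 : ℝ)..2 * Real.pi, h s * Real.cos (s * m)) • a +
      (∫ s in (0 : ℝ)..2 * Real.pi, h s * Real.sin (s * m)) • b := by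
  rw [hθ.flowAverage_apply hh hx]
  simp_rw [hrot, smul_add, smul_smul]
  rw [intervalIntegral.integral_add, intervalIntegral.integral_smul_const,
    intervalIntegral.integral_smul_const]
  · exact Continuous.intervalIntegrable (by fun_prop) _ _
  · exact Continuous.intervalIntegrable (by fun_prop) _ _

theorem flowProj_rot (hm : m ≠ 0) (hp : Real.cos (2 * Real.pi * m) = 1)
    (hrot : ∀ s, tderiv E E (θ s) x a = Real.cos (s * m) • a + Real.sin (s * m) • b) :
    flowProj E θ x a = 0 := by
  rw [flowProj, hθ.flowAverage_rot hx continuous_const hrot, intervalIntegral.integral_const_mul,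
    intervalIntegral.integral_const_mul, integral_cos_mul_of_period hm hp,
    integral_sin_mul_of_period hm hp]
  simp

theorem flowSaw_rot (hp : Real.cos (2 * Real.pi * m) = 1)
    (hrot : ∀ s, tderiv E E (θ s) x a = Real.cos (s * m) • a + Real.sin (s * m) • b) :
    flowSaw E θ x a = (2 * Real.pi / m) • b := by
  rw [flowSaw, hθ.flowAverage_rot hx (by fun_prop) hrot]
  -- For `m = 0` the formula relies on `2π / 0 = 0`, which agrees with the sawtooth having mean
  -- zero.
  rcases eq_or_ne m 0 with rfl | hm
  · simp [integral_pi_sub]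
  · rw [integral_sawtooth_cos hm hp, integral_sawtooth_sin hm hp]
    simp

variable {Ω : E [⋀^Fin 2]→L[ℝ] ℝ} {ρ : (Fin 2 → ℝ) → E →L[ℝ] E} {η : Fin 2 → ℝ}

section OnePlane
variable (hρ : ∀ s, tderiv E E (θ s) x = ρ (s • η)) {α : Fin 2 → ℝ} (h : IsRotPlane Ω ρ α a b)
include hρ h

theorem rot_left (s : ℝ) : tderiv E E (θ s) x a =
    Real.cos (s * (α ⬝ᵥ η)) • a + Real.sin (s * (α ⬝ᵥ η)) • b := by
  rw [hρ, h.left, dotProduct_smul, smul_eq_mul]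

/-- Stated in the form of a left rotation of the pair `(b, -a)`, so that the formulas for the first
vector of a plane apply to the second one too. -/
theorem rot_right (s : ℝ) : tderiv E E (θ s) x b =
    Real.cos (s * (α ⬝ᵥ η)) • b + Real.sin (s * (α ⬝ᵥ η)) • -a := by
  rw [hρ, h.right, dotProduct_smul, smul_eq_mul]
  module

theorem cos_period : Real.cos (2 * Real.pi * (α ⬝ᵥ η)) = 1 := by
  have h1 : ρ ((2 * Real.pi) • η) a = a := by
    have h0 := hθ.tderiv_periodic x 0
    simp only [zero_add, hθ.tderiv_zero] at h0
    rw [← hρ, h0]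
    rfl
  have := h.cos_eq_one h1
  rwa [dotProduct_smul, smul_eq_mul] at this

theorem flowProj_plane (hm : α ⬝ᵥ η ≠ 0) (y z : ℝ) : flowProj E θ x (y • a + z • b) = 0 := by
  have hp := hθ.cos_period hx hρ h
  rw [map_add, map_smul, map_smul, hθ.flowProj_rot hx hm hp (hθ.rot_left hx hρ h),
    hθ.flowProj_rot hx hm hp (hθ.rot_right hx hρ h)]
  simp

theorem flowProj_plane_zero (hm : α ⬝ᵥ η = 0) (y z : ℝ) :
    flowProj E θ x (y • a + z • b) = y • a + z • b := by
  refine hθ.flowProj_eq_self hx fun s => ?_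
  rw [map_add, map_smul, map_smul, hθ.rot_left hx hρ h, hθ.rot_right hx hρ h]
  simp [hm]

theorem flowSaw_plane (y z : ℝ) :
    flowSaw E θ x (y • a + z • b) =
      (-(2 * Real.pi / (α ⬝ᵥ η) * z)) • a + (2 * Real.pi / (α ⬝ᵥ η) * y) • b := by
  have hp := hθ.cos_period hx hρ h
  rw [map_add, map_smul, map_smul, hθ.flowSaw_rot hx hp (hθ.rot_left hx hρ h),
    hθ.flowSaw_rot hx hp (hθ.rot_right hx hρ h)]
  module

end OnePlane

variable [FiniteDimensional ℝ E] (hE : Module.finrank ℝ E = 6)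
  (hρ : ∀ s, tderiv E E (θ s) x = ρ (s • η))
  (hinv : ∀ ζ u v, pairing Ω (ρ ζ u) (ρ ζ v) = pairing Ω u v)
  {α : Fin 3 → Fin 2 → ℝ} {a b : Fin 3 → E} (h : ∀ i, IsRotPlane Ω ρ (α i) (a i) (b i))
  (hs : ∀ i j, i ≠ j → det2 (α i) (α j) ≠ 0)
include hE hρ hinv h hs

/-- The projection is the identity on the plane of weight zero for the circle and kills the other
two planes, so its range is that plane. -/
theorem finrank_range_flowProj (h0 : α 0 ⬝ᵥ η = 0) (h1 : α 1 ⬝ᵥ η ≠ 0) (h2 : α 2 ⬝ᵥ η ≠ 0) :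
    Module.finrank ℝ (LinearMap.range (flowProj E θ x : E →ₗ[ℝ] E)) = 2 := by
  have hli : LinearIndependent ℝ ![a 0, b 0] := by
    have h3 := linearIndependent_of_separated hinv h
      fun i j hij => separated_of_det2 (hs i j hij)
    have h4 := h3.comp (![Sum.inl 0, Sum.inr 0] : Fin 2 → Fin 3 ⊕ Fin 3) (by decide)
    convert h4 using 1
    funext i; fin_cases i <;> rfl
  have hr : LinearMap.range (flowProj E θ x : E →ₗ[ℝ] E) =
      Submodule.span ℝ (range ![a 0, b 0]) := by
    refine le_antisymm ?_ ?_
    · rintro _ ⟨u, rfl⟩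
      obtain ⟨y, z, rfl⟩ := exists_combo_of_three_planes hinv hE h hs u
      rw [Fin.sum_univ_three]
      change flowProj E θ x _ ∈ _
      rw [map_add, map_add, hθ.flowProj_plane_zero hx hρ (h 0) h0,
        hθ.flowProj_plane hx hρ (h 1) h1, hθ.flowProj_plane hx hρ (h 2) h2, add_zero, add_zero]
      exact Submodule.add_mem _
        (Submodule.smul_mem _ _ (Submodule.subset_span ⟨0, rfl⟩))
        (Submodule.smul_mem _ _ (Submodule.subset_span ⟨1, rfl⟩))
    · refine Submodule.span_le.2 ?_
      rintro _ ⟨i, rfl⟩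
      fin_cases i
      · refine ⟨a 0, ?_⟩
        simpa using hθ.flowProj_plane_zero hx hρ (h 0) h0 1 0
      · refine ⟨b 0, ?_⟩
        simpa using hθ.flowProj_plane_zero hx hρ (h 0) h0 0 1
  rw [hr, finrank_span_eq_card hli]
  simp

/-- The signature of the sawtooth form is given by the signs of the weights of the circle. -/
theorem sawNonneg_iff : (∀ u, 0 ≤ pairing Ω u (flowSaw E θ x u)) ↔ ∀ i, 0 ≤ α i ⬝ᵥ η := by
  constructor
  · intro hpos i
    have h1 := hpos ((1 : ℝ) • a i + (0 : ℝ) • b i)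
    rw [hθ.flowSaw_plane hx hρ (h i), pairing_combo] at h1
    by_contra hneg
    have h2 : 2 * Real.pi / (α i ⬝ᵥ η) < 0 := div_neg_of_pos_of_neg Real.two_pi_pos (not_le.1 hneg)
    have h3 := mul_neg_of_neg_of_pos h2 (h i).pos
    simp only [one_mul, mul_one, zero_mul, sub_zero] at h1
    linarith
  · intro hpos u
    obtain ⟨y, z, rfl⟩ := exists_combo_of_three_planes hinv hE h hs u
    have h1 : flowSaw E θ x (∑ i, (y i • a i + z i • b i)) =
        ∑ i, ((-(2 * Real.pi / (α i ⬝ᵥ η) * z i)) • a i +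
          (2 * Real.pi / (α i ⬝ᵥ η) * y i) • b i) := by
      rw [map_sum]
      exact Finset.sum_congr rfl fun i _ => hθ.flowSaw_plane hx hρ (h i) (y i) (z i)
    rw [h1, map_sum]
    refine Finset.sum_nonneg fun i _ => ?_
    rw [map_sum, LinearMap.sum_apply, Finset.sum_eq_single i
      (fun j _ hj => pairing_eq_zero_of_separated hinv (h j) (h i)
        (separated_of_det2 (hs j i hj)) _ _ _ _) (by simp), pairing_combo]
    have h2 : 0 ≤ 2 * Real.pi / (α i ⬝ᵥ η) := div_nonneg Real.two_pi_pos.le (hpos i)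
    have h3 : 0 ≤ 2 * Real.pi / (α i ⬝ᵥ η) * (y i ^ 2 + z i ^ 2) * pairing Ω (a i) (b i) :=
      mul_nonneg (mul_nonneg h2 (by positivity)) (h i).pos.le
    linarith

end IsCircleFlow
end FlowWeights

/-! ### The exponential map of the torus -/

section TorusExp

theorem texp_add (ξ ζ : Fin 2 → ℝ) : texp (ξ + ζ) = texp ξ * texp ζ := by
  simp [texp, Circle.exp_add]

theorem texp_zero : texp 0 = 1 := by
  simp [texp]

theorem texp_two_pi_int (k : Fin 2 → ℤ) : texp ((2 * Real.pi) • fun i => (k i : ℝ)) = 1 := by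
  simp only [texp, Pi.smul_apply, smul_eq_mul, mul_comm (2 * Real.pi)]
  ext1 <;> exact Circle.exp_int_mul_two_pi _

theorem texp_surjective : Function.Surjective texp := by
  rintro ⟨z, w⟩
  obtain ⟨s, rfl⟩ := Circle.exp_surjective z
  obtain ⟨t, rfl⟩ := Circle.exp_surjective w
  exact ⟨![s, t], rfl⟩

theorem contMDiff_texp_smul (η : Fin 2 → ℝ) :
    ContMDiff 𝓘(ℝ, ℝ) ((𝓡 1).prod (𝓡 1)) ∞ (fun s : ℝ => texp (s • η)) := by
  have h : ∀ i, ContMDiff 𝓘(ℝ, ℝ) 𝓘(ℝ, ℝ) ∞ fun s : ℝ => (s • η) i := fun i => by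
    refine ContDiff.contMDiff ?_
    simp only [Pi.smul_apply, smul_eq_mul]
    fun_prop
  exact (contMDiff_circleExp.comp (h 0)).prodMk (contMDiff_circleExp.comp (h 1))

end TorusExp

/-! ### Torus actions, their circle subgroups and isotropy representations -/

section TorusActions

variable {M : Type*} [TopologicalSpace M] [ChartedSpace (EuclideanSpace ℝ (Fin 6)) M]

/-- The model space of the six-dimensional manifolds. -/
abbrev Model : Type := EuclideanSpace ℝ (Fin 6)

/-- A two-form, with the tangent spaces written as the model space. -/
def TwoForm.model (Ω : TwoForm M) : M → Model [⋀^Fin 2]→L[ℝ] ℝ := fun x => Ω x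

variable [MulAction Torus M]

/-- The flow of the fundamental vector field of `η`. -/
def torusFlow (η : Fin 2 → ℝ) (s : ℝ) (x : M) : M := texp (s • η) • x

/-- The isotropy action of `exp ζ` at a fixed point. -/
def isoRep (x : M) (ζ : Fin 2 → ℝ) : Model →L[ℝ] Model :=
  tderiv Model Model (fun y : M => texp ζ • y) x

/-- The fundamental vector field, with the tangent spaces written as the model space. -/
def fundVec (ξ : Fin 2 → ℝ) (x : M) : Model :=
  tderiv ℝ Model (fun s : ℝ => texp (s • ξ) • x) 0 1

theorem isWeightPlane_iff {Ω : TwoForm M} {x : M} {α : Fin 2 → ℝ} {a b : Model} :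
    IsWeightPlane Ω x α a b ↔ IsRotPlane (Ω.model x) (isoRep x) α a b :=
  ⟨fun h => ⟨h.pos, h.rot_left, h.rot_right⟩, fun h => ⟨h.pos, h.left, h.right⟩⟩

theorem tderiv_torusFlow (η : Fin 2 → ℝ) (s : ℝ) (x : M) :
    tderiv Model Model (torusFlow η s) x = isoRep x (s • η) := rfl

theorem mem_flowFixed_of_mem_fixedPoints {x : M} (hx : x ∈ MulAction.fixedPoints Torus M)
    (η : Fin 2 → ℝ) : x ∈ flowFixed (torusFlow η) := fun _ => hx _

variable [IsManifold (𝓡 6) ∞ M] [ContMDiffSMul ((𝓡 1).prod (𝓡 1)) (𝓡 6) ∞ Torus M]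

theorem contMDiff_smul_torus (t : Torus) : ContMDiff (𝓡 6) (𝓡 6) ∞ (fun y : M => t • y) :=
  ContMDiffSMul.contMDiff_const_smul (I := (𝓡 1).prod (𝓡 1)) t

theorem mdifferentiableAt_smul_torus (t : Torus) (x : M) :
    MDifferentiableAt (𝓡 6) (𝓡 6) (fun y : M => t • y) x :=
  (contMDiff_smul_torus t).mdifferentiable (by simp) x

theorem contMDiff_torusFlow (η : Fin 2 → ℝ) :
    ContMDiff (𝓘(ℝ, ℝ).prod (𝓡 6)) (𝓡 6) ∞ (fun p : ℝ × M => torusFlow η p.1 p.2) := by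
  have h1 : ContMDiff (𝓘(ℝ, ℝ).prod (𝓡 6)) ((𝓡 1).prod (𝓡 1)) ∞
      (fun p : ℝ × M => texp (p.1 • η)) := (contMDiff_texp_smul η).comp contMDiff_fst
  exact h1.smul (I := (𝓡 1).prod (𝓡 1)) contMDiff_snd

/-- The flow of an integral vector is periodic. -/
theorem isCircleFlow_torusFlow (k : Fin 2 → ℤ) :
    IsCircleFlow (E := Model) (torusFlow (M := M) fun i => (k i : ℝ)) where
  smooth := contMDiff_torusFlow _
  zero x := by simp [torusFlow, texp_zero]
  add s t x := by simp [torusFlow, add_smul, texp_add, mul_smul]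
  period x := by simp only [torusFlow, texp_two_pi_int, one_smul]

variable {Ω : TwoForm M} {μ : M → Fin 2 → ℝ}

theorem IsHamiltonian.pairing_inv (h : IsHamiltonian Ω μ) {x : M} {t : Torus} (hx : t • x = x)
    (u v : Model) : pairing (Ω.model x) (tderiv Model Model (fun y : M => t • y) x u)
      (tderiv Model Model (fun y : M => t • y) x v) = pairing (Ω.model x) u v := by
  have h1 : Ω.model (t • x) ![tderiv Model Model (fun y : M => t • y) x u,
      tderiv Model Model (fun y : M => t • y) x v] = Ω.model x ![u, v] :=
    h.action_preserves t x u v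
  rw [hx] at h1
  exact h1

theorem IsHamiltonian.nondegenerate (h : IsHamiltonian Ω μ) (x : M) (u : Model)
    (hu : ∀ v, pairing (Ω.model x) u v = 0) : u = 0 :=
  h.symplectic.nondegenerate x u hu

theorem IsHamiltonian.isContinuousForm (h : IsHamiltonian Ω μ) : IsContinuousForm Ω.model :=
  fun x₀ => ((h.symplectic.smooth x₀).continuousOn.continuousAt
    ((isOpen_extChartAt_target x₀).mem_nhds (mem_extChartAt_target x₀)))

theorem IsHamiltonian.moment (h : IsHamiltonian Ω μ) (ξ : Fin 2 → ℝ) (x : M) (v : Model) :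
    tderiv Model (Fin 2 → ℝ) μ x v ⬝ᵥ ξ = pairing (Ω.model x) v (fundVec ξ x) :=
  h.moment_eq ξ x v

/-- The weights at a fixed point, and vectors spanning the weight planes. -/
theorem IsHamiltonianGKM.exists_planes (h : IsHamiltonianGKM Ω μ) {x : M}
    (hx : x ∈ MulAction.fixedPoints Torus M) :
    ∃ (α : Fin 3 → Fin 2 → ℝ) (a b : Fin 3 → Model),
      (∀ i, IsRotPlane (Ω.model x) (isoRep x) (α i) (a i) (b i)) ∧
      ∀ i j, i ≠ j → det2 (α i) (α j) ≠ 0 := by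
  obtain ⟨α, ⟨a, b, hab, -, -⟩, hind⟩ := h.independent x hx
  exact ⟨α, a, b, fun i => isWeightPlane_iff.1 (hab i),
    fun i j hij => det2_ne_zero_of_linearIndependent (hind i j hij)⟩

/-- The isotropy weights are integral. -/
theorem IsRotPlane.exists_int {x : M} {ω' : Model [⋀^Fin 2]→L[ℝ] ℝ} {α : Fin 2 → ℝ} {a b : Model}
    (h : IsRotPlane ω' (isoRep x) α a b) : ∃ k : Fin 2 → ℤ, α = fun i => (k i : ℝ) := by
  have h1 : ∀ i, ∃ k : ℤ, α i = k := by
    intro i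
    -- `exp (2π e)` is trivial for a basis vector `e` of the integral lattice, so it acts trivially,
    -- and the rotation angle `2π α i` is a full turn.
    set e : Fin 2 → ℤ := Pi.single i 1
    have h2 : isoRep x ((2 * Real.pi) • fun j => (e j : ℝ)) a = a := by
      simp only [isoRep, texp_two_pi_int, one_smul]
      rw [tderiv_id]
      rfl
    have h3 := h.cos_eq_one h2
    rw [dotProduct_smul, smul_eq_mul] at h3
    obtain ⟨k, hk⟩ := (Real.cos_eq_one_iff _).1 h3
    refine ⟨k, ?_⟩
    have h4 : (α ⬝ᵥ fun j => (e j : ℝ)) = α i := by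
      simp only [e, dotProduct, Pi.single_apply, Int.cast_ite, Int.cast_one, Int.cast_zero,
        mul_ite, mul_one, mul_zero, Finset.sum_ite_eq', Finset.mem_univ, if_true]
    rw [h4, mul_comm] at hk
    exact (mul_left_cancel₀ Real.two_pi_pos.ne' hk).symm
  choose k hk using h1
  exact ⟨k, funext hk⟩

end TorusActions

/-! ### Injectivity of the differential of an immersion -/

section Immersions

variable {E F : Type*} [NormedAddCommGroup E] [NormedSpace ℝ E] [NormedAddCommGroup F]
  [NormedSpace ℝ F] {M N : Type*} [TopologicalSpace M] [ChartedSpace E M]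
  [IsManifold 𝓘(ℝ, E) ∞ M] [TopologicalSpace N] [ChartedSpace F N] [IsManifold 𝓘(ℝ, F) ∞ N]

theorem mdifferentiable_of_mem_maximalAtlas {e : OpenPartialHomeomorph M E}
    (he : e ∈ IsManifold.maximalAtlas 𝓘(ℝ, E) ∞ M) : e.MDifferentiable 𝓘(ℝ, E) 𝓘(ℝ, E) :=
  ⟨fun _ hx => ((contMDiffAt_of_mem_maximalAtlas he hx).mdifferentiableAt
      (by simp)).mdifferentiableWithinAt,
    fun _ hx => ((contMDiffAt_symm_of_mem_maximalAtlas he hx).mdifferentiableAt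
      (by simp)).mdifferentiableWithinAt⟩

/-- In the normal form charts the immersion is the inclusion `u ↦ (u, 0)`, and charts have injective
differentials. -/
theorem tderiv_injective_of_isImmersion {φ : N → M}
    (h : Manifold.IsImmersion 𝓘(ℝ, F) 𝓘(ℝ, E) ∞ φ) (n : N) :
    Function.Injective (tderiv F E φ n) := by
  have hn := h.isImmersionAt n
  have hd := mdifferentiable_of_mem_maximalAtlas hn.domChart_mem_maximalAtlas
  have hc := mdifferentiable_of_mem_maximalAtlas hn.codChart_mem_maximalAtlas
  have heq : (hn.codChart ∘ φ) =ᶠ[𝓝 n] fun n' => hn.equiv (hn.domChart n', 0) := by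
    filter_upwards [hn.domChart.open_source.mem_nhds hn.mem_domChart_source] with n' hn'
    have hmem : hn.domChart n' ∈ (hn.domChart.extend 𝓘(ℝ, F)).target := by
      simpa using hn.domChart.map_source hn'
    have h1 := hn.writtenInCharts hmem
    simpa [hn.domChart.left_inv hn'] using h1
  have h1 := tderiv_comp (E := F) (F := E) (G := E) (g := hn.codChart) (f := φ) n
    (hc.mdifferentiableAt hn.mem_codChart_source) (h.contMDiff.mdifferentiable (by simp) n)
  let Λ : F →L[ℝ] E := (hn.equiv : (F × hn.complement) →L[ℝ] E).comp
    (ContinuousLinearMap.inl ℝ F hn.complement)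
  have h2 : tderiv F E (Λ ∘ hn.domChart) n = Λ.comp (tderiv F F hn.domChart n) := by
    have := tderiv_comp (E := F) (F := F) (G := E) (g := Λ) (f := hn.domChart) n
      Λ.differentiableAt.mdifferentiableAt
      (hd.mdifferentiableAt hn.mem_domChart_source)
    rw [this, tderiv_eq_fderiv, Λ.fderiv]
  have h3 : tderiv F E (hn.codChart ∘ φ) n = tderiv F E (Λ ∘ hn.domChart) n := tderiv_congr heq
  rw [h1, h2] at h3
  intro u v huv
  have h4 : Λ (tderiv F F hn.domChart n u) = Λ (tderiv F F hn.domChart n v) := by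
    have hu := DFunLike.congr_fun h3 u
    have hv := DFunLike.congr_fun h3 v
    simp only [ContinuousLinearMap.comp_apply] at hu hv
    rw [← hu, ← hv, huv]
  have h5 : tderiv F F hn.domChart n u = tderiv F F hn.domChart n v := by
    have := hn.equiv.injective h4
    exact congrArg Prod.fst this
  exact hd.mfderiv_injective hn.mem_domChart_source h5

end Immersions

/-! ### Invariant surfaces and their tangent planes at fixed points -/

section Surfaces

variable {M : Type*} [TopologicalSpace M] [ChartedSpace Model M] [MulAction Torus M]
  {N : Type*} [TopologicalSpace N] [ChartedSpace (EuclideanSpace ℝ (Fin 2)) N]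

/-- The model space of surfaces. -/
abbrev SurfaceModel : Type := EuclideanSpace ℝ (Fin 2)

/-- `φ` is an embedding of a surface whose image is invariant under the torus. -/
structure IsInvariantSurface (φ : N → M) : Prop where
  embedding : Manifold.IsSmoothEmbedding (𝓡 2) (𝓡 6) ∞ φ
  invariant : ∀ (t : Torus) n, t • φ n ∈ range φ

variable [T2Space M] [IsManifold (𝓡 6) ∞ M]
  [ContMDiffSMul ((𝓡 1).prod (𝓡 1)) (𝓡 6) ∞ Torus M] [IsManifold (𝓡 2) ∞ N]
  {φ : N → M} {Ω : TwoForm M} {μ : M → Fin 2 → ℝ}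

namespace IsInvariantSurface
variable (hφ : IsInvariantSurface φ)
include hφ

theorem contMDiff : ContMDiff (𝓡 2) (𝓡 6) ∞ φ := hφ.embedding.contMDiff

theorem mdifferentiableAt (n : N) : MDifferentiableAt (𝓡 2) (𝓡 6) φ n :=
  hφ.contMDiff.mdifferentiable (by simp) n

theorem tderiv_injective (n : N) : Function.Injective (tderiv SurfaceModel Model φ n) :=
  tderiv_injective_of_isImmersion hφ.embedding.isImmersion n

theorem finrank_range_tderiv (n : N) :
    Module.finrank ℝ (LinearMap.range (tderiv SurfaceModel Model φ n : SurfaceModel →ₗ[ℝ] Model))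
      = 2 := by
  rw [LinearMap.finrank_range_of_inj (hφ.tderiv_injective n)]
  simp

/-- The tangent plane at a fixed point is invariant. -/
theorem isoRep_mem_range {n : N} (hn : φ n ∈ MulAction.fixedPoints Torus M) (ζ : Fin 2 → ℝ)
    (u : SurfaceModel) : isoRep (φ n) ζ (tderiv SurfaceModel Model φ n u) ∈
      LinearMap.range (tderiv SurfaceModel Model φ n : SurfaceModel →ₗ[ℝ] Model) := by
  -- The map `g` is the action transported to the surface. It is smooth because `φ` is an embedding
  -- and an immersion, and it fixes `n`, so the chain rule for `φ ∘ g` shows that the tangent plane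
  -- is preserved.
  choose g hg using hφ.invariant (texp ζ)
  have hcomp : φ ∘ g = (fun y : M => texp ζ • y) ∘ φ := funext hg
  have hsm : ContMDiff (𝓡 2) (𝓡 6) ∞ (φ ∘ g) := by
    rw [hcomp]
    exact (contMDiff_smul_torus _).comp hφ.contMDiff
  have hgs : ContMDiff (𝓡 2) (𝓡 2) ∞ g :=
    (ContMDiff.iff_comp_isImmersion hφ.embedding.isImmersion).2
      ⟨hφ.embedding.isEmbedding.continuous_iff.2 hsm.continuous, hsm⟩
  have hgn : g n = n := hφ.embedding.isEmbedding.injective ((hg n).trans (hn _))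
  have h1 := tderiv_comp (E := SurfaceModel) (F := Model) (G := Model)
    (g := fun y : M => texp ζ • y) (f := φ) n
    (mdifferentiableAt_smul_torus _ _) (hφ.mdifferentiableAt n)
  have h2 := tderiv_comp (E := SurfaceModel) (F := SurfaceModel) (G := Model) (g := φ) (f := g) n
    (hφ.mdifferentiableAt _) (hgs.mdifferentiable (by simp) n)
  rw [hcomp, h1, hgn] at h2
  exact ⟨tderiv SurfaceModel SurfaceModel g n u, (DFunLike.congr_fun h2 u).symm⟩

/-- The tangent plane at a fixed point is one of the weight planes. -/
theorem exists_isRotPlane (hM : IsHamiltonianGKM Ω μ) {n : N}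
    (hn : φ n ∈ MulAction.fixedPoints Torus M) :
    ∃ α u v, IsRotPlane (Ω.model (φ n)) (isoRep (φ n)) α
      (tderiv SurfaceModel Model φ n u) (tderiv SurfaceModel Model φ n v) := by
  obtain ⟨α, a, b, hab, hs⟩ := hM.exists_planes hn
  obtain ⟨i, ⟨u, hu⟩, v, hv⟩ := exists_plane_le_of_invariant
    (fun ζ u v => hM.hamiltonian.pairing_inv (hn (texp ζ)) u v) (by simp) hab hs
    (W := LinearMap.range (tderiv SurfaceModel Model φ n : SurfaceModel →ₗ[ℝ] Model))
    (by
      rintro ζ _ ⟨u, rfl⟩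
      exact hφ.isoRep_mem_range hn ζ u)
    (fun h0 => by
      have := hφ.finrank_range_tderiv n
      rw [h0, finrank_bot] at this
      omega)
  refine ⟨α i, u, v, ?_⟩
  have := hab i
  rw [← hu, ← hv] at this
  exact this

variable {α : Fin 2 → ℝ} {n₀ : N} {u₀ v₀ : SurfaceModel}

theorem range_tderiv_eq_span (h : IsRotPlane (Ω.model (φ n₀)) (isoRep (φ n₀)) α
    (tderiv SurfaceModel Model φ n₀ u₀) (tderiv SurfaceModel Model φ n₀ v₀)) (u : SurfaceModel) :
    ∃ x y : ℝ, tderiv SurfaceModel Model φ n₀ u = x • tderiv SurfaceModel Model φ n₀ u₀ +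
      y • tderiv SurfaceModel Model φ n₀ v₀ := by
  have hli : LinearIndependent ℝ ![u₀, v₀] := by
    rw [LinearIndependent.pair_iff]
    intro s t hst
    have h1 : s • tderiv SurfaceModel Model φ n₀ u₀ + t • tderiv SurfaceModel Model φ n₀ v₀ = 0 := by
      rw [← map_smul, ← map_smul, ← map_add, hst, map_zero]
    have h2 : ∀ z w, (s * w - t * z) * pairing (Ω.model (φ n₀))
        (tderiv SurfaceModel Model φ n₀ u₀) (tderiv SurfaceModel Model φ n₀ v₀) = 0 := by
      intro z w
      rw [← pairing_combo, h1]
      simp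
    constructor
    · simpa [h.pos.ne'] using h2 0 1
    · simpa [h.pos.ne'] using h2 1 0
  have hsp := hli.span_eq_top_of_card_eq_finrank (by simp)
  have hu : u ∈ Submodule.span ℝ (range ![u₀, v₀]) := hsp ▸ Submodule.mem_top
  obtain ⟨g, hg⟩ := (Submodule.mem_span_range_iff_exists_fun ℝ).1 hu
  refine ⟨g 0, g 1, ?_⟩
  rw [← hg, Fin.sum_univ_two, map_add, map_smul, map_smul]
  rfl

/-- A circle subgroup on whose Lie algebra the weight of the surface vanishes fixes the surface,
and the tangent planes of the surface consist of the vectors fixed by this circle. -/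
theorem fixed_and_range_eq [PreconnectedSpace N] (hM : IsHamiltonianGKM Ω μ)
    (hn : φ n₀ ∈ MulAction.fixedPoints Torus M)
    (h : IsRotPlane (Ω.model (φ n₀)) (isoRep (φ n₀)) α
      (tderiv SurfaceModel Model φ n₀ u₀) (tderiv SurfaceModel Model φ n₀ v₀))
    {k : Fin 2 → ℤ} (hk0 : (fun i => (k i : ℝ)) ≠ 0) (hk : α ⬝ᵥ (fun i => (k i : ℝ)) = 0) :
    (∀ n, φ n ∈ flowFixed (torusFlow (M := M) fun i => (k i : ℝ))) ∧
    ∀ n, LinearMap.range (flowProj Model (torusFlow fun i => (k i : ℝ)) (φ n) :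
      Model →ₗ[ℝ] Model) =
        LinearMap.range (tderiv SurfaceModel Model φ n : SurfaceModel →ₗ[ℝ] Model) := by
  set η : Fin 2 → ℝ := fun i => (k i : ℝ)
  have hθ := isCircleFlow_torusFlow (M := M) k
  have hfix₀ := mem_flowFixed_of_mem_fixedPoints hn η
  have hinv := fun ζ u v => hM.hamiltonian.pairing_inv (hn (texp ζ)) u v
  have hfix : ∀ n, φ n ∈ flowFixed (torusFlow (M := M) η) := by
    refine hθ.forall_mem_flowFixed hφ.contMDiff hφ.embedding.isEmbedding hφ.tderiv_injective
      (fun s n => hφ.invariant _ n) hfix₀ fun s u => ?_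
    obtain ⟨x, y, hxy⟩ := hφ.range_tderiv_eq_span h u
    rw [hxy, tderiv_torusFlow, h.combo_zero (by rw [dotProduct_smul, hk, smul_zero])]
  refine ⟨hfix, fun n => ?_⟩
  obtain ⟨α₁, a₁, b₁, hab₁, hs₁⟩ := hM.exists_planes hn
  obtain ⟨α', a', b', hab, hs, h0, -, -⟩ := exists_completion hinv (by simp) hab₁ hs₁ h
  -- In the plane, two covectors vanishing on the same nonzero vector are parallel, which the
  -- pairwise independence of the completed weights excludes.
  have hne : ∀ i, 0 ≠ i → α' i ⬝ᵥ η ≠ 0 := by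
    intro i hi h1
    have h2 := hs 0 i hi
    rw [h0] at h2
    obtain ⟨ζ, hζ⟩ : ∃ ζ, ζ ≠ 0 ∧ η = rot ζ :=
      ⟨![η 1, -η 0], fun h3 => hk0 (by
        have h4 := congrFun h3 0
        have h5 := congrFun h3 1
        funext j
        fin_cases j
        · simpa using h5
        · simpa using h4), by
        funext j; fin_cases j <;> simp [rot]⟩
    rw [hζ.2, dot_rot] at h1 hk
    obtain ⟨c, hc⟩ := exists_eq_smul_of_det2_eq_zero hζ.1 h1
    obtain ⟨d, hd⟩ := exists_eq_smul_of_det2_eq_zero hζ.1 hk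
    refine h2 ?_
    rw [hc, hd]
    simp only [det2, Pi.smul_apply, smul_eq_mul]
    ring
  have hrank : Module.finrank ℝ (LinearMap.range (flowProj Model (torusFlow η) (φ n) :
      Model →ₗ[ℝ] Model)) = 2 := by
    rw [hθ.finrank_flowProj_eq hφ.contMDiff.continuous hfix n n₀]
    exact hθ.finrank_range_flowProj hfix₀ (by simp) (fun s => tderiv_torusFlow η s _) hinv hab hs
      (by rw [h0]; exact hk) (hne 1 (by decide)) (hne 2 (by decide))
  -- Tangent vectors are fixed vectors because the surface is fixed. Equality follows since the
  -- space of fixed vectors has dimension two at `n₀`, hence all along the surface.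
  refine (Submodule.eq_of_le_of_finrank_eq ?_ ?_).symm
  · rintro _ ⟨u, rfl⟩
    exact ⟨_, hθ.flowProj_eq_self (hfix n) fun s =>
      hθ.tderiv_apply_of_forall_mem_flowFixed hφ.contMDiff hfix n s u⟩
  · rw [hrank, hφ.finrank_range_tderiv]

end IsInvariantSurface

end Surfaces

/-! ### Fundamental vector fields and their zeros -/

section FundamentalFields

variable {M : Type*} [TopologicalSpace M] [ChartedSpace (EuclideanSpace ℝ (Fin 6)) M]
  [MulAction Torus M]

theorem mem_fixedPoints_of_mem_flowFixed {x : M} {α : Fin 2 → ℝ} (hα : α ≠ 0)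
    (h1 : x ∈ flowFixed (torusFlow (M := M) α)) (h2 : x ∈ flowFixed (torusFlow (M := M) (rot α))) :
    x ∈ MulAction.fixedPoints Torus M := by
  intro t
  obtain ⟨ζ, rfl⟩ := texp_surjective t
  have h3 := det2_rot_ne_zero hα
  -- Cramer's rule in the basis `α`, `rot α` of the plane.
  have h4 : ζ = (det2 ζ (rot α) / det2 α (rot α)) • α + (det2 α ζ / det2 α (rot α)) • rot α := by
    funext i
    simp only [Pi.add_apply, Pi.smul_apply, smul_eq_mul]
    field_simp
    fin_cases i <;> simp [det2, rot] <;> ring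
  rw [h4, texp_add, mul_smul]
  have h5 := h2 (det2 α ζ / det2 α (rot α))
  have h6 := h1 (det2 ζ (rot α) / det2 α (rot α))
  simp only [torusFlow] at h5 h6
  rw [h5, h6]

theorem fundVec_eq_zero_of_mem_flowFixed {x : M} {η : Fin 2 → ℝ}
    (hx : x ∈ flowFixed (torusFlow (M := M) η)) : fundVec η x = 0 := by
  have : (fun s : ℝ => texp (s • η) • x) = fun _ => x := funext hx
  rw [fundVec, this, tderiv_const]
  rfl

variable [IsManifold (𝓡 6) ∞ M] [ContMDiffSMul ((𝓡 1).prod (𝓡 1)) (𝓡 6) ∞ Torus M]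

theorem mdifferentiable_orbit (ζ : Fin 2 → ℝ) (x : M) :
    MDifferentiable 𝓘(ℝ, ℝ) (𝓡 6) (fun s : ℝ => texp (s • ζ) • x) := by
  have h : ContMDiff 𝓘(ℝ, ℝ) (𝓡 6) ∞ (fun s : ℝ => texp (s • ζ) • x) :=
    (contMDiff_texp_smul ζ).smul (I := (𝓡 1).prod (𝓡 1)) contMDiff_const
  exact h.mdifferentiable (by simp)

/-- The torus is commutative, so its fundamental vector fields are invariant. -/
theorem tderiv_smul_fundVec (t : Torus) (ζ : Fin 2 → ℝ) (x : M) :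
    tderiv Model Model (fun y : M => t • y) x (fundVec ζ x) = fundVec ζ (t • x) := by
  have h1 := tderiv_comp (E := ℝ) (F := Model) (G := Model) (g := fun y : M => t • y)
    (f := fun s : ℝ => texp (s • ζ) • x) 0 (mdifferentiableAt_smul_torus _ _)
    (mdifferentiable_orbit ζ x 0)
  have h2 : (fun y : M => t • y) ∘ (fun s : ℝ => texp (s • ζ) • x) =
      fun s : ℝ => texp (s • ζ) • (t • x) := by
    funext s
    simp only [Function.comp_apply, ← mul_smul, mul_comm]
  rw [h2] at h1
  simp only [zero_smul, texp_zero, one_smul] at h1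
  simp only [fundVec]
  rw [h1]
  rfl

/-- The velocity at time `s` is the velocity at time zero moved by the flow. If the latter vanishes,
the orbit is constant. -/
theorem tderiv_orbit (ζ : Fin 2 → ℝ) (x : M) (s : ℝ) :
    tderiv ℝ Model (fun s : ℝ => texp (s • ζ) • x) s 1 =
      tderiv Model Model (fun y : M => texp (s • ζ) • y) x (fundVec ζ x) := by
  have h1 := tderiv_comp (E := ℝ) (F := ℝ) (G := Model) (g := fun s : ℝ => texp (s • ζ) • x)
    (f := fun r : ℝ => s + r) 0 (mdifferentiable_orbit ζ x _)
    (by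
      rw [mdifferentiableAt_iff_differentiableAt]
      fun_prop)
  have h2 := tderiv_comp (E := ℝ) (F := Model) (G := Model) (g := fun y : M => texp (s • ζ) • y)
    (f := fun s : ℝ => texp (s • ζ) • x) 0 (mdifferentiableAt_smul_torus _ _)
    (mdifferentiable_orbit ζ x 0)
  have h3 : (fun s : ℝ => texp (s • ζ) • x) ∘ (fun r : ℝ => s + r) =
      (fun y : M => texp (s • ζ) • y) ∘ fun s : ℝ => texp (s • ζ) • x := by
    funext r
    simp only [Function.comp_apply, ← mul_smul, ← texp_add, add_smul]
  rw [h3, h2] at h1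
  simp only [zero_smul, texp_zero, one_smul, add_zero] at h1
  have h4 := DFunLike.congr_fun h1 1
  simp only [ContinuousLinearMap.comp_apply] at h4
  have h5 : tderiv ℝ ℝ (fun r : ℝ => s + r) 0 1 = 1 := by
    rw [tderiv_eq_fderiv]
    simp
  rw [h5] at h4
  exact h4.symm

/-- A zero of a fundamental vector field is a fixed point of its flow. -/
theorem mem_flowFixed_of_fundVec_eq_zero [T2Space M] {x : M} {ζ : Fin 2 → ℝ}
    (h : fundVec ζ x = 0) : x ∈ flowFixed (torusFlow (M := M) ζ) := by
  intro s
  have h1 := eq_of_tderiv_eq_zero (mdifferentiable_orbit ζ x) (fun s => by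
    ext
    rw [tderiv_orbit, h, map_zero]
    rfl) s 0
  simpa [torusFlow, texp_zero] using h1

end FundamentalFields

/-! ### The moment map along a submanifold -/

section SurfaceMoment

variable {M : Type*} [TopologicalSpace M] [ChartedSpace (EuclideanSpace ℝ (Fin 6)) M]
  [MulAction Torus M] {Ω : TwoForm M} {μ : M → Fin 2 → ℝ}

/-- The pairing with a vector of the Lie algebra, as a continuous linear form. -/
def dotCLM (ζ : Fin 2 → ℝ) : (Fin 2 → ℝ) →L[ℝ] ℝ := ∑ i, ζ i • ContinuousLinearMap.proj i

theorem dotCLM_apply (ζ α : Fin 2 → ℝ) : dotCLM ζ α = α ⬝ᵥ ζ := by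
  simp [dotCLM, dotProduct, mul_comm]

theorem IsHamiltonian.mdifferentiable_moment (h : IsHamiltonian Ω μ) :
    MDifferentiable (𝓡 6) 𝓘(ℝ, Fin 2 → ℝ) μ :=
  h.smooth_moment.mdifferentiable (by simp)

variable [IsManifold (𝓡 6) ∞ M] [ContMDiffSMul ((𝓡 1).prod (𝓡 1)) (𝓡 6) ∞ Torus M]
  {F N : Type*} [NormedAddCommGroup F] [NormedSpace ℝ F] [TopologicalSpace N]
  [ChartedSpace F N] {φ : N → M}

theorem IsHamiltonian.mdifferentiableAt_moment_comp (h : IsHamiltonian Ω μ) {n : N}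
    (hφ : MDifferentiableAt 𝓘(ℝ, F) (𝓡 6) φ n) (ζ : Fin 2 → ℝ) :
    MDifferentiableAt 𝓘(ℝ, F) 𝓘(ℝ, ℝ) (fun n => μ (φ n) ⬝ᵥ ζ) n := by
  have h1 : (fun n => μ (φ n) ⬝ᵥ ζ) = dotCLM ζ ∘ (μ ∘ φ) :=
    funext fun n => (dotCLM_apply ζ _).symm
  rw [h1]
  exact (dotCLM ζ).differentiableAt.mdifferentiableAt.comp n
    ((h.mdifferentiable_moment _).comp n hφ)

theorem IsHamiltonian.tderiv_moment_comp (h : IsHamiltonian Ω μ) {n : N}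
    (hφ : MDifferentiableAt 𝓘(ℝ, F) (𝓡 6) φ n) (ζ : Fin 2 → ℝ) (u : F) :
    tderiv F ℝ (fun n => μ (φ n) ⬝ᵥ ζ) n u =
      pairing (Ω.model (φ n)) (tderiv F Model φ n u) (fundVec ζ (φ n)) := by
  have h1 : (fun n => μ (φ n) ⬝ᵥ ζ) = dotCLM ζ ∘ (μ ∘ φ) :=
    funext fun n => (dotCLM_apply ζ _).symm
  rw [h1, tderiv_comp (F := Fin 2 → ℝ) n (dotCLM ζ).differentiableAt.mdifferentiableAt
    ((h.mdifferentiable_moment _).comp n hφ),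
    tderiv_comp (F := Model) n (h.mdifferentiable_moment _) hφ,
    tderiv_eq_fderiv, (dotCLM ζ).fderiv, ← h.moment, ← dotCLM_apply]
  rfl

variable [T2Space M] [IsManifold 𝓘(ℝ, F) ∞ N]

theorem IsHamiltonian.moment_eq_of_forall_mem_flowFixed [PreconnectedSpace N]
    (h : IsHamiltonian Ω μ) (hφ : MDifferentiable 𝓘(ℝ, F) (𝓡 6) φ) {η : Fin 2 → ℝ}
    (hfix : ∀ n, φ n ∈ flowFixed (torusFlow (M := M) η)) (n n' : N) :
    μ (φ n) ⬝ᵥ η = μ (φ n') ⬝ᵥ η :=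
  eq_of_tderiv_eq_zero (f := fun n => μ (φ n) ⬝ᵥ η)
    (fun n => h.mdifferentiableAt_moment_comp (hφ n) η) (fun n => by
      ext u
      rw [h.tderiv_moment_comp (hφ n), fundVec_eq_zero_of_mem_flowFixed (hfix n), map_zero]
      rfl) n n'

end SurfaceMoment

/-! ### The moment map on an invariant surface -/

section InvariantSurfaces

variable {M : Type*} [TopologicalSpace M] [ChartedSpace Model M] [MulAction Torus M]
  {N : Type*} [TopologicalSpace N] [ChartedSpace (EuclideanSpace ℝ (Fin 2)) N] [T2Space M]
  [IsManifold (𝓡 6) ∞ M] [ContMDiffSMul ((𝓡 1).prod (𝓡 1)) (𝓡 6) ∞ Torus M]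
  [IsManifold (𝓡 2) ∞ N] [PreconnectedSpace N]
  {φ : N → M} {Ω : TwoForm M} {μ : M → Fin 2 → ℝ}

/-- Weights are integral, and so are their rotations; hence `rot α`, which spans the kernel of a
nonzero weight `α`, generates a circle action. -/
theorem exists_int_rot {α : Fin 2 → ℝ} (h : ∃ k : Fin 2 → ℤ, α = fun i => (k i : ℝ)) :
    ∃ k : Fin 2 → ℤ, rot α = fun i => (k i : ℝ) := by
  obtain ⟨k, rfl⟩ := h
  refine ⟨![-k 1, k 0], funext fun i => ?_⟩
  fin_cases i <;> simp [rot]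

theorem dot_rot_self (α : Fin 2 → ℝ) : α ⬝ᵥ rot α = 0 := by
  rw [dot_rot, det2_self]

theorem IsHamiltonianGKM.ne_zero_of_isRotPlane (hM : IsHamiltonianGKM Ω μ) {x : M}
    (hx : x ∈ MulAction.fixedPoints Torus M) {α : Fin 2 → ℝ} {a b : Model}
    (h : IsRotPlane (Ω.model x) (isoRep x) α a b) : α ≠ 0 := by
  obtain ⟨α₁, a₁, b₁, hab₁, hs₁⟩ := hM.exists_planes hx
  obtain ⟨α', a', b', -, hs, h0, -, -⟩ := exists_completion
    (fun ζ u v => hM.hamiltonian.pairing_inv (hx (texp ζ)) u v) (by simp) hab₁ hs₁ h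
  rw [← h0]
  exact ne_zero_of_det2_ne_zero (hs 0 1 (by decide))

namespace IsInvariantSurface

variable (hφ : IsInvariantSurface φ) (hM : IsHamiltonianGKM Ω μ) {α : Fin 2 → ℝ} {n₀ : N}
  {u₀ v₀ : SurfaceModel} (hn : φ n₀ ∈ MulAction.fixedPoints Torus M)
  (h : IsRotPlane (Ω.model (φ n₀)) (isoRep (φ n₀)) α
      (tderiv SurfaceModel Model φ n₀ u₀) (tderiv SurfaceModel Model φ n₀ v₀))
include hφ hM hn h

theorem fixed_rot (n : N) : φ n ∈ flowFixed (torusFlow (M := M) (rot α)) := by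
  obtain ⟨k, hk⟩ := exists_int_rot h.exists_int
  have h0 := rot_ne_zero (hM.ne_zero_of_isRotPlane hn h)
  have h1 := dot_rot_self α
  rw [hk] at h0 h1 ⊢
  exact (hφ.fixed_and_range_eq hM hn h h0 h1).1 n

/-- The moment map sends the surface into a line in the direction of its weight. -/
theorem moment_rot (n n' : N) : μ (φ n) ⬝ᵥ rot α = μ (φ n') ⬝ᵥ rot α :=
  hM.hamiltonian.moment_eq_of_forall_mem_flowFixed hφ.mdifferentiableAt
    (hφ.fixed_rot hM hn h) n n'

/-- Along the surface, the critical points of the moment map are fixed points. -/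
theorem mem_fixedPoints_of_tderiv_eq_zero {n : N}
    (h0 : tderiv SurfaceModel ℝ (fun n => μ (φ n) ⬝ᵥ α) n = 0) :
    φ n ∈ MulAction.fixedPoints Torus M := by
  obtain ⟨k, hk⟩ := exists_int_rot h.exists_int
  have hα := hM.ne_zero_of_isRotPlane hn h
  have h1 := dot_rot_self α
  have h2 := rot_ne_zero hα
  have hfix := hφ.fixed_rot hM hn h n
  refine mem_fixedPoints_of_mem_flowFixed hα (mem_flowFixed_of_fundVec_eq_zero ?_) hfix
  rw [hk] at h1 h2 hfix
  have hrange := (hφ.fixed_and_range_eq hM hn h h2 h1).2 n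
  have hθ := isCircleFlow_torusFlow (M := M) k
  refine hM.hamiltonian.nondegenerate (φ n) _ fun v => ?_
  have hinv : ∀ s u v, pairing (Ω.model (φ n))
      (tderiv Model Model (torusFlow (fun i => (k i : ℝ)) s) (φ n) u)
      (tderiv Model Model (torusFlow (fun i => (k i : ℝ)) s) (φ n) v) =
      pairing (Ω.model (φ n)) u v := fun s u v => hM.hamiltonian.pairing_inv (hfix s) u v
  have hX : ∀ s, tderiv Model Model (torusFlow (fun i => (k i : ℝ)) s) (φ n) (fundVec α (φ n)) =
      fundVec α (φ n) := fun s =>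
    (tderiv_smul_fundVec _ α (φ n)).trans (by rw [show _ • φ n = φ n from hfix s])
  -- The field of `α` is fixed by the circle, so it pairs with `v` as with the average of `v`. That
  -- average is tangent to the surface, and there the pairing is a derivative of the moment map,
  -- which vanishes by assumption.
  rw [← hθ.pairing_flowProj hfix hinv hX v]
  obtain ⟨u, hu⟩ : flowProj Model (torusFlow fun i => (k i : ℝ)) (φ n) v ∈
      LinearMap.range (tderiv SurfaceModel Model φ n : SurfaceModel →ₗ[ℝ] Model) :=
    hrange ▸ LinearMap.mem_range_self _ v
  rw [← hu, pairing_swap, neg_eq_zero]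
  exact (hM.hamiltonian.tderiv_moment_comp (hφ.mdifferentiableAt n) α u).symm.trans
    (by rw [h0]; rfl)

end IsInvariantSurface

end InvariantSurfaces

/-! ### Linearization of a velocity field -/

section MixedPartials

variable {E : Type*} [NormedAddCommGroup E] [NormedSpace ℝ E]

/-- The velocity at time zero of a smooth family of maps has, as derivative at a point, the
time derivative of the derivative. -/
theorem hasFDerivAt_velocity {G : ℝ × E → E} {y : E} (hG : ContDiffAt ℝ ∞ G (0, y)) (a b : E)
    (hb : HasDerivAt (fun s : ℝ => fderiv ℝ (fun y => G (s, y)) y a) b 0) :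
    ∃ A : E →L[ℝ] E, HasFDerivAt (fun y => fderiv ℝ G (0, y) (1, 0)) A y ∧ A a = b := by
  have h2 : (2 : WithTop ℕ∞) ≤ ∞ := WithTop.coe_le_coe.2 (le_top (a := (2 : ℕ∞)))
  set B := fderiv ℝ (fderiv ℝ G) (0, y)
  have hd : HasFDerivAt (fderiv ℝ G) B (0, y) :=
    ((hG.fderiv_right (m := 1) (one_add_one_eq_two.trans_le h2)).differentiableAt (by simp)).hasFDerivAt
  have hsymm : IsSymmSndFDerivAt ℝ G (0, y) := by
    refine (hG.of_le (m := 2) h2).isSymmSndFDerivAt (by simp)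
  have h1 : HasFDerivAt (fun y => fderiv ℝ G (0, y)) (B.comp (ContinuousLinearMap.inr ℝ ℝ E)) y :=
    hd.comp y (hasFDerivAt_prodMk_right 0 y)
  refine ⟨((ContinuousLinearMap.apply ℝ E ((1, 0) : ℝ × E)).comp
    (B.comp (ContinuousLinearMap.inr ℝ ℝ E))),
    (ContinuousLinearMap.apply ℝ E ((1, 0) : ℝ × E)).hasFDerivAt.comp y h1, ?_⟩
  have h2 : HasFDerivAt (fun s => fderiv ℝ G (s, y)) (B.comp (ContinuousLinearMap.inl ℝ ℝ E)) 0 :=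
    hd.comp (0 : ℝ) (hasFDerivAt_prodMk_left 0 y)
  have h3 : HasDerivAt (fun s => fderiv ℝ G (s, y) (0, a)) (B (1, 0) (0, a)) 0 :=
    ((ContinuousLinearMap.apply ℝ E ((0, a) : ℝ × E)).hasFDerivAt.comp (0 : ℝ) h2).hasDerivAt
  have h4 : (fun s : ℝ => fderiv ℝ (fun y => G (s, y)) y a) =ᶠ[𝓝 0]
      fun s => fderiv ℝ G (s, y) (0, a) := by
    have h5 : ∀ᶠ p in 𝓝 ((0 : ℝ), y), DifferentiableAt ℝ G p :=
      ((hG.of_le (m := 1) (by simp)).eventually (by simp)).mono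
        fun p hp => hp.differentiableAt (by simp)
    have h6 : ContinuousAt (fun s : ℝ => (s, y)) 0 := by fun_prop
    filter_upwards [h6.eventually h5] with s hs
    have h7 : HasFDerivAt (fun y => G (s, y))
        ((fderiv ℝ G (s, y)).comp (ContinuousLinearMap.inr ℝ ℝ E)) y :=
      hs.hasFDerivAt.comp y (hasFDerivAt_prodMk_right s y)
    rw [h7.fderiv]
    rfl
  have h8 := (h3.congr_of_eventuallyEq h4).unique hb
  -- What remains is the symmetry of the second derivative, exchanging the time direction and `a`.
  rw [← h8]
  exact hsymm _ _

theorem tendsto_alternating {ι : Type*} {l : Filter ι} {A : ι → E [⋀^Fin 2]→L[ℝ] ℝ} {u v : ι → E}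
    {A₀ : E [⋀^Fin 2]→L[ℝ] ℝ} {u₀ v₀ : E} (hA : Tendsto A l (𝓝 A₀)) (hu : Tendsto u l (𝓝 u₀))
    (hv : Tendsto v l (𝓝 v₀)) : Tendsto (fun i => A i ![u i, v i]) l (𝓝 (A₀ ![u₀, v₀])) := by
  have h : Continuous fun p : (E [⋀^Fin 2]→L[ℝ] ℝ) × (Fin 2 → E) => p.1 p.2 := by fun_prop
  refine (h.tendsto (A₀, ![u₀, v₀])).comp (hA.prodMk_nhds ?_)
  rw [tendsto_pi_nhds]
  intro i
  fin_cases i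
  · exact hu
  · exact hv

end MixedPartials

/-! ### Growth of the moment map from a fixed point -/

section LocalBehaviour

variable {M : Type*} [TopologicalSpace M] [ChartedSpace (EuclideanSpace ℝ (Fin 6)) M]
  [IsManifold (𝓡 6) ∞ M] {Ω : TwoForm M} {μ : M → Fin 2 → ℝ}

theorem pairing_eq_inChart (Ω : TwoForm M) {x z : M} (hz : z ∈ (extChartAt (𝓡 6) x).source)
    (u v : Model) : pairing (Ω.model z) u v =
      (Ω.model ((extChartAt (𝓡 6) x).symm (extChartAt (𝓡 6) x z))).compContinuousLinearMap
        (tderiv Model Model (extChartAt (𝓡 6) x).symm (extChartAt (𝓡 6) x z))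
        ![tderiv Model Model (extChartAt (𝓡 6) x) z u,
          tderiv Model Model (extChartAt (𝓡 6) x) z v] := by
  have h1 := tderiv_symm_comp_chart (E := Model) hz
  have h2 := fun u => DFunLike.congr_fun h1 u
  simp only [ContinuousLinearMap.comp_apply, ContinuousLinearMap.id_apply] at h2
  rw [(extChartAt (𝓡 6) x).left_inv hz, pairing_apply,
    ContinuousAlternatingMap.compContinuousLinearMap_apply]
  congr 1
  funext i
  fin_cases i
  · exact (h2 u).symm
  · exact (h2 v).symm

variable [MulAction Torus M] [ContMDiffSMul ((𝓡 1).prod (𝓡 1)) (𝓡 6) ∞ Torus M]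

/-- The fundamental vector field in a chart. -/
theorem fderiv_flowInChart_time {x z : M} (hz : z ∈ (extChartAt (𝓡 6) x).source) {α : Fin 2 → ℝ}
    (hd : DifferentiableAt ℝ (fun p : ℝ × Model => flowInChart Model (torusFlow α) x p.1 p.2)
      (0, extChartAt (𝓡 6) x z)) :
    fderiv ℝ (fun p : ℝ × Model => flowInChart Model (torusFlow α) x p.1 p.2)
      (0, extChartAt (𝓡 6) x z) (1, 0) =
      tderiv Model Model (extChartAt (𝓡 6) x) z (fundVec α z) := by
  have h1 := HasFDerivAt.comp (f := fun s : ℝ => (s, extChartAt (𝓡 6) x z)) (0 : ℝ)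
    hd.hasFDerivAt (hasFDerivAt_prodMk_left (0 : ℝ) (extChartAt (𝓡 6) x z))
  have h2 := tderiv_comp (E := ℝ) (F := Model) (G := Model) (g := extChartAt (𝓡 6) x)
    (f := fun s : ℝ => texp (s • α) • z) 0
    (mdifferentiableAt_chart (by simpa [texp_zero] using hz)) (mdifferentiable_orbit α z 0)
  have h3 : (fun p : ℝ × Model => flowInChart Model (torusFlow α) x p.1 p.2) ∘
      (fun s : ℝ => (s, extChartAt (𝓡 6) x z)) =
      extChartAt (𝓡 6) x ∘ fun s : ℝ => texp (s • α) • z := by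
    funext s
    simp only [Function.comp_apply, flowInChart, torusFlow, (extChartAt (𝓡 6) x).left_inv hz]
  rw [h3] at h1
  rw [tderiv_eq_fderiv, h1.fderiv] at h2
  simp only [zero_smul, texp_zero, one_smul] at h2
  exact DFunLike.congr_fun h2 1

variable {F N : Type*} [NormedAddCommGroup F] [NormedSpace ℝ F] [TopologicalSpace N]
  [ChartedSpace F N] [IsManifold 𝓘(ℝ, F) ∞ N] {φ : N → M}

/-- The moment map increases from a fixed point in the directions of a weight plane. -/
theorem IsHamiltonian.frequently_moment_lt (hM : IsHamiltonian Ω μ)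
    (hφ : ContMDiff 𝓘(ℝ, F) (𝓡 6) ∞ φ) {n₀ : N} (hn : φ n₀ ∈ MulAction.fixedPoints Torus M)
    {α : Fin 2 → ℝ} (hα : α ≠ 0) {u₀ : F} {b : Model}
    (h : IsRotPlane (Ω.model (φ n₀)) (isoRep (φ n₀)) α (tderiv F Model φ n₀ u₀) b) :
    ∃ᶠ n in 𝓝 n₀, μ (φ n₀) ⬝ᵥ α < μ (φ n) ⬝ᵥ α := by
  set c := extChartAt (𝓡 6) (φ n₀) with hc
  set e := extChartAt 𝓘(ℝ, F) n₀ with he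
  set a := tderiv F Model φ n₀ u₀ with ha
  have hθ : IsCircleFlow (E := Model) (torusFlow (M := M) α) := by
    obtain ⟨k, rfl⟩ := h.exists_int
    exact isCircleFlow_torusFlow k
  have hx := mem_flowFixed_of_mem_fixedPoints hn α
  have hαα : 0 < α ⬝ᵥ α := by
    refine lt_of_le_of_ne ?_ fun h0 => hα (dotProduct_self_eq_zero.1 h0.symm)
    exact Finset.sum_nonneg fun i _ => mul_self_nonneg _
  set G : ℝ × Model → Model := fun p => flowInChart Model (torusFlow α) (φ n₀) p.1 p.2
  have hG : ContDiffAt ℝ ∞ G (0, c (φ n₀)) := hθ.contDiffAt_flowInChart hx 0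
  -- the velocity field in the chart
  obtain ⟨A, hA, hAa⟩ := hasFDerivAt_velocity hG a ((α ⬝ᵥ α) • b) (by
    have h1 : (fun s : ℝ => fderiv ℝ (fun y => G (s, y)) (c (φ n₀)) a) =
        fun s => Real.cos (s * (α ⬝ᵥ α)) • a + Real.sin (s * (α ⬝ᵥ α)) • b := by
      funext s
      have h2 := hθ.fderiv_flowInChart_self hx s
      have h3 := h.left (s • α)
      rw [dotProduct_smul, smul_eq_mul] at h3
      rw [← h3]
      exact DFunLike.congr_fun h2 a
    rw [h1]
    have h4 : HasDerivAt (fun s : ℝ => s * (α ⬝ᵥ α)) (α ⬝ᵥ α) 0 := hasDerivAt_mul_const _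
    have h5 := (h4.cos.smul_const a).add (h4.sin.smul_const b)
    refine h5.congr_deriv ?_
    simp)
  -- `X` is the fundamental field of `α` in the chart, and `g` a curve leaving `n₀` in the direction
  -- `u₀`. Along it, `X` is `r |α|² b + o(r)`, so the derivative of `⟨μ, α⟩` divided by `r` tends to
  -- `|α|² Ω(a, b) > 0`.
  set X : Model → Model := fun y => fderiv ℝ G (0, y) (1, 0)
  set g : ℝ → N := fun r => e.symm (e n₀ + r • u₀)
  set Φ : ℝ → M := fun r => φ (g r)
  set ψ : ℝ → Model := fun r => c (Φ r)
  have hl0 : e n₀ + (0 : ℝ) • u₀ = e n₀ := by rw [zero_smul, add_zero]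
  have hline : ContDiff ℝ ∞ fun r : ℝ => e n₀ + r • u₀ := by fun_prop
  have hg0 : g 0 = n₀ := by
    simp only [g, zero_smul, add_zero]
    exact extChartAt_to_inv n₀
  have hψs : ContDiffAt ℝ ∞ ψ 0 := by
    have h1 := contDiffAt_in_charts hφ n₀
    refine ContDiffAt.comp (g := fun u => c (φ (e.symm u))) 0 ?_ hline.contDiffAt
    rw [hl0]
    exact h1
  have hψ0 : HasDerivAt ψ a 0 := by
    have h1 := (hasStrictFDerivAt_in_charts hφ n₀).hasFDerivAt
    have h2 : HasDerivAt (fun r : ℝ => e n₀ + r • u₀) u₀ 0 := by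
      simpa using ((hasDerivAt_id (0 : ℝ)).smul_const u₀).const_add (e n₀)
    refine HasFDerivAt.comp_hasDerivAt (f := fun r : ℝ => e n₀ + r • u₀)
      (l := fun u => c (φ (e.symm u))) 0 ?_ h2
    rw [hl0]
    exact h1
  have hψc : Tendsto (deriv ψ) (𝓝 0) (𝓝 a) := by
    have h1 : ContinuousAt (fderiv ℝ ψ) 0 :=
      (hψs.fderiv_right (m := 0) (by simp)).continuousAt
    have h2 : ContinuousAt (deriv ψ) 0 := by
      have := (ContinuousLinearMap.apply ℝ Model (1 : ℝ)).continuous.continuousAt.comp h1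
      exact this
    rw [← hψ0.deriv]
    exact h2
  have hψ0' : ψ 0 = c (φ n₀) := by simp only [ψ, Φ, hg0]
  -- conditions which hold near zero
  have hgt : ContinuousAt g 0 := by
    refine ContinuousAt.comp (g := e.symm) ?_ hline.continuous.continuousAt
    rw [hl0]
    exact continuousAt_extChartAt_symm n₀
  have hE1 : ∀ᶠ r in 𝓝 (0 : ℝ), Φ r ∈ c.source := by
    have h1 : ContinuousAt Φ 0 := hφ.continuous.continuousAt.comp hgt
    refine h1 ?_
    simp only [Φ, hg0]
    exact extChartAt_source_mem_nhds _
  have hE2 : ∀ᶠ r in 𝓝 (0 : ℝ), e n₀ + r • u₀ ∈ e.target := by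
    refine hline.continuous.continuousAt ?_
    rw [hl0]
    exact extChartAt_target_mem_nhds n₀
  have hE3 : ∀ᶠ r in 𝓝 (0 : ℝ), DifferentiableAt ℝ G (0, ψ r) := by
    have h5 : ∀ᶠ p in 𝓝 ((0 : ℝ), c (φ n₀)), DifferentiableAt ℝ G p :=
      ((hG.of_le (m := 1) (by simp)).eventually (by simp)).mono
        fun p hp => hp.differentiableAt (by simp)
    have h6 : ContinuousAt (fun r : ℝ => ((0 : ℝ), ψ r)) 0 :=
      continuousAt_const.prodMk hψs.continuousAt
    rw [← hψ0'] at h5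
    exact h6.eventually h5
  have hΦ : ∀ r, e n₀ + r • u₀ ∈ e.target → MDifferentiableAt 𝓘(ℝ, ℝ) (𝓡 6) Φ r := by
    intro r hr
    refine (hφ.mdifferentiable (by simp) _).comp r ?_
    exact (mdifferentiableAt_chart_symm hr).comp r
      (hline.differentiable (by simp) r).mdifferentiableAt
  set k : ℝ → ℝ := fun r => μ (Φ r) ⬝ᵥ α
  have hkd : ∀ r, e n₀ + r • u₀ ∈ e.target → DifferentiableAt ℝ k r := fun r hr =>
    mdifferentiableAt_iff_differentiableAt.1 (hM.mdifferentiableAt_moment_comp (hΦ r hr) α)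
  set W : Model → Model [⋀^Fin 2]→L[ℝ] ℝ := fun y =>
    (Ω.model (c.symm y)).compContinuousLinearMap (tderiv Model Model c.symm y)
  have hX0 : X (ψ 0) = 0 := by
    have h1 := fderiv_flowInChart_time (α := α) (mem_extChartAt_source (I := 𝓡 6) (φ n₀))
      (hG.differentiableAt (by simp))
    rw [fundVec_eq_zero_of_mem_flowFixed hx, map_zero] at h1
    rw [hψ0']
    exact h1
  have hk' : ∀ᶠ r in 𝓝 (0 : ℝ), deriv k r = W (ψ r) ![deriv ψ r, X (ψ r)] := by
    filter_upwards [hE1, hE2, hE3] with r h1 h2 h3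
    have h4 := hM.tderiv_moment_comp (hΦ r h2) α (1 : ℝ)
    rw [tderiv_eq_fderiv, pairing_eq_inChart Ω h1, ← fderiv_flowInChart_time h1 h3] at h4
    have h5 := tderiv_comp (E := ℝ) (F := Model) (G := Model) (g := c) (f := Φ) r
      (mdifferentiableAt_chart h1) (hΦ r h2)
    rw [tderiv_eq_fderiv] at h5
    have h6 : deriv ψ r = tderiv Model Model c (Φ r) (tderiv ℝ Model Φ r 1) :=
      DFunLike.congr_fun h5 1
    rw [h6]
    exact h4
  have hXs : Tendsto (fun r : ℝ => r⁻¹ • X (ψ r)) (𝓝[>] 0) (𝓝 ((α ⬝ᵥ α) • b)) := by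
    have h1 : HasDerivAt (fun r => X (ψ r)) (A a) 0 := by
      refine HasFDerivAt.comp_hasDerivAt (l := X) 0 ?_ hψ0
      rw [hψ0']
      exact hA
    rw [hAa] at h1
    have h2 := h1.tendsto_slope_zero_right
    simpa only [zero_add, hX0, sub_zero] using h2
  have hlim : Tendsto (fun r : ℝ => W (ψ r) ![deriv ψ r, r⁻¹ • X (ψ r)]) (𝓝[>] 0)
      (𝓝 (W (c (φ n₀)) ![a, (α ⬝ᵥ α) • b])) := by
    refine tendsto_alternating ?_ (hψc.mono_left nhdsWithin_le_nhds) hXs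
    have h1 : ContinuousAt W (c (φ n₀)) := hM.isContinuousForm (φ n₀)
    refine (h1.tendsto.comp ?_)
    rw [← hψ0']
    exact hψs.continuousAt.tendsto.mono_left nhdsWithin_le_nhds
  have hpos : 0 < W (c (φ n₀)) ![a, (α ⬝ᵥ α) • b] := by
    have h1 := pairing_eq_inChart Ω (mem_extChartAt_source (I := 𝓡 6) (φ n₀)) a ((α ⬝ᵥ α) • b)
    have h2 := tderiv_chart_self (E := Model) (φ n₀)
    rw [h2] at h1
    have h3 : W (c (φ n₀)) ![a, (α ⬝ᵥ α) • b] = pairing (Ω.model (φ n₀)) a ((α ⬝ᵥ α) • b) :=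
      h1.symm
    rw [h3, map_smul, smul_eq_mul]
    exact mul_pos hαα h.pos
  have hev : ∀ᶠ r in 𝓝[>] (0 : ℝ), 0 < deriv k r := by
    filter_upwards [hlim.eventually_const_lt hpos, hk'.filter_mono nhdsWithin_le_nhds,
      self_mem_nhdsWithin] with r h1 h2 h3
    have h4 : W (ψ r) ![deriv ψ r, r⁻¹ • X (ψ r)] = r⁻¹ * W (ψ r) ![deriv ψ r, X (ψ r)] :=
      map_smul (pairing (W (ψ r)) (deriv ψ r)) r⁻¹ (X (ψ r))
    rw [h4] at h1
    rw [h2]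
    exact (pos_iff_pos_of_mul_pos h1).1 (inv_pos.2 h3)
  have hlt : ∀ᶠ r in 𝓝[>] (0 : ℝ), k 0 < k r := by
    obtain ⟨δ, hδ, hδ'⟩ := mem_nhdsGT_iff_exists_Ioo_subset.1
      (hev.and (hE2.filter_mono nhdsWithin_le_nhds))
    filter_upwards [Ioo_mem_nhdsGT hδ] with r hr
    have hmono : StrictMonoOn k (Icc 0 r) := by
      refine strictMonoOn_of_deriv_pos (convex_Icc 0 r) ?_ ?_
      · intro s hs
        refine (hkd s ?_).continuousAt.continuousWithinAt
        rcases hs.1.eq_or_lt with h0 | h0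
        · rw [← h0, hl0]
          exact mem_extChartAt_target n₀
        · exact (hδ' ⟨h0, hs.2.trans_lt hr.2⟩).2
      · intro s hs
        rw [interior_Icc] at hs
        exact (hδ' ⟨hs.1, hs.2.trans hr.2⟩).1
    exact hmono ⟨le_rfl, hr.1.le⟩ ⟨hr.1.le, le_rfl⟩ hr.1
  have hgt' : Tendsto g (𝓝[>] 0) (𝓝 n₀) := by
    have := hgt.tendsto.mono_left (nhdsWithin_le_nhds (s := Ioi 0))
    rwa [hg0] at this
  refine hgt'.frequently (hlt.frequently.mono fun r hr => ?_)
  simp only [k, Φ, hg0] at hr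
  exact hr

end LocalBehaviour

/-! ### Critical points at maxima -/

section CriticalPoints

variable {F N : Type*} [NormedAddCommGroup F] [NormedSpace ℝ F] [TopologicalSpace N]
  [ChartedSpace F N] [IsManifold 𝓘(ℝ, F) ∞ N]

theorem tderiv_eq_zero_of_isMaxOn {f : N → ℝ} {n : N} (hf : MDifferentiableAt 𝓘(ℝ, F) 𝓘(ℝ, ℝ) f n)
    (h : ∀ n', f n' ≤ f n) : tderiv F ℝ f n = 0 := by
  have h1 := fderiv_in_charts_self hf
  rw [← h1]
  refine IsLocalMax.fderiv_eq_zero (Eventually.of_forall fun u => ?_)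
  have h2 : (extChartAt 𝓘(ℝ, F) n).symm (extChartAt 𝓘(ℝ, F) n n) = n := extChartAt_to_inv n
  beta_reduce
  rw [h2]
  exact h _

end CriticalPoints

/-! ### Edges of the GKM graph and their weights -/

section Edges

/-- The two-sphere. -/
abbrev Sphere2 : Type := Metric.sphere (0 : EuclideanSpace ℝ (Fin 3)) 1

instance : PreconnectedSpace Sphere2 :=
  Subtype.preconnectedSpace (isPreconnected_sphere (by
    rw [← Module.finrank_eq_rank]
    simp) _ _)

variable {M : Type*} [TopologicalSpace M] [T2Space M] [ChartedSpace (EuclideanSpace ℝ (Fin 6)) M]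
  [IsManifold (𝓡 6) ∞ M] [MulAction Torus M] [ContMDiffSMul ((𝓡 1).prod (𝓡 1)) (𝓡 6) ∞ Torus M]
  {Ω : TwoForm M} {μ : M → Fin 2 → ℝ} {v w w' : MulAction.fixedPoints Torus M} {α α' : Fin 2 → ℝ}

theorem IsEdgeSphere.isInvariantSurface {φ : Sphere2 → M} (h : IsEdgeSphere φ v w) :
    IsInvariantSurface φ :=
  ⟨h.embedding, fun t n => h.invariant t _ (mem_range_self n)⟩

theorem isEdgeWeight_iff : IsEdgeWeight Ω v w α ↔ v ≠ w ∧ ∃ φ, IsEdgeSphere φ v w ∧ ∃ s, φ s = v ∧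
    ∃ a b, IsRotPlane (Ω.model (φ s)) (isoRep (φ s)) α (tderiv SurfaceModel Model φ s a)
      (tderiv SurfaceModel Model φ s b) := by
  unfold IsEdgeWeight
  refine and_congr_right fun _ => exists_congr fun φ => and_congr_right fun _ =>
    exists_congr fun s => and_congr_right fun _ => exists_congr fun a => exists_congr fun b => ?_
  exact isWeightPlane_iff

variable (hM : IsHamiltonianGKM Ω μ)
include hM

/-- The default value of `edgeWeight` never occurs on an edge, because the tangent plane of an
invariant sphere at a fixed point is a weight plane. -/
theorem isEdgeWeight_edgeWeight (h : (gkmGraph M).Adj v w) :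
    IsEdgeWeight Ω v w (edgeWeight Ω v w) := by
  obtain ⟨hne, φ, hφ⟩ := h
  have h1 : (v : M) ∈ range φ := (hφ.fixed.ge (mem_insert _ _)).1
  obtain ⟨s, hs⟩ := h1
  obtain ⟨α, a, b, hab⟩ := hφ.isInvariantSurface.exists_isRotPlane hM (n := s) (hs ▸ v.2)
  have h2 : ∃ α, IsEdgeWeight Ω v w α := ⟨α, isEdgeWeight_iff.2 ⟨hne, φ, hφ, s, hs, a, b, hab⟩⟩
  rw [edgeWeight, dif_pos h2]
  exact h2.choose_spec

theorem exists_isRotPlane_edgeWeight (h : (gkmGraph M).Adj v w) :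
    ∃ a b, IsRotPlane (Ω.model v) (isoRep (v : M)) (edgeWeight Ω v w) a b := by
  obtain ⟨-, φ, -, s, hs, a, b, hab⟩ := isEdgeWeight_iff.1 (isEdgeWeight_edgeWeight hM h)
  rw [hs] at hab
  exact ⟨_, _, hab⟩

theorem edgeWeight_ne_zero (h : (gkmGraph M).Adj v w) : edgeWeight Ω v w ≠ 0 := by
  obtain ⟨a, b, hab⟩ := exists_isRotPlane_edgeWeight hM h
  exact hM.ne_zero_of_isRotPlane v.2 hab

/-- The moment map sends an edge to a segment in the direction of its weight. -/
theorem exists_moment_sub_eq_smul (h : (gkmGraph M).Adj v w) :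
    ∃ k : ℝ, 0 < k ∧ μ w - μ v = k • edgeWeight Ω v w := by
  set α := edgeWeight Ω v w
  obtain ⟨hne, φ, hφ, s, hs, a, b, hab⟩ := isEdgeWeight_iff.1 (isEdgeWeight_edgeWeight hM h)
  have hsurf := hφ.isInvariantSurface
  have hfs : φ s ∈ MulAction.fixedPoints Torus M := hs ▸ v.2
  have hα : α ≠ 0 := edgeWeight_ne_zero hM h
  have hd : ∀ n, MDifferentiableAt (𝓡 2) 𝓘(ℝ, ℝ) (fun n => μ (φ n) ⬝ᵥ α) n := fun n =>
    hM.hamiltonian.mdifferentiableAt_moment_comp (hsurf.mdifferentiableAt n) α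
  have hcont : Continuous fun n => μ (φ n) ⬝ᵥ α :=
    continuous_iff_continuousAt.2 fun n => (hd n).continuousAt
  -- A maximum of `⟨μ, α⟩` on the sphere is a critical point, hence a fixed point. The function
  -- grows from `v`, so the maximum is not attained at `v` and must be at `w`; this gives the sign
  -- of `k`.
  obtain ⟨m, -, hm⟩ := isCompact_univ.exists_isMaxOn ⟨s, mem_univ s⟩ hcont.continuousOn
  have hm' : ∀ n, μ (φ n) ⬝ᵥ α ≤ μ (φ m) ⬝ᵥ α := fun n => hm (mem_univ n)
  obtain ⟨n, hn⟩ := (hM.hamiltonian.frequently_moment_lt hsurf.contMDiff hfs hα hab).exists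
  have hlt : μ (φ s) ⬝ᵥ α < μ (φ m) ⬝ᵥ α := hn.trans_le (hm' n)
  have hmf := hsurf.mem_fixedPoints_of_tderiv_eq_zero hM hfs hab
    (tderiv_eq_zero_of_isMaxOn (hd m) hm')
  have hmw : φ m = w := by
    have h1 : φ m ∈ ({(v : M), (w : M)} : Set M) := hφ.fixed ▸ ⟨mem_range_self m, hmf⟩
    rcases h1 with h1 | h1
    · rw [h1, hs] at hlt
      exact absurd hlt (lt_irrefl _)
    · exact h1
  have hrot := hsurf.moment_rot hM hfs hab m s
  rw [hmw, hs] at hlt hrot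
  have hdet : det2 α (μ w - μ v) = 0 := by
    rw [← dot_rot, sub_dotProduct, hrot, sub_self]
  obtain ⟨k, hk⟩ := exists_eq_smul_of_det2_eq_zero hα hdet
  refine ⟨k, ?_, hk⟩
  have h1 : 0 < (μ w - μ v) ⬝ᵥ α := by
    rw [sub_dotProduct]
    linarith
  rw [hk, smul_dotProduct, smul_eq_mul] at h1
  exact pos_of_mul_pos_left h1 (Finset.sum_nonneg fun i _ => mul_self_nonneg _)

/-- Different edges at a vertex have independent weights. -/
theorem det2_edgeWeight_ne_zero (h : (gkmGraph M).Adj v w) (h' : (gkmGraph M).Adj v w')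
    (hww : w ≠ w') : det2 (edgeWeight Ω v w) (edgeWeight Ω v w') ≠ 0 := by
  intro hdet
  set α := edgeWeight Ω v w
  set α' := edgeWeight Ω v w'
  have hα : α ≠ 0 := edgeWeight_ne_zero hM h
  obtain ⟨-, φ, hφ, s, hs, a, b, hab⟩ := isEdgeWeight_iff.1 (isEdgeWeight_edgeWeight hM h)
  obtain ⟨hne, φ', hφ', s', hs', a', b', hab'⟩ :=
    isEdgeWeight_iff.1 (isEdgeWeight_edgeWeight hM h')
  have hfs : φ s ∈ MulAction.fixedPoints Torus M := hs ▸ v.2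
  have hfs' : φ' s' ∈ MulAction.fixedPoints Torus M := hs' ▸ v.2
  -- If the weights were parallel, one circle would fix both spheres. The first sphere is tangent to
  -- all fixed vectors of this circle and meets the second one in `v`, so it contains it; then `w'`
  -- would be one of the two fixed points `v`, `w`.
  obtain ⟨k, hk⟩ := exists_int_rot hab.exists_int
  have h0 := rot_ne_zero hα
  have h1 := dot_rot_self α
  have h2 : α' ⬝ᵥ rot α = 0 := by rw [dot_rot, hdet]
  change rot α = _ at hk
  rw [hk] at h0 h1 h2
  obtain ⟨hfix, hrange⟩ := hφ.isInvariantSurface.fixed_and_range_eq hM hfs hab h0 h1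
  obtain ⟨hfix', -⟩ := hφ'.isInvariantSurface.fixed_and_range_eq hM hfs' hab' h0 h2
  have hsub := (isCircleFlow_torusFlow (M := M) k).range_subset_range
    hφ'.isInvariantSurface.contMDiff.continuous hfix' hφ.isInvariantSurface.contMDiff hfix
    (fun n => (hrange n).le) (n' := s') ⟨s, hs.trans hs'.symm⟩
  have h3 : (w' : M) ∈ ({(v : M), (w : M)} : Set M) := by
    have h4 := hφ'.fixed.ge (mem_insert_of_mem _ rfl : (w' : M) ∈ ({(v : M), (w' : M)} : Set M))
    rw [← hφ.fixed]
    exact ⟨hsub h4.1, h4.2⟩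
  rcases h3 with h3 | h3
  · exact hne (Subtype.ext h3).symm
  · exact hww (Subtype.ext h3).symm

/-- A vertex has at most three neighbours. -/
theorem not_four_neighbours {w : Fin 4 → MulAction.fixedPoints Torus M}
    (hw : Function.Injective w) (h : ∀ i, (gkmGraph M).Adj v (w i)) : False := by
  choose a b hab using fun i => exists_isRotPlane_edgeWeight hM (h i)
  exact not_four_planes (fun ζ u u' => hM.hamiltonian.pairing_inv (v.2 (texp ζ)) u u') (by simp)
    hab fun i j hij => separated_of_det2 (det2_edgeWeight_ne_zero hM (h i) (h j) (hw.ne hij.ne))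

/-- Three edges have independent weights and so exhaust the tangent space; the signs of the circle's
weights can be read off the graph. -/
theorem isSawNonneg_iff_of_neighbours {w : Fin 3 → MulAction.fixedPoints Torus M}
    (hw : Function.Injective w) (h : ∀ i, (gkmGraph M).Adj v (w i)) (k : Fin 2 → ℤ) :
    IsSawNonneg (torusFlow fun i => (k i : ℝ)) Ω.model (v : M) ↔
      ∀ i, 0 ≤ edgeWeight Ω v (w i) ⬝ᵥ fun i => (k i : ℝ) := by
  choose a b hab using fun i => exists_isRotPlane_edgeWeight hM (h i)
  exact (isCircleFlow_torusFlow (M := M) k).sawNonneg_iff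
    (mem_flowFixed_of_mem_fixedPoints v.2 _) (by simp) (fun s => tderiv_torusFlow _ s _)
    (fun ζ u u' => hM.hamiltonian.pairing_inv (v.2 (texp ζ)) u u') hab
    fun i j hij => det2_edgeWeight_ne_zero hM (h i) (h j) (hw.ne hij)

theorem isSawNonneg_of_adj (h : (gkmGraph M).Adj v w) {k : Fin 2 → ℤ}
    (hk0 : (fun i => (k i : ℝ)) ≠ 0) (hk : (edgeWeight Ω v w ⬝ᵥ fun i => (k i : ℝ)) = 0)
    (hv : IsSawNonneg (torusFlow fun i => (k i : ℝ)) Ω.model (v : M)) :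
    IsSawNonneg (torusFlow fun i => (k i : ℝ)) Ω.model (w : M) := by
  obtain ⟨-, φ, hφ, s, hs, a, b, hab⟩ := isEdgeWeight_iff.1 (isEdgeWeight_edgeWeight hM h)
  obtain ⟨hfix, -⟩ := hφ.isInvariantSurface.fixed_and_range_eq hM (hs ▸ v.2) hab hk0 hk
  obtain ⟨s', hs'⟩ := (hφ.fixed.ge (mem_insert_of_mem _ rfl :
    (w : M) ∈ ({(v : M), (w : M)} : Set M))).1
  rw [← hs] at hv
  rw [← hs']
  exact (isCircleFlow_torusFlow (M := M) k).isSawNonneg_of_isSawNonneg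
    hφ.isInvariantSurface.contMDiff.continuous hfix hM.hamiltonian.isContinuousForm
    (fun n t u u' => hM.hamiltonian.pairing_inv (hfix n t) u u')
    hM.hamiltonian.nondegenerate hv s'

end Edges

/-! ### Linear polynomials and half-planes -/

section LinearPolynomials

theorem eval_linPoly (x α : Fin 2 → ℝ) : MvPolynomial.eval x (linPoly α) = α ⬝ᵥ x := by
  simp [linPoly, dotProduct]

theorem linPoly_smul (c : ℝ) (α : Fin 2 → ℝ) :
    linPoly (c • α) = MvPolynomial.C c * linPoly α := by
  simp only [linPoly, Finset.mul_sum, Pi.smul_apply, smul_eq_mul, MvPolynomial.C_mul, mul_assoc]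

theorem exists_eq_linPoly {f : MvPolynomial (Fin 2) ℝ} (hf : f.IsHomogeneous 1) :
    ∃ β, f = linPoly β := by
  have h1 : f ∈ MvPolynomial.homogeneousSubmodule (Fin 2) ℝ 1 := hf
  rw [MvPolynomial.homogeneousSubmodule_one_eq_span_X,
    Submodule.mem_span_range_iff_exists_fun] at h1
  obtain ⟨β, rfl⟩ := h1
  exact ⟨β, by simp only [linPoly, MvPolynomial.smul_eq_C_mul]⟩

/-- Divisibility is tested at `rot α`, a zero of the divisor; vanishing of the other form there
means that the two are parallel. -/
theorem exists_eq_smul_of_linPoly_dvd {α β : Fin 2 → ℝ} (hα : α ≠ 0) (h : linPoly α ∣ linPoly β) :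
    ∃ c : ℝ, β = c • α := by
  obtain ⟨g, hg⟩ := h
  have h1 := congrArg (MvPolynomial.eval (rot α)) hg
  rw [map_mul, eval_linPoly, eval_linPoly, dot_rot_self, zero_mul, dot_rot] at h1
  exact exists_eq_smul_of_det2_eq_zero hα h1

theorem eq_of_C_mul_linPoly_eq {α : Fin 2 → ℝ} (hα : α ≠ 0) {c c' : ℝ}
    (h : MvPolynomial.C c * linPoly α = MvPolynomial.C c' * linPoly α) : c = c' := by
  obtain ⟨ζ, hζ⟩ := exists_dot_eq_of_ne_zero hα 1
  have h1 := congrArg (MvPolynomial.eval ζ) h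
  simpa [eval_linPoly, hζ] using h1

/-- Two points on the same side of a line have the same sign with respect to its normal. -/
theorem mul_nonneg_of_wSameSide {A B x y : Fin 2 → ℝ} (h : (line[ℝ, A, B]).WSameSide x y)
    {η : Fin 2 → ℝ} (hη : (B - A) ⬝ᵥ η = 0) : 0 ≤ ((x - A) ⬝ᵥ η) * ((y - A) ⬝ᵥ η) := by
  obtain ⟨p₁, hp₁, p₂, hp₂, hr⟩ := h
  have h1 : ∀ p ∈ line[ℝ, A, B], ∀ x : Fin 2 → ℝ, (x - A) ⬝ᵥ η = (x -ᵥ p) ⬝ᵥ η := by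
    intro p hp x
    obtain ⟨r, rfl⟩ := mem_affineSpan_pair_iff_exists_lineMap_eq.1 hp
    rw [AffineMap.lineMap_apply_module', vsub_eq_sub, sub_dotProduct x, sub_dotProduct x,
      add_dotProduct, smul_dotProduct, hη, smul_zero, zero_add]
  rw [h1 _ hp₁ x, h1 _ hp₂ y]
  rcases hr with h0 | h0 | ⟨r₁, r₂, hr₁, hr₂, h0⟩
  · rw [h0]; simp
  · rw [h0]; simp
  · have h2 := congrArg (fun z => z ⬝ᵥ η) h0
    simp only [smul_dotProduct, smul_eq_mul] at h2
    set X := (x -ᵥ p₁) ⬝ᵥ η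
    set Y := (y -ᵥ p₂) ⬝ᵥ η
    have h3 : r₁ * (X * Y) = r₂ * (Y * Y) := by linear_combination Y * h2
    exact nonneg_of_mul_nonneg_right (h3 ▸ mul_nonneg hr₂.le (mul_self_nonneg Y)) hr₁

end LinearPolynomials

/-! ### Comparison of signs at the two ends of an edge -/

section SignComparison

variable {M : Type*} [TopologicalSpace M] [T2Space M] [ChartedSpace (EuclideanSpace ℝ (Fin 6)) M]
  [IsManifold (𝓡 6) ∞ M] [MulAction Torus M] [ContMDiffSMul ((𝓡 1).prod (𝓡 1)) (𝓡 6) ∞ Torus M]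
  {Ω : TwoForm M} {μ : M → Fin 2 → ℝ} {p q r d v b : MulAction.fixedPoints Torus M}

theorem injective_triple {V : Type*} {x y z : V} (h1 : x ≠ y) (h2 : x ≠ z) (h3 : y ≠ z) :
    Function.Injective ![x, y, z] := by
  intro i j hij
  fin_cases i <;> fin_cases j <;> simp_all

variable (hM : IsHamiltonianGKM Ω μ)
include hM

/-- Both weights are positive multiples of the difference of the moment images, taken in opposite
directions. -/
theorem exists_edgeWeight_swap (h : (gkmGraph M).Adj p q) :
    ∃ k : ℝ, k ≠ 0 ∧ edgeWeight Ω q p = k • edgeWeight Ω p q := by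
  obtain ⟨k, hk, hpq⟩ := exists_moment_sub_eq_smul hM h
  obtain ⟨k', hk', hqp⟩ := exists_moment_sub_eq_smul hM h.symm
  refine ⟨-(k / k'), neg_ne_zero.2 (div_pos hk hk').ne', ?_⟩
  have h1 : k' • edgeWeight Ω q p = -(k • edgeWeight Ω p q) := by
    rw [← hpq, ← hqp, neg_sub]
  have h2 : edgeWeight Ω q p = k'⁻¹ • (k' • edgeWeight Ω q p) := by
    rw [smul_smul, inv_mul_cancel₀ hk'.ne', one_smul]
  rw [h2, h1, smul_neg, smul_smul, neg_smul, div_eq_inv_mul]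

/-- If the circle of an edge has no negative weights at one end of the edge, then it has no
negative weights at the other end. -/
theorem edgeWeight_nonneg_of_adj (hpq : (gkmGraph M).Adj p q) (hpr : (gkmGraph M).Adj p r)
    (hpd : (gkmGraph M).Adj p d) (hqv : (gkmGraph M).Adj q v) (hqb : (gkmGraph M).Adj q b)
    (hqr : q ≠ r) (hqd : q ≠ d) (hrd : r ≠ d) (hpv : p ≠ v) (hpb : p ≠ b) (hvb : v ≠ b)
    {η : Fin 2 → ℝ} (hint : ∃ k : Fin 2 → ℤ, η = fun i => (k i : ℝ)) (hη0 : η ≠ 0)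
    (hη : edgeWeight Ω p q ⬝ᵥ η = 0)
    (h : 0 ≤ edgeWeight Ω p r ⬝ᵥ η ∧ 0 ≤ edgeWeight Ω p d ⬝ᵥ η) :
    0 ≤ edgeWeight Ω q v ⬝ᵥ η ∧ 0 ≤ edgeWeight Ω q b ⬝ᵥ η := by
  obtain ⟨k, rfl⟩ := hint
  have h1 := (isSawNonneg_iff_of_neighbours hM (v := p) (injective_triple hqr hqd hrd)
    (by intro i; fin_cases i <;> assumption) k).2 (by
      intro i
      fin_cases i
      · exact hη.ge
      · exact h.1
      · exact h.2)
  have h2 := (isSawNonneg_iff_of_neighbours hM (v := q) (injective_triple hpv hpb hvb)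
    (by intro i; fin_cases i; exacts [hpq.symm, hqv, hqb]) k).1
    (isSawNonneg_of_adj hM hpq hη0 hη h1)
  exact ⟨h2 1, h2 2⟩

/-- Along an edge whose adjacent edges on one side lie in one half plane, the adjacent edges on the
other side do so too. -/
theorem edgeWeight_mul_pos (hpq : (gkmGraph M).Adj p q) (hpr : (gkmGraph M).Adj p r)
    (hpd : (gkmGraph M).Adj p d) (hqv : (gkmGraph M).Adj q v) (hqb : (gkmGraph M).Adj q b)
    (hqr : q ≠ r) (hqd : q ≠ d) (hrd : r ≠ d) (hpv : p ≠ v) (hpb : p ≠ b) (hvb : v ≠ b)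
    (hside : (line[ℝ, μ p, μ q]).WSameSide (μ b) (μ d)) :
    0 < (edgeWeight Ω p r ⬝ᵥ rot (edgeWeight Ω p q)) *
      (edgeWeight Ω q v ⬝ᵥ rot (edgeWeight Ω p q)) := by
  set α := edgeWeight Ω p q with hα
  obtain ⟨k₀, hk₀, hswap⟩ := exists_edgeWeight_swap hM hpq
  have hα0 : α ≠ 0 := edgeWeight_ne_zero hM hpq
  have hint : ∃ k : Fin 2 → ℤ, rot α = fun i => (k i : ℝ) := by
    obtain ⟨a, b, hab⟩ := exists_isRotPlane_edgeWeight hM hpq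
    exact exists_int_rot hab.exists_int
  have hint' : ∃ k : Fin 2 → ℤ, -rot α = fun i => (k i : ℝ) := by
    obtain ⟨k, hk⟩ := hint
    exact ⟨-k, by rw [hk]; funext i; simp⟩
  have hη := dot_rot_self α
  have hη' : α ⬝ᵥ -rot α = 0 := by rw [dotProduct_neg, hη, neg_zero]
  have hη0 := rot_ne_zero hα0
  have hA : edgeWeight Ω p r ⬝ᵥ rot α ≠ 0 := by
    rw [dot_rot]; exact det2_edgeWeight_ne_zero hM hpq hpr hqr
  have hD : edgeWeight Ω p d ⬝ᵥ rot α ≠ 0 := by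
    rw [dot_rot]; exact det2_edgeWeight_ne_zero hM hpq hpd hqd
  have hdet : ∀ w, (gkmGraph M).Adj q w → p ≠ w → edgeWeight Ω q w ⬝ᵥ rot α ≠ 0 := by
    intro w hw hpw h0
    refine det2_edgeWeight_ne_zero hM hpq.symm hw hpw ?_
    rw [dot_rot] at h0
    rw [hswap, ← hα]
    simp only [det2, Pi.smul_apply, smul_eq_mul] at h0 ⊢
    linear_combination k₀ * h0
  have hV := hdet v hqv hpv
  have hB := hdet b hqb hpb
  -- The half-plane condition is used here: with respect to the normal of `pq`, `μ b` and `μ d` have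
  -- the signs of the weights of the edges `qb` and `pd`.
  have hDB : 0 ≤ (edgeWeight Ω q b ⬝ᵥ rot α) * (edgeWeight Ω p d ⬝ᵥ rot α) := by
    obtain ⟨k, hk, hpq'⟩ := exists_moment_sub_eq_smul hM hpq
    obtain ⟨kd, hkd, hpd'⟩ := exists_moment_sub_eq_smul hM hpd
    obtain ⟨kb, hkb, hqb'⟩ := exists_moment_sub_eq_smul hM hqb
    have h0 : (μ q - μ p) ⬝ᵥ rot α = 0 := by
      rw [hpq', smul_dotProduct, hη, smul_zero]
    have h1 := mul_nonneg_of_wSameSide hside h0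
    have h2 : (μ b - μ p) ⬝ᵥ rot α = kb * (edgeWeight Ω q b ⬝ᵥ rot α) := by
      rw [← sub_add_sub_cancel (μ b) (μ q) (μ p), add_dotProduct, h0, add_zero, hqb',
        smul_dotProduct, smul_eq_mul]
    rw [h2, hpd', smul_dotProduct, smul_eq_mul] at h1
    have h3 : 0 ≤ (kb * kd) * ((edgeWeight Ω q b ⬝ᵥ rot α) * (edgeWeight Ω p d ⬝ᵥ rot α)) := by
      linarith
    exact nonneg_of_mul_nonneg_right h3 (mul_pos hkb hkd)
  -- Nonnegativity is transported in both directions along the edge and for both orientations of the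
  -- circle.
  have key := fun η => edgeWeight_nonneg_of_adj (η := η) hM hpq hpr hpd hqv hqb hqr hqd hrd hpv hpb hvb
  have key' := fun η => edgeWeight_nonneg_of_adj (η := η) hM hpq.symm hqv hqb hpr hpd hpv hpb hvb hqr hqd hrd
  have hηq : edgeWeight Ω q p ⬝ᵥ rot α = 0 := by
    rw [hswap, smul_dotProduct, hη, smul_zero]
  have hηq' : edgeWeight Ω q p ⬝ᵥ -rot α = 0 := by rw [dotProduct_neg, hηq, neg_zero]
  have k1 := key _ hint hη0 hη
  have k2 := key _ hint' (neg_ne_zero.2 hη0) hη'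
  have k3 := key' _ hint hη0 hηq
  have k4 := key' _ hint' (neg_ne_zero.2 hη0) hηq'
  simp only [dotProduct_neg] at k2 k4
  generalize edgeWeight Ω p r ⬝ᵥ rot α = A at *
  generalize edgeWeight Ω p d ⬝ᵥ rot α = D at *
  generalize edgeWeight Ω q v ⬝ᵥ rot α = V at *
  generalize edgeWeight Ω q b ⬝ᵥ rot α = B at *
  have hDB' : 0 < B * D := lt_of_le_of_ne hDB (mul_ne_zero hB hD).symm
  -- `D` and `B` have the same sign. If `A` and `V` had opposite signs, exactly one end would have
  -- two equal signs, and the matching transport statement would contradict the other end.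
  rcases lt_or_gt_of_ne hA with hA' | hA' <;> rcases lt_or_gt_of_ne hV with hV' | hV'
  · exact mul_pos_of_neg_of_neg hA' hV'
  · exfalso
    rcases lt_or_gt_of_ne hD with hD' | hD'
    · linarith [k2 ⟨by linarith, by linarith⟩]
    · have : 0 < B := pos_of_mul_pos_left hDB' hD'.le
      linarith [k3 ⟨by linarith, by linarith⟩]
  · exfalso
    rcases lt_or_gt_of_ne hD with hD' | hD'
    · have : B < 0 := neg_of_mul_pos_left hDB' hD'.le
      linarith [k4 ⟨by linarith, by linarith⟩]
    · linarith [k1 ⟨by linarith, by linarith⟩]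
  · exact mul_pos hA' hV'

end SignComparison

/-! ### Ascending paths, indices and the ascending cycle -/

section AscendingPaths

variable {M : Type*} [TopologicalSpace M] [ChartedSpace (EuclideanSpace ℝ (Fin 6)) M]
  [MulAction Torus M] {Ω : TwoForm M} {μ : M → Fin 2 → ℝ} {ξ : Fin 2 → ℝ}
  {p q r d v w b : MulAction.fixedPoints Torus M}

theorem eq_or_lt_of_mem_ascVertices (hinc : IsIndexIncreasing μ ξ) (h : w ∈ ascVertices μ ξ v) :
    w = v ∨ (μ v ⬝ᵥ ξ < μ w ⬝ᵥ ξ ∧ morseIndex μ ξ v < morseIndex μ ξ w) := by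
  induction h with
  | refl => exact Or.inl rfl
  | tail _ h ih =>
    right
    have h1 := hinc _ _ h
    rcases ih with rfl | ih
    · exact ⟨h.2, h1⟩
    · exact ⟨ih.1.trans h.2, ih.2.trans h1⟩

theorem notMem_ascVertices_of_ascends (hinc : IsIndexIncreasing μ ξ) (h : Ascends μ ξ w v) :
    w ∉ ascVertices μ ξ v := by
  intro h1
  rcases eq_or_lt_of_mem_ascVertices hinc h1 with rfl | h2
  · exact lt_irrefl _ h.2
  · exact lt_asymm h2.1 h.2

theorem exists_downNbrs_eq_singleton (hp : morseIndex μ ξ p = 2) : ∃ r, downNbrs μ ξ p = {r} := by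
  rw [morseIndex] at hp
  exact ncard_eq_one.1 (by omega)

/-- A vertex of index four has exactly one further neighbour below it. -/
theorem exists_downNbrs_eq_pair (hq : morseIndex μ ξ q = 4) (h : p ∈ downNbrs μ ξ q) :
    ∃ v, v ≠ p ∧ downNbrs μ ξ q = {p, v} := by
  rw [morseIndex] at hq
  obtain ⟨x, y, hxy, h1⟩ := ncard_eq_two.1 (show (downNbrs μ ξ q).ncard = 2 by omega)
  rw [h1] at h ⊢
  rcases h with rfl | rfl
  · exact ⟨y, hxy.symm, rfl⟩
  · exact ⟨x, hxy, pair_comm _ _⟩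

/-- The vertex below `q` that differs from `p` cannot be reached from `p`. -/
theorem notMem_ascVertices_of_index (hinc : IsIndexIncreasing μ ξ) (hp : morseIndex μ ξ p = 2)
    (hq : morseIndex μ ξ q = 4) (hv : Ascends μ ξ v q) (hne : v ≠ p) : v ∉ ascVertices μ ξ p := by
  intro h1
  rcases eq_or_lt_of_mem_ascVertices hinc h1 with h2 | h2
  · exact hne h2
  · have h3 := hinc _ _ hv
    have h4 := h2.2
    simp only [morseIndex] at hp hq h3 h4
    omega

variable [T2Space M] [IsManifold (𝓡 6) ∞ M] [ContMDiffSMul ((𝓡 1).prod (𝓡 1)) (𝓡 6) ∞ Torus M]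

/-- The difference of the moment images is a positive multiple of an isotropy weight, and genericity
keeps that weight from vanishing on `ξ`. -/
theorem ascends_or_ascends (hM : IsHamiltonianGKM Ω μ) (hξ : IsGeneric Ω ξ)
    (h : (gkmGraph M).Adj v w) : Ascends μ ξ v w ∨ Ascends μ ξ w v := by
  obtain ⟨a, b, hab⟩ := exists_isRotPlane_edgeWeight hM h
  have h1 := hξ v v.2 _ ⟨a, b, isWeightPlane_iff.2 hab⟩
  obtain ⟨k, hk, hvw⟩ := exists_moment_sub_eq_smul hM h
  have h2 : (μ w - μ v) ⬝ᵥ ξ ≠ 0 := by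
    rw [hvw, smul_dotProduct, smul_eq_mul]
    exact mul_ne_zero hk.ne' h1
  rw [sub_dotProduct, sub_ne_zero] at h2
  rcases lt_or_gt_of_ne h2 with h3 | h3
  · exact Or.inr ⟨h.symm, h3⟩
  · exact Or.inl ⟨h, h3⟩

theorem ascends_of_index_lt (hM : IsHamiltonianGKM Ω μ) (hξ : IsGeneric Ω ξ)
    (hinc : IsIndexIncreasing μ ξ) (h : (gkmGraph M).Adj p q)
    (hlt : morseIndex μ ξ p < morseIndex μ ξ q) : Ascends μ ξ p q :=
  (ascends_or_ascends hM hξ h).resolve_right fun h1 => lt_asymm hlt (hinc _ _ h1)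

/-- In a convex tetragonal ascending cycle, the edges adjacent to the edge `pq` and not belonging to
the cycle point to the same side of it. -/
theorem edgeWeight_mul_pos_of_cycle (hM : IsHamiltonianGKM Ω μ) (hξ : IsGeneric Ω ξ)
    (hinc : IsIndexIncreasing μ ξ) (hp : morseIndex μ ξ p = 2) (hq : morseIndex μ ξ q = 4)
    (hpq : (gkmGraph M).Adj p q) (hconv : IsConvexTetragonalCycle μ ξ p)
    (hr : Ascends μ ξ r p) (hv : Ascends μ ξ v q) (hvp : v ≠ p) :
    0 < (edgeWeight Ω p r ⬝ᵥ rot (edgeWeight Ω p q)) *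
      (edgeWeight Ω q v ⬝ᵥ rot (edgeWeight Ω p q)) := by
  obtain ⟨a, b, d, ⟨hvert, hcard, hpa, hab, hbd, hdp⟩, hside⟩ := hconv
  have hasc : Ascends μ ξ p q := ascends_of_index_lt hM hξ hinc hpq (by omega)
  have hr' := notMem_ascVertices_of_ascends hinc hr
  have hv' := notMem_ascVertices_of_index hinc hp hq hv hvp
  have hq' : q ∈ ascVertices μ ξ p := Relation.ReflTransGen.single hasc
  have hpne : q ≠ p := hpq.ne'
  rw [hvert] at hr' hv' hq' hcard
  simp only [mem_insert_iff, mem_singleton_iff, not_or] at hr' hv' hq'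
  obtain ⟨hrp, hra, hrb, hrd⟩ := hr'
  obtain ⟨-, hva, hvb, hvd⟩ := hv'
  -- Opposite vertices of the cycle are distinct because it has four vertices.
  have hdist : p ≠ b ∧ a ≠ d := by
    constructor
    · rintro rfl
      have h1 : ({p, a, p, d} : Set (MulAction.fixedPoints Torus M)) = {p, a, d} := by
        ext; simp; tauto
      have h2 := ncard_insert_le p ({a, d} : Set (MulAction.fixedPoints Torus M))
      have h3 := ncard_insert_le a ({d} : Set (MulAction.fixedPoints Torus M))
      rw [ncard_singleton] at h3
      rw [h1] at hcard
      omega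
    · rintro rfl
      have h1 : ({p, a, b, a} : Set (MulAction.fixedPoints Torus M)) = {p, a, b} := by
        ext; simp; tauto
      have h2 := ncard_insert_le p ({a, b} : Set (MulAction.fixedPoints Torus M))
      have h3 := ncard_insert_le a ({b} : Set (MulAction.fixedPoints Torus M))
      rw [ncard_singleton] at h3
      rw [h1] at hcard
      omega
  obtain ⟨hpb, had⟩ := hdist
  rcases hq' with rfl | rfl | rfl | rfl
  · exact absurd rfl hpne
  · refine edgeWeight_mul_pos hM hpq hr.1.symm hdp.symm hv.1.symm hab (Ne.symm hra) had hrd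
      hvp.symm hpb hvb (hside.1 _ ?_ _ ?_) <;> simp
  -- If `q` were opposite to `p`, then `p` would have the four neighbours `a`, `d`, `q` and `r`.
  · refine (not_four_neighbours hM (v := p) (w := ![a, d, q, r]) ?_ ?_).elim
    · have h1 := hab.ne
      have h2 := hbd.ne
      intro i j hij
      fin_cases i <;> fin_cases j <;> simp_all
    · intro i
      fin_cases i
      exacts [hpa, hdp.symm, hpq, hr.1.symm]
  · refine edgeWeight_mul_pos hM hpq hr.1.symm hpa hv.1.symm hbd.symm (Ne.symm hrd) had.symm hra
      hvp.symm hpb hvb ?_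
    -- In the cyclic order the last side runs from `q` to `p`.
    rw [pair_comm]
    refine hside.2.2.2 _ ?_ _ ?_ <;> simp

end AscendingPaths

/-! ### Values of the Thom class at the ends of an edge -/

section ThomCoefficient

variable {M : Type*} [TopologicalSpace M] [ChartedSpace (EuclideanSpace ℝ (Fin 6)) M]
  [MulAction Torus M] {Ω : TwoForm M} {μ : M → Fin 2 → ℝ} {ξ : Fin 2 → ℝ}
  {p q r d v w b : MulAction.fixedPoints Torus M}
  {τ : MulAction.fixedPoints Torus M → MvPolynomial (Fin 2) ℝ}
  [T2Space M] [IsManifold (𝓡 6) ∞ M] [ContMDiffSMul ((𝓡 1).prod (𝓡 1)) (𝓡 6) ∞ Torus M]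
  (hM : IsHamiltonianGKM Ω μ) (hτ : IsThomClass Ω μ ξ p τ)
include hM hτ

/-- Below a vertex `q` and outside the support, the Thom class forces its value at `q`. -/
theorem IsThomClass.exists_eq_C_mul (hp : morseIndex μ ξ p = 2) (hqv : (gkmGraph M).Adj q v)
    (hv : v ∉ ascVertices μ ξ p) :
    ∃ c : ℝ, τ q = MvPolynomial.C c * linPoly (edgeWeight Ω q v) := by
  have hv0 : τ v = 0 := by
    by_contra h
    exact hv (hτ.support v h)
  have h1 := hτ.graphClass q v hqv
  have h2 := hτ.homogeneous q
  rw [hp] at h2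
  obtain ⟨β, hβ⟩ := exists_eq_linPoly h2
  obtain ⟨k, hk, hkv⟩ := exists_moment_sub_eq_smul hM hqv
  rw [hv0, sub_zero, hβ, hkv] at h1
  obtain ⟨c, hc⟩ := exists_eq_smul_of_linPoly_dvd
    (smul_ne_zero hk.ne' (edgeWeight_ne_zero hM hqv)) h1
  refine ⟨c * k, ?_⟩
  rw [hβ, hc, smul_smul, linPoly_smul]

/-- The two values of the Thom class agree on the line of the edge `pq`. -/
theorem IsThomClass.edgeWeight_dot_eq (hpq : (gkmGraph M).Adj p q) (hr : downNbrs μ ξ p = {r})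
    {c : ℝ} (hc : τ q = MvPolynomial.C c * linPoly (edgeWeight Ω q v)) :
    edgeWeight Ω p r ⬝ᵥ rot (edgeWeight Ω p q) =
      c * (edgeWeight Ω q v ⬝ᵥ rot (edgeWeight Ω p q)) := by
  have h1 := hτ.value
  rw [hr, finprod_mem_singleton] at h1
  obtain ⟨g, hg⟩ := hτ.graphClass p q hpq
  obtain ⟨k, hk, hkq⟩ := exists_moment_sub_eq_smul hM hpq
  -- Evaluation at a point of the kernel of `α_{p,q}` removes the multiple of the edge form.
  have h2 := congrArg (MvPolynomial.eval (rot (edgeWeight Ω p q))) hg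
  rw [h1, hc, hkq] at h2
  simp only [map_sub, map_mul, eval_linPoly, MvPolynomial.eval_C, smul_dotProduct, dot_rot_self,
    smul_zero, zero_mul] at h2
  linarith

end ThomCoefficient

end HamGKM
end

theorem mainTheorem4
    {M : Type*} [TopologicalSpace M] [T2Space M] [CompactSpace M]
    [ChartedSpace (EuclideanSpace ℝ (Fin 6)) M] [IsManifold (𝓡 6) ∞ M]
    [MulAction HamGKM.Torus M]
    [ContMDiffSMul ((𝓡 1).prod (𝓡 1)) (𝓡 6) ∞ HamGKM.Torus M]
    (Ω : HamGKM.TwoForm M) (μ : M → Fin 2 → ℝ) (hM : HamGKM.IsHamiltonianGKM Ω μ)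
    (ξ : Fin 2 → ℝ) (hξ : HamGKM.IsGeneric Ω ξ) (hinc : HamGKM.IsIndexIncreasing μ ξ)
    (p q : MulAction.fixedPoints HamGKM.Torus M)
    (hp : HamGKM.morseIndex μ ξ p = 2) (hq : HamGKM.morseIndex μ ξ q = 4)
    (hpq : (HamGKM.gkmGraph M).Adj p q)
    (hconv : HamGKM.IsConvexTetragonalCycle μ ξ p)
    (τ : MulAction.fixedPoints HamGKM.Torus M → MvPolynomial (Fin 2) ℝ)
    (hτ : HamGKM.IsThomClass Ω μ ξ p τ) :
    (∃! c : ℝ, HamGKM.IsThomCoefficient Ω μ ξ τ p q c) ∧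
      ∀ c : ℝ, HamGKM.IsThomCoefficient Ω μ ξ τ p q c → 0 < c := by
  have hasc := HamGKM.ascends_of_index_lt hM hξ hinc hpq (by omega)
  obtain ⟨r, hr⟩ := HamGKM.exists_downNbrs_eq_singleton hp
  have hrp : HamGKM.Ascends μ ξ r p := by
    have : r ∈ HamGKM.downNbrs μ ξ p := hr ▸ rfl
    exact this
  constructor
  · obtain ⟨v, hvp, hv⟩ := HamGKM.exists_downNbrs_eq_pair hq hasc
    have hvq : HamGKM.Ascends μ ξ v q := by
      have : v ∈ HamGKM.downNbrs μ ξ q := hv ▸ Set.mem_insert_of_mem _ rfl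
      exact this
    obtain ⟨c, hc⟩ := hτ.exists_eq_C_mul hM hp hvq.1.symm
      (HamGKM.notMem_ascVertices_of_index hinc hp hq hvq hvp)
    refine ⟨c, ⟨v, hvp, hvq, hc⟩, ?_⟩
    rintro c' ⟨v', hv'p, hv'q, hc'⟩
    obtain rfl : v' = v := by
      rw [hv] at hv'q
      exact hv'q.resolve_left hv'p
    exact HamGKM.eq_of_C_mul_linPoly_eq (HamGKM.edgeWeight_ne_zero hM hvq.1.symm)
      (hc'.symm.trans hc)
  · rintro c ⟨v, hvp, hvq, hc⟩
    have h1 := HamGKM.edgeWeight_mul_pos_of_cycle hM hξ hinc hp hq hpq hconv hrp hvq hvp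
    -- The positive product becomes `c` times the square of `⟨α_{q,v}, rot α_{p,q}⟩`.
    rw [hτ.edgeWeight_dot_eq hM hpq hr hc, mul_assoc] at h1
    exact pos_of_mul_pos_left h1 (mul_self_nonneg _)
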